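/- Let $k$ be a field. A simplicial complex $\Delta$ on a finite vertex set $V$, $|V| = n$, is a family of subsets of $V$ (faces) closed under taking subsets that contains $\emptyset$ and $\{v\}$ for every $v \in V$. It is a simplex if $V$ itself is a face. Let $S = k[x_v : v \in V]$ be the standard graded polynomial ring, let $I_\Delta \subseteq S$ be the Stanley–Reisner ideal, generated by the monomials $\prod_{v \in s} x_v$ with $s$ a non-face, and let $k[\Delta] = S/I_\Delta$. Let $d$ be the largest number of vertices of a face, and let $c = n - d$ be the codimension of $\Delta$. The modified type and the type defect of $\Delta$ are $$\operatorname{type}(\Delta) = \dim_k \operatorname{Tor}^S_c(S/I_\Delta, k) - \dim_k \operatorname{Tor}^S_c(S/I_\Delta, k)_c, \qquad \operatorname{td}(\Delta) = \operatorname{type}(\Delta) - c,$$ where the subscript $c$ outside $\operatorname{Tor}$ denotes the component of internal degree $c$. The complex $\Delta$ is called Cohen–Macaulay (Gorenstein) if the graded ring $k[\Delta]$ is Cohen–Macaulay (Gorenstein). Let $\Delta_1$ and $\Delta_2$ be simplicial complexes on disjoint finite vertex sets $V_1$ and $V_2$, and let $\Delta = \Delta_1 * \Delta_2 = \{F_1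 \cup F_2 : F_1 \in \Delta_1, F_2 \in \Delta_2\}$ be their join, on the vertex set $V_1 \cup V_2$. Then: 1. If $\Delta_2$ is a simplex, then $\operatorname{td}(\Delta) = \operatorname{td}(\Delta_1)$. 2. In all cases $\operatorname{td}(\Delta) \ge \operatorname{td}(\Delta_1) + \operatorname{td}(\Delta_2) - 1$. Equality holds if and only if $\Delta_1$ and $\Delta_2$ are both Cohen–Macaulay, neither of them is a simplex, and at least one of them is Gorenstein. -/

import Mathlib

open CategoryTheory

universe u v w

/-!
# Stanley–Reisner rings, type defect, and joins

A simplicial complex with vertex set `V` is an `AbstractSimplicialComplex V`: a downward closed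
family of nonempty finite subsets of `V` that contains all singletons (so every element of `V` is a
vertex). The empty face is tacitly a face of every complex; with `V` empty, the only complex is the
complex whose only face is the empty one.
-/

namespace AbstractSimplicialComplex

/-- `Δ` is a (full) simplex: every nonempty set of vertices is a face. -/
def IsSimplex {V : Type u} (Δ : AbstractSimplicialComplex V) : Prop :=
  ∀ s : Finset V, s.Nonempty → s ∈ Δ

/-- The join `Δ₁ * Δ₂` on the disjoint union of the two vertex sets: the faces are the disjoint
unions of a (possibly empty) face of `Δ₁` and a (possibly empty) face of `Δ₂`. -/
def join {V₁ : Type u} {V₂ : Type v} (Δ₁ : AbstractSimplicialComplex V₁)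
    (Δ₂ : AbstractSimplicialComplex V₂) : AbstractSimplicialComplex (V₁ ⊕ V₂) where
  faces := {s | s.Nonempty ∧ (s.toLeft.Nonempty → s.toLeft ∈ Δ₁) ∧
    (s.toRight.Nonempty → s.toRight ∈ Δ₂)}
  isRelLowerSet_faces := by
    rintro s ⟨hs, h₁, h₂⟩
    refine ⟨hs, fun t hts ht => ⟨ht, fun hl => ?_, fun hr => ?_⟩⟩
    · have hsub : t.toLeft ⊆ s.toLeft := Finset.toLeft_subset_toLeft hts
      exact (Δ₁.isRelLowerSet_faces (h₁ (hl.mono hsub))).2 hsub hl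
    · have hsub : t.toRight ⊆ s.toRight := Finset.toRight_subset_toRight hts
      exact (Δ₂.isRelLowerSet_faces (h₂ (hr.mono hsub))).2 hsub hr
  singleton_mem := by
    rintro (a | b)
    · refine ⟨Finset.singleton_nonempty _, fun _ => ?_, fun h => ?_⟩
      · have : ({Sum.inl a} : Finset (V₁ ⊕ V₂)).toLeft = {a} := by ext; simp
        rw [this]; exact Δ₁.singleton_mem a
      · obtain ⟨x, hx⟩ := h
        simp at hx
    · refine ⟨Finset.singleton_nonempty _, fun h => ?_, fun _ => ?_⟩
      · obtain ⟨x, hx⟩ := h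
        simp at hx
      · have : ({Sum.inr b} : Finset (V₁ ⊕ V₂)).toRight = {b} := by ext; simp
        rw [this]; exact Δ₂.singleton_mem b

section Koszul

/-! The homology of the Koszul complex `K_•(x_v : v ∈ V; A)` of a finite family of degree one elements
of a graded `k`-algebra `A`. The term `K_i = A ⊗ Λ^i k^V` (exterior generators `e_v` in degree one) is
realised as the space of alternating functions `f` of `i`-tuples in `V` with values in `A`; the value
`f (v₁, …, v_i)` is the coefficient at `e_{v₁} ∧ ⋯ ∧ e_{v_i}`. -/

variable (k : Type w) [Field k] {V : Type u} {A : Type v} [CommRing A] [Algebra k A]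

/-- The Koszul differential `K_{i+1} → K_i`,
`(∂ f)(v₁, …, v_i) = ∑_y x_y · f(y, v₁, …, v_i)`. -/
noncomputable def koszulDifferential [Fintype V] (x : V → A) (i : ℕ) :
    ((Fin (i + 1) → V) → A) →ₗ[k] ((Fin i → V) → A) where
  toFun f := fun s => ∑ y : V, x y * f (Fin.cons y s)
  map_add' f g := by
    ext s
    simp [mul_add, Finset.sum_add_distrib]
  map_smul' c f := by
    ext s
    simp [Finset.smul_sum]

/-- The degree `j` strand of `K_i`, where `piece e` is the degree `e` component of `A`: the alternating
functions with values in the degree `j - i` component of `A` (which is `0` for `j < i`). -/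
noncomputable def koszulStrand (V : Type u) (piece : ℕ → Submodule k A) (i j : ℕ) :
    Submodule k ((Fin i → V) → A) where
  carrier := {f | (∀ s, ¬ Function.Injective s → f s = 0) ∧
    (∀ s (σ : Equiv.Perm (Fin i)), f (s ∘ σ) = (Equiv.Perm.sign σ : ℤ) • f s) ∧
    ∀ s, f s ∈ (if i ≤ j then piece (j - i) else ⊥)}
  add_mem' := by
    rintro f g ⟨hf₁, hf₂, hf₃⟩ ⟨hg₁, hg₂, hg₃⟩
    refine ⟨fun s hs => ?_, fun s σ => ?_, fun s => Submodule.add_mem _ (hf₃ s) (hg₃ s)⟩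
    · simp [hf₁ s hs, hg₁ s hs]
    · simp only [Pi.add_apply, hf₂ s σ, hg₂ s σ, smul_add]
  zero_mem' := ⟨fun _ _ => rfl, fun _ _ => by simp, fun _ => Submodule.zero_mem _⟩
  smul_mem' := by
    rintro c f ⟨hf₁, hf₂, hf₃⟩
    refine ⟨fun s hs => ?_, fun s σ => ?_, fun s => Submodule.smul_mem _ c (hf₃ s)⟩
    · simp [hf₁ s hs]
    · simp only [Pi.smul_apply, hf₂ s σ, smul_comm c]

/-- The degree `j` cycles in `K_i`. -/
noncomputable def koszulCycles [Fintype V] (x : V → A) (piece : ℕ → Submodule k A) : (i j : ℕ) →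
    Submodule k ((Fin i → V) → A)
  | 0, j => koszulStrand k V piece 0 j
  | i + 1, j => koszulStrand k V piece (i + 1) j ⊓ LinearMap.ker (koszulDifferential k x i)

/-- The degree `j` boundaries in `K_i`. -/
noncomputable def koszulBoundaries [Fintype V] (x : V → A) (piece : ℕ → Submodule k A) (i j : ℕ) :
    Submodule k ((Fin i → V) → A) :=
  (koszulStrand k V piece (i + 1) j).map (koszulDifferential k x i)

/-- The degree `j` component of the `i`-th Koszul homology: cycles modulo boundaries. -/
abbrev koszulHomology [Fintype V] (x : V → A) (piece : ℕ → Submodule k A) (i j : ℕ) :=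
  koszulCycles k x piece i j ⧸
    (koszulBoundaries k x piece i j).submoduleOf (koszulCycles k x piece i j)

end Koszul

section StanleyReisner

variable (k : Type w) [Field k] {V : Type u} (Δ : AbstractSimplicialComplex V)

/-- The Stanley–Reisner ideal `I_Δ`, generated by the squarefree monomials of the non-faces. -/
noncomputable def stanleyReisnerIdeal : Ideal (MvPolynomial V k) :=
  Ideal.span {p | ∃ s : Finset V, s.Nonempty ∧ s ∉ Δ ∧ p = ∏ x ∈ s, MvPolynomial.X x}

/-- The Stanley–Reisner ring `k[Δ] = S / I_Δ`, where `S = k[x_v : v ∈ V]`. -/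
abbrev stanleyReisnerRing : Type (max u w) :=
  MvPolynomial V k ⧸ stanleyReisnerIdeal k Δ

/-- The irrelevant ideal of `k[Δ]`, generated by the residue classes of the variables. -/
noncomputable def irrelevantIdeal : Ideal (stanleyReisnerRing k Δ) :=
  Ideal.span (Set.range fun x : V =>
    Ideal.Quotient.mk (stanleyReisnerIdeal k Δ) (MvPolynomial.X x))

/-- `Δ` is Cohen–Macaulay over `k`: the graded ring `k[Δ]` is Cohen–Macaulay, i.e. its depth equals
its Krull dimension: some `k[Δ]`-regular sequence in the irrelevant ideal has length
`dim k[Δ]`. -/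
def IsCohenMacaulay : Prop :=
  ∃ rs : List (stanleyReisnerRing k Δ), (∀ r ∈ rs, r ∈ irrelevantIdeal k Δ) ∧
    RingTheory.Sequence.IsRegular (stanleyReisnerRing k Δ) rs ∧
    (rs.length : WithBot ℕ∞) = ringKrullDim (stanleyReisnerRing k Δ)

/-- `Δ` is Gorenstein over `k`: the graded ring `R = k[Δ]` is Gorenstein, i.e. it is
Cohen–Macaulay and `Ext_R^d(k, R) ≅ k`, where `d = dim R` and `k` is the residue field of `R` at the
irrelevant ideal. -/
def IsGorenstein : Prop :=
  IsCohenMacaulay k Δ ∧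
    ∃ d : ℕ, (d : WithBot ℕ∞) = ringKrullDim (stanleyReisnerRing k Δ) ∧
      Nonempty (Abelian.Ext
          (ModuleCat.of (stanleyReisnerRing k Δ) (stanleyReisnerRing k Δ ⧸ irrelevantIdeal k Δ))
          (ModuleCat.of (stanleyReisnerRing k Δ) (stanleyReisnerRing k Δ)) d
        ≃ₗ[stanleyReisnerRing k Δ] (stanleyReisnerRing k Δ ⧸ irrelevantIdeal k Δ))

/-- The `S`-module `Tor_i^S(S / I_Δ, k)`, where `k = S / (x_v : v ∈ V)`. -/
noncomputable def torModule (i : ℕ) : ModuleCat.{max u w} (MvPolynomial V k) :=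
  ((Tor (ModuleCat.{max u w} (MvPolynomial V k)) i).obj
      (ModuleCat.of (MvPolynomial V k) (stanleyReisnerRing k Δ))).obj
    (ModuleCat.of (MvPolynomial V k)
      (MvPolynomial V k ⧸ Ideal.span (Set.range (MvPolynomial.X : V → MvPolynomial V k))))

/-- The total Betti number `b_i(S / I_Δ) = dim_k Tor_i^S(S / I_Δ, k)`. -/
noncomputable def bettiNumber (i : ℕ) : ℕ :=
  Module.finrank k ((ModuleCat.restrictScalars
    (algebraMap k (MvPolynomial V k))).obj (torModule k Δ i))

/-- The degree `e` component of the graded ring `k[Δ]`. -/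
noncomputable def gradedPiece (e : ℕ) : Submodule k (stanleyReisnerRing k Δ) :=
  (MvPolynomial.homogeneousSubmodule V k e).map
    (Ideal.Quotient.mkₐ k (stanleyReisnerIdeal k Δ)).toLinearMap

/-- The graded Betti number `b_{i,j}(S / I_Δ) = dim_k Tor_i^S(S / I_Δ, k)_j`. The grading of `Tor` is the
one computed by the Koszul resolution of `k` over `S`: `Tor_i^S(k[Δ], k)_j` is the degree `j` component
of the `i`-th homology of the Koszul complex of the variables on `k[Δ]`. -/
noncomputable def gradedBettiNumber [Fintype V] (i j : ℕ) : ℕ :=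
  Module.finrank k (koszulHomology k
    (fun y : V => Ideal.Quotient.mk (stanleyReisnerIdeal k Δ) (MvPolynomial.X y))
    (gradedPiece k Δ) i j)

section TypeDefect

variable [Fintype V]

open Classical in
/-- The codimension `c = n - d`, where `n` is the number of vertices and `d` is the largest number
of vertices of a face (so `dim Δ = d - 1`). -/
noncomputable def codim : ℕ :=
  Fintype.card V - (Finset.univ.filter fun s : Finset V => s ∈ Δ).sup Finset.card

/-- The modified type `dim Tor_c^S(S / I_Δ, k) - dim Tor_c^S(S / I_Δ, k)_c`. -/
noncomputable def modifiedType : ℤ :=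
  (bettiNumber k Δ Δ.codim : ℤ) - (gradedBettiNumber k Δ Δ.codim Δ.codim : ℤ)

/-- The type defect `td(Δ)`: modified type minus codimension. -/
noncomputable def typeDefect : ℤ :=
  modifiedType k Δ - (Δ.codim : ℤ)

end TypeDefect

end StanleyReisner

end AbstractSimplicialComplex

/-!
Write `b_i` for the total Betti numbers of a Stanley–Reisner ring `k[Δ]` over the polynomial ring
`S`, and `c` for the codimension. The type defect is `b_c - c` unless `Δ` is a simplex, in which
case `c = 0`, `b_0 = 1` is cancelled by its degree zero part, and the type defect is `0`. (In
positive codimension nothing is subtracted, because the variables are linearly independent in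
`k[Δ]`: `gradedBettiNumber_self`.)

The ring of a join is the tensor product of the two rings, so that the Künneth formula gives
`b_n(Δ₁ * Δ₂) = ∑ b_p(Δ₁) b_q(Δ₂)` over `p + q = n` (`bettiNumber_join`), while codimensions add up.
If one factor is a simplex, its only nonzero Betti number is `b_0 = 1`, and the type defect is that
of the other factor. Otherwise the Künneth sum at `n = c₁ + c₂` consists of the product of
`b_{c₁}(Δ₁) ≥ 1` and `b_{c₂}(Δ₂) ≥ 1` and of further summands, with sum `r ≥ 0`, and

`td(Δ₁ * Δ₂) - (td(Δ₁) + td(Δ₂) - 1) = (b_{c₁}(Δ₁) - 1) (b_{c₂}(Δ₂) - 1) + r ≥ 0`.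

Equality means that `r = 0` and that `b_{c₁}(Δ₁) = 1` or `b_{c₂}(Δ₂) = 1`. Now `r = 0` if and only
if all `b_i(Δ_j)` with `i > c_j` vanish, i.e. both complexes are Cohen–Macaulay
(`isCohenMacaulay_iff`); for this one needs that the Betti numbers below a nonzero one are nonzero.
A Cohen–Macaulay complex is Gorenstein if and only if `b_c = 1` (`isGorenstein_iff`).

The homological input is developed for the Koszul complex of a finite family `x` of elements of a
ring, presented by a matrix (`KoszulFrame`):

* If `x` is the family of variables, its homology with coefficients in `k[Δ]` computes the torsion
  products in the definition of the Betti numbers (`KoszulFrame.finrank_tor`).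
* The number of highest homology groups that vanish is the maximal length of a regular sequence in
  `(x)` (`KoszulFrame.vanish_of_isWeaklyRegular`, `KoszulFrame.exists_isRegular_of_vanish`).
  Together with `dim k[Δ] = |V| - c` and depth at most dimension this gives `b_c ≠ 0` and the
  criterion for the Cohen–Macaulay property.
* A vanishing homology group forces all later ones to vanish (`KoszulFrame.vanish_of_le`).
* Dividing by a regular sequence `rs` of length `d = dim k[Δ]` turns `b_c` into the dimension of the
  socle of `R / (rs)`, where `R = k[Δ]` (`KoszulFrame.betti_top_quotient`, `KoszulFrame.betti_top`).
  By Rees' theorem (`nonempty_ext_linearEquiv`) this socle is also `Ext_R^d(k, R)`.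
-/

/-! ### Matrices acting on module-valued functions -/

section MatrixAction

variable {A I M N : Type*} [CommRing A] [Fintype I] [AddCommGroup M] [Module A M]
  [AddCommGroup N] [Module A N]

/-- The action of an `A`-valued square matrix on column vectors with entries in an `A`-module. -/
def matAct (M : Type*) [AddCommGroup M] [Module A M] (D : Matrix I I A) :
    (I → M) →ₗ[A] (I → M) where
  toFun f a := ∑ b, D a b • f b
  map_add' f g := by ext a; simp [Finset.sum_add_distrib]
  map_smul' c f := by
    ext a
    simp only [Pi.smul_apply, Finset.smul_sum, RingHom.id_apply]
    exact Finset.sum_congr rfl fun b _ => smul_comm _ _ _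

lemma matAct_apply (D : Matrix I I A) (f : I → M) (a : I) :
    matAct M D f a = ∑ b, D a b • f b := rfl

lemma matAct_mul (D E : Matrix I I A) (f : I → M) :
    matAct M (D * E) f = matAct M D (matAct M E f) := by
  ext a
  simp only [matAct_apply, Matrix.mul_apply, Finset.sum_smul, Finset.smul_sum, mul_smul]
  exact Finset.sum_comm

lemma matAct_add (D E : Matrix I I A) (f : I → M) :
    matAct M (D + E) f = matAct M D f + matAct M E f := by
  ext a
  simp [matAct_apply, add_smul, Finset.sum_add_distrib]

lemma matAct_zero (f : I → M) : matAct M (0 : Matrix I I A) f = 0 := by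
  ext a
  simp [matAct_apply]

lemma matAct_smul_one [DecidableEq I] (r : A) (f : I → M) :
    matAct M (r • (1 : Matrix I I A)) f = r • f := by
  ext a
  simp [matAct_apply, Matrix.one_apply, ite_smul]

/-- Matrix actions commute with applying a linear map to all entries. -/
lemma matAct_comp (φ : M →ₗ[A] N) (D : Matrix I I A) (f : I → M) :
    matAct N D (φ ∘ f) = φ ∘ matAct M D f := by
  ext a
  simp [matAct_apply]

end MatrixAction

/-! ### Koszul frames -/

/-- A matrix model of the Koszul complex of a finite family `x` of elements of a commutative ring
`A`: a finite graded index set `I` and a matrix `D` that lowers degrees by one, such that `K(M)`,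
the complex of functions `I → M` with differential `D`, makes sense for every `A`-module `M`.
The recorded properties are those from which the homological behaviour of the Koszul complex
follows: `D² = 0`, the entries of `D` lie in the ideal `(x)`, each `x v` is null-homotopic
(through `H v`), and there is exactly one index of lowest degree `0` and exactly one of highest
degree, the number of elements of the family. -/
structure KoszulFrame {V : Type u} {A : Type v} [CommRing A] (x : V → A) where
  I : Type
  [fintype : Fintype I]
  [decEq : DecidableEq I]
  deg : I → ℕ
  D : Matrix I I A
  D_mul_D : D * D = 0
  deg_of_D : ∀ a b, D a b ≠ 0 → deg b = deg a + 1
  D_mem : ∀ a b, D a b ∈ Ideal.span (Set.range x)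
  H : V → Matrix I I A
  deg_of_H : ∀ v a b, H v a b ≠ 0 → deg a = deg b + 1
  homotopy : ∀ v, D * H v + H v * D = x v • 1
  bot : I
  top : I
  deg_bot : deg bot = 0
  eq_bot : ∀ a, deg a = 0 → a = bot
  deg_le : ∀ a, deg a ≤ deg top
  eq_top : ∀ a, deg a = deg top → a = top
  deg_top : deg top = Nat.card V

attribute [instance] KoszulFrame.fintype KoszulFrame.decEq

namespace KoszulFrame

section Existence

variable {A : Type*} [CommRing A]

/-- The frame of the empty family. -/
def empty {V : Type*} [IsEmpty V] (x : V → A) : KoszulFrame x where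
  I := Unit
  deg _ := 0
  D := 0
  D_mul_D := by simp
  deg_of_D := by simp
  D_mem := by simp
  H v := isEmptyElim v
  deg_of_H v := isEmptyElim v
  homotopy v := isEmptyElim v
  bot := ()
  top := ()
  deg_bot := rfl
  eq_bot _ _ := rfl
  deg_le _ := le_rfl
  eq_top _ _ := rfl
  deg_top := by simp

/-- The frame of a family with one member. -/
def unique (x : Unit → A) : KoszulFrame x where
  I := Fin 2
  deg i := i
  D := !![0, x (); 0, 0]
  D_mul_D := by ext i j; fin_cases i <;> fin_cases j <;> simp
  deg_of_D a b := by fin_cases a <;> fin_cases b <;> simp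
  D_mem a b := by
    have : x () ∈ Ideal.span (Set.range x) := Ideal.subset_span ⟨(), rfl⟩
    fin_cases a <;> fin_cases b <;> simp [this]
  H _ := !![0, 0; 1, 0]
  deg_of_H _ a b := by fin_cases a <;> fin_cases b <;> simp
  homotopy v := by ext i j; fin_cases i <;> fin_cases j <;> simp
  bot := 0
  top := 1
  deg_bot := rfl
  eq_bot a := by fin_cases a <;> simp
  deg_le a := by fin_cases a <;> simp
  eq_top a := by fin_cases a <;> simp
  deg_top := by simp

/-- A frame for a family is a frame for the reindexed family. -/
def reindex {V W : Type*} (e : W ≃ V) {x : V → A} (F : KoszulFrame x) :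
    KoszulFrame (fun w => x (e w)) where
  I := F.I
  deg := F.deg
  D := F.D
  D_mul_D := F.D_mul_D
  deg_of_D := F.deg_of_D
  D_mem := by
    have : Set.range (fun w => x (e w)) = Set.range x := e.surjective.range_comp x
    rw [this]
    exact F.D_mem
  H w := F.H (e w)
  deg_of_H w := F.deg_of_H (e w)
  homotopy w := F.homotopy (e w)
  bot := F.bot
  top := F.top
  deg_bot := F.deg_bot
  eq_bot := F.eq_bot
  deg_le := F.deg_le
  eq_top := F.eq_top
  deg_top := F.deg_top.trans (Nat.card_congr e).symm

open Kronecker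

/-- The matrix `diag((-1)^deg)`. -/
def sgn {I : Type*} [DecidableEq I] (deg : I → ℕ) : Matrix I I A :=
  Matrix.diagonal fun a => (-1) ^ deg a

lemma sgn_mul_sgn {I : Type*} [DecidableEq I] [Fintype I] (deg : I → ℕ) :
    (sgn deg * sgn deg : Matrix I I A) = 1 := by
  simp only [sgn, Matrix.diagonal_mul_diagonal]
  rw [← Matrix.diagonal_one]
  congr 1
  ext a
  rw [← mul_pow]
  simp

/-- A matrix that changes degrees by one anticommutes with the sign matrix. -/
lemma sgn_mul_add_mul_sgn {I : Type*} [DecidableEq I] [Fintype I] (deg : I → ℕ)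
    (D : Matrix I I A) (h : ∀ a b, D a b ≠ 0 → deg b = deg a + 1 ∨ deg a = deg b + 1) :
    sgn deg * D + D * sgn deg = 0 := by
  ext a b
  simp only [sgn, Matrix.add_apply, Matrix.diagonal_mul, Matrix.mul_diagonal, Matrix.zero_apply]
  by_cases hD : D a b = 0
  · simp [hD]
  · obtain h | h := h a b hD <;> rw [h] <;> ring

variable {V₁ V₂ A₁ A₂ : Type*} [CommRing A₁] [CommRing A₂] {x₁ : V₁ → A₁} {x₂ : V₂ → A₂}

lemma map_sq {I B : Type*} [CommRing B] [Fintype I] (φ : A →+* B) {D : Matrix I I A}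
    (h : D * D = 0) : D.map φ * D.map φ = 0 := by
  rw [← Matrix.map_mul, h]
  simp

lemma map_homotopy {I B : Type*} [CommRing B] [Fintype I] [DecidableEq I] (φ : A →+* B)
    {D H : Matrix I I A} {y : A} (h : D * H + H * D = y • 1) :
    D.map φ * H.map φ + H.map φ * D.map φ = φ y • 1 := by
  rw [← Matrix.map_mul, ← Matrix.map_mul, ← Matrix.map_add _ (map_add φ), h]
  ext a b
  by_cases hab : a = b <;> simp [hab]

/-- The tensor product of two frames, over a ring that receives maps from both base rings: a frame
for the disjoint union of the two families, with differential `D₁ ⊗ 1 + (-1)^deg ⊗ D₂`. -/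
abbrev tensor (F₁ : KoszulFrame x₁) (F₂ : KoszulFrame x₂) [Finite V₁] [Finite V₂]
    (φ₁ : A₁ →+* A) (φ₂ : A₂ →+* A) :
    KoszulFrame (Sum.elim (fun v => φ₁ (x₁ v)) (fun v => φ₂ (x₂ v))) where
  I := F₁.I × F₂.I
  deg a := F₁.deg a.1 + F₂.deg a.2
  D := F₁.D.map φ₁ ⊗ₖ 1 + sgn F₁.deg ⊗ₖ F₂.D.map φ₂
  D_mul_D := by
    have h : sgn F₁.deg * F₁.D.map φ₁ + F₁.D.map φ₁ * sgn F₁.deg = 0 :=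
      sgn_mul_add_mul_sgn _ _ fun a b hab =>
        Or.inl (F₁.deg_of_D a b fun h => hab (by simp [h]))
    simp only [add_mul, mul_add, ← Matrix.mul_kronecker_mul, map_sq _ F₁.D_mul_D,
      map_sq _ F₂.D_mul_D, Matrix.zero_kronecker, Matrix.kronecker_zero, one_mul, mul_one]
    rw [zero_add, add_zero, ← Matrix.add_kronecker, h, Matrix.zero_kronecker]
  deg_of_D := by
    rintro ⟨a₁, a₂⟩ ⟨b₁, b₂⟩ hab
    simp only [Matrix.add_apply, Matrix.kronecker_apply, Matrix.map_apply, Matrix.one_apply,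
      sgn, Matrix.diagonal_apply] at hab
    by_cases h₁ : a₁ = b₁
    · by_cases h₂ : F₂.D a₂ b₂ = 0
      · by_cases h₃ : F₁.D a₁ b₁ = 0
        · simp [h₂, h₃] at hab
        · have := F₁.deg_of_D _ _ h₃
          subst h₁
          omega
      · have := F₂.deg_of_D _ _ h₂
        subst h₁
        simp only
        omega
    · by_cases h₂ : a₂ = b₂
      · by_cases h₃ : F₁.D a₁ b₁ = 0
        · simp [h₁, h₃] at hab
        · have := F₁.deg_of_D _ _ h₃
          subst h₂
          simp only
          omega
      · simp [h₁, h₂] at hab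
  D_mem := by
    rintro ⟨a₁, a₂⟩ ⟨b₁, b₂⟩
    have h₁ : φ₁ (F₁.D a₁ b₁) ∈
        Ideal.span (Set.range (Sum.elim (fun v => φ₁ (x₁ v)) (fun v => φ₂ (x₂ v)))) := by
      have := Ideal.mem_map_of_mem φ₁ (F₁.D_mem a₁ b₁)
      rw [Ideal.map_span] at this
      refine Ideal.span_mono ?_ this
      rintro _ ⟨_, ⟨v, rfl⟩, rfl⟩
      exact ⟨Sum.inl v, rfl⟩
    have h₂ : φ₂ (F₂.D a₂ b₂) ∈
        Ideal.span (Set.range (Sum.elim (fun v => φ₁ (x₁ v)) (fun v => φ₂ (x₂ v)))) := by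
      have := Ideal.mem_map_of_mem φ₂ (F₂.D_mem a₂ b₂)
      rw [Ideal.map_span] at this
      refine Ideal.span_mono ?_ this
      rintro _ ⟨_, ⟨v, rfl⟩, rfl⟩
      exact ⟨Sum.inr v, rfl⟩
    simp only [Matrix.add_apply, Matrix.kronecker_apply, Matrix.map_apply]
    exact Ideal.add_mem _ (Ideal.mul_mem_right _ _ h₁) (Ideal.mul_mem_left _ _ h₂)
  H := Sum.elim (fun v => (F₁.H v).map φ₁ ⊗ₖ 1) (fun v => sgn F₁.deg ⊗ₖ (F₂.H v).map φ₂)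
  deg_of_H := by
    rintro (v | v) ⟨a₁, a₂⟩ ⟨b₁, b₂⟩ hab
    · simp only [Sum.elim_inl, Matrix.kronecker_apply, Matrix.map_apply, Matrix.one_apply] at hab
      have h₂ : a₂ = b₂ := by
        by_contra h
        simp [h] at hab
      have h₁ := F₁.deg_of_H v a₁ b₁ fun h => hab (by simp [h])
      subst h₂
      simp only
      omega
    · simp only [Sum.elim_inr, Matrix.kronecker_apply, Matrix.map_apply, sgn,
        Matrix.diagonal_apply] at hab
      have h₁ : a₁ = b₁ := by
        by_contra h
        simp [h] at hab
      have h₂ := F₂.deg_of_H v a₂ b₂ fun h => hab (by simp [h])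
      subst h₁
      simp only
      omega
  homotopy := by
    have hH : ∀ v, sgn F₁.deg * (F₁.H v).map φ₁ + (F₁.H v).map φ₁ * sgn F₁.deg = 0 := fun v =>
      sgn_mul_add_mul_sgn _ _ fun a b hab =>
        Or.inr (F₁.deg_of_H v a b fun h => hab (by simp [h]))
    have hD : sgn F₁.deg * F₁.D.map φ₁ + F₁.D.map φ₁ * sgn F₁.deg = 0 :=
      sgn_mul_add_mul_sgn _ _ fun a b hab =>
        Or.inl (F₁.deg_of_D a b fun h => hab (by simp [h]))
    rintro (v | v)
    · simp only [Sum.elim_inl, add_mul, mul_add, ← Matrix.mul_kronecker_mul, one_mul, mul_one]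
      rw [add_add_add_comm, ← Matrix.add_kronecker, ← Matrix.add_kronecker, hH,
        map_homotopy φ₁ (F₁.homotopy v), Matrix.zero_kronecker, add_zero,
        Matrix.smul_kronecker, Matrix.one_kronecker_one]
    · simp only [Sum.elim_inr, add_mul, mul_add, ← Matrix.mul_kronecker_mul, one_mul, mul_one,
        sgn_mul_sgn]
      rw [add_add_add_comm, ← Matrix.add_kronecker, add_comm (F₁.D.map φ₁ * _), hD,
        ← Matrix.kronecker_add, map_homotopy φ₂ (F₂.homotopy v), Matrix.zero_kronecker, zero_add,
        Matrix.kronecker_smul, Matrix.one_kronecker_one]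
  bot := (F₁.bot, F₂.bot)
  top := (F₁.top, F₂.top)
  deg_bot := by simp [F₁.deg_bot, F₂.deg_bot]
  eq_bot a h := Prod.ext (F₁.eq_bot _ (by omega)) (F₂.eq_bot _ (by omega))
  deg_le a := Nat.add_le_add (F₁.deg_le _) (F₂.deg_le _)
  eq_top a h := by
    have h₁ := F₁.deg_le a.1
    have h₂ := F₂.deg_le a.2
    exact Prod.ext (F₁.eq_top _ (by simp only at h; omega)) (F₂.eq_top _ (by simp only at h; omega))
  deg_top := by simp [F₁.deg_top, F₂.deg_top, Nat.card_sum]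

/-- Every finite family has a Koszul frame. -/
theorem nonempty {V : Type u} [Finite V] (x : V → A) : Nonempty (KoszulFrame x) := by
  induction V using Finite.induction_empty_option with
  | of_equiv e ih =>
    obtain ⟨F⟩ := ih (fun v => x (e v))
    have := F.reindex e.symm
    simp only [Equiv.apply_symm_apply] at this
    exact ⟨this⟩
  | h_empty => exact ⟨empty x⟩
  | h_option ih =>
    rename_i W _
    obtain ⟨F⟩ := ih (fun v => x (some v))
    have G := (F.tensor (unique (fun _ => x none)) (RingHom.id A) (RingHom.id A)).reindex
      (Equiv.optionEquivSumPUnit.{0} W)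
    have h : (fun w => Sum.elim (fun v => RingHom.id A (x (some v)))
        (fun _ => RingHom.id A (x none)) (Equiv.optionEquivSumPUnit.{0} W w)) = x := by
      funext w
      cases w <;> simp
    rw [h] at G
    exact ⟨G⟩

end Existence

end KoszulFrame

/-! ### Homology of a graded differential -/

section GradedHomology

variable {B T : Type*} [Ring B] [AddCommGroup T] [Module B T]

/-- The cycles of degree `i` of a differential `d` on a module with graded pieces `G`. -/
def gradedCycles (d : T →ₗ[B] T) (G : ℕ → Submodule B T) (i : ℕ) : Submodule B T :=
  LinearMap.ker d ⊓ G i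

/-- The boundaries of degree `i` of a differential `d` that lowers degrees by one. -/
def gradedBoundaries (d : T →ₗ[B] T) (G : ℕ → Submodule B T) (i : ℕ) : Submodule B T :=
  (G (i + 1)).map d

/-- The homology in degree `i` of a differential `d` that lowers degrees by one. -/
abbrev gradedHomology (d : T →ₗ[B] T) (G : ℕ → Submodule B T) (i : ℕ) : Type _ :=
  gradedCycles d G i ⧸ (gradedBoundaries d G i).submoduleOf (gradedCycles d G i)

/-- A surjection from the cycles whose kernel consists of the boundaries identifies the homology. -/
noncomputable def gradedHomologyEquiv {W : Type*} [AddCommGroup W] [Module B W]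
    {d : T →ₗ[B] T} {G : ℕ → Submodule B T} {i : ℕ} (φ : gradedCycles d G i →ₗ[B] W)
    (hφ : Function.Surjective φ)
    (hker : ∀ f : gradedCycles d G i, φ f = 0 ↔ (f : T) ∈ gradedBoundaries d G i) :
    gradedHomology d G i ≃ₗ[B] W :=
  (Submodule.quotEquivOfEq _ _ (by
    ext f
    rw [LinearMap.mem_ker, hker]
    rfl)).trans (φ.quotKerEquivOfSurjective hφ)

end GradedHomology

namespace KoszulFrame

variable {V : Type u} {A : Type v} [CommRing A] {x : V → A} (F : KoszulFrame x)
variable {M N : Type*} [AddCommGroup M] [Module A M] [AddCommGroup N] [Module A N]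

/-! ### The complex of a frame with coefficients in a module -/

/-- The functions with values in `M` that are supported in degree `i`. -/
def strand (M : Type*) [AddCommGroup M] [Module A M] (i : ℕ) : Submodule A (F.I → M) where
  carrier := {f | ∀ a, F.deg a ≠ i → f a = 0}
  add_mem' hf hg a ha := by simp [hf a ha, hg a ha]
  zero_mem' _ _ := rfl
  smul_mem' c f hf a ha := by simp [hf a ha]

/-- The differential of the complex `K(M)`. -/
abbrev diff (M : Type*) [AddCommGroup M] [Module A M] : (F.I → M) →ₗ[A] (F.I → M) :=
  matAct M F.D

lemma diff_diff (f : F.I → M) : F.diff M (F.diff M f) = 0 := by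
  rw [← matAct_mul, F.D_mul_D, matAct_zero]

lemma diff_mem {i : ℕ} {f : F.I → M} (hf : f ∈ F.strand M (i + 1)) :
    F.diff M f ∈ F.strand M i := by
  intro a ha
  refine Finset.sum_eq_zero fun b _ => ?_
  by_cases hD : F.D a b = 0
  · simp [hD]
  · have := F.deg_of_D a b hD
    rw [hf b (by omega), smul_zero]

lemma diff_eq_zero_of_mem_strand_zero {f : F.I → M} (hf : f ∈ F.strand M 0) :
    F.diff M f = 0 := by
  ext a
  refine Finset.sum_eq_zero fun b _ => ?_
  by_cases hD : F.D a b = 0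
  · simp [hD]
  · have := F.deg_of_D a b hD
    rw [hf b (by omega), smul_zero]

lemma H_mem {i : ℕ} {f : F.I → M} (hf : f ∈ F.strand M i) (v : V) :
    matAct M (F.H v) f ∈ F.strand M (i + 1) := by
  intro a ha
  refine Finset.sum_eq_zero fun b _ => ?_
  by_cases hD : F.H v a b = 0
  · simp [hD]
  · have := F.deg_of_H v a b hD
    rw [hf b (by omega), smul_zero]

lemma eq_zero_of_mem_strand {i : ℕ} (hi : F.deg F.top < i) {f : F.I → M}
    (hf : f ∈ F.strand M i) : f = 0 := by
  ext a
  exact hf a ((F.deg_le a).trans_lt hi).ne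

lemma comp_mem_strand (φ : M →ₗ[A] N) {i : ℕ} {f : F.I → M} (hf : f ∈ F.strand M i) :
    φ ∘ f ∈ F.strand N i := by
  intro a ha
  simp [hf a ha]

/-- A surjection of modules is surjective on each strand. -/
lemma exists_lift {φ : M →ₗ[A] N} (hφ : Function.Surjective φ) {i : ℕ} {f : F.I → N}
    (hf : f ∈ F.strand N i) : ∃ g ∈ F.strand M i, φ ∘ g = f := by
  choose s hs using hφ
  refine ⟨fun a => if F.deg a = i then s (f a) else 0, fun a ha => by simp [ha], ?_⟩
  ext a
  by_cases ha : F.deg a = i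
  · simp [ha, hs]
  · simp [ha, hf a ha]

/-- The homology of `K(M)` vanishes in degree `i`. -/
def Vanish (M : Type*) [AddCommGroup M] [Module A M] (i : ℕ) : Prop :=
  ∀ f ∈ F.strand M i, F.diff M f = 0 → ∃ g ∈ F.strand M (i + 1), F.diff M g = f

lemma vanish_of_top_lt {i : ℕ} (hi : F.deg F.top < i) : F.Vanish M i := fun f hf _ =>
  ⟨0, Submodule.zero_mem _, by rw [map_zero, F.eq_zero_of_mem_strand hi hf]⟩

/-- The ideal `(x)` annihilates the homology of `K(M)`. -/
lemma exists_diff_eq_smul {r : A} (hr : r ∈ Ideal.span (Set.range x)) {i : ℕ} {f : F.I → M}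
    (hf : f ∈ F.strand M i) (hdf : F.diff M f = 0) :
    ∃ g ∈ F.strand M (i + 1), F.diff M g = r • f := by
  induction hr using Submodule.span_induction with
  | mem r hr =>
    obtain ⟨v, rfl⟩ := hr
    refine ⟨matAct M (F.H v) f, F.H_mem hf v, ?_⟩
    have h := matAct_smul_one (x v) f
    rw [← F.homotopy v, matAct_add, matAct_mul, matAct_mul, hdf, map_zero, add_zero] at h
    exact h
  | zero => exact ⟨0, Submodule.zero_mem _, by simp⟩
  | add r s _ _ hr hs =>
    obtain ⟨g, hg, hdg⟩ := hr
    obtain ⟨g', hg', hdg'⟩ := hs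
    exact ⟨g + g', Submodule.add_mem _ hg hg', by rw [map_add, hdg, hdg', add_smul]⟩
  | smul a r _ hr =>
    obtain ⟨g, hg, hdg⟩ := hr
    exact ⟨a • g, Submodule.smul_mem _ _ hg, by rw [map_smul, hdg, smul_assoc]⟩

/-- If some element congruent to `1` modulo `(x)` annihilates `M`, then `K(M)` is acyclic. -/
lemma vanish_of_smul_eq_zero {r : A} (hr : r - 1 ∈ Ideal.span (Set.range x))
    (hM : ∀ y : M, r • y = 0) (i : ℕ) : F.Vanish M i := by
  intro f hf hdf
  obtain ⟨g, hg, hdg⟩ := F.exists_diff_eq_smul hr hf hdf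
  refine ⟨-g, Submodule.neg_mem _ hg, ?_⟩
  have : r • f = 0 := by
    ext a
    exact hM _
  rw [map_neg, hdg, sub_smul, this, one_smul, zero_sub, neg_neg]

lemma single_bot_mem (y : M) : Pi.single F.bot y ∈ F.strand M 0 := by
  intro a ha
  have : a ≠ F.bot := fun h => ha (h ▸ F.deg_bot)
  simp [this]

lemma eq_single_bot {f : F.I → M} (hf : f ∈ F.strand M 0) : f = Pi.single F.bot (f F.bot) := by
  ext a
  by_cases ha : a = F.bot
  · subst ha
    simp
  · rw [hf a fun h => ha (F.eq_bot a h)]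
    simp [ha]

/-- In degree zero, the boundaries of `K(M)` are the elements of `(x) M`. -/
lemma exists_diff_eq_single_bot_iff (y : M) :
    (∃ g ∈ F.strand M 1, F.diff M g = Pi.single F.bot y) ↔
      y ∈ Ideal.span (Set.range x) • (⊤ : Submodule A M) := by
  constructor
  · rintro ⟨g, _, hdg⟩
    have h := congrFun hdg F.bot
    rw [Pi.single_eq_same] at h
    rw [← h]
    exact Submodule.sum_mem _ fun b _ => Submodule.smul_mem_smul (F.D_mem _ _) trivial
  · intro hy
    induction hy using Submodule.smul_induction_on' with
    | smul r hr m _ =>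
      obtain ⟨g, hg, hdg⟩ := F.exists_diff_eq_smul hr (F.single_bot_mem m)
        (F.diff_eq_zero_of_mem_strand_zero (F.single_bot_mem m))
      exact ⟨g, hg, by rw [hdg, ← Pi.single_smul]⟩
    | add y _ y' _ h h' =>
      obtain ⟨g, hg, hdg⟩ := h
      obtain ⟨g', hg', hdg'⟩ := h'
      exact ⟨g + g', Submodule.add_mem _ hg hg', by rw [map_add, hdg, hdg', Pi.single_add]⟩

lemma vanish_zero_iff :
    F.Vanish M 0 ↔ Ideal.span (Set.range x) • (⊤ : Submodule A M) = ⊤ := by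
  constructor
  · intro h
    rw [eq_top_iff]
    intro y _
    exact (F.exists_diff_eq_single_bot_iff y).1 (h _ (F.single_bot_mem y)
      (F.diff_eq_zero_of_mem_strand_zero (F.single_bot_mem y)))
  · intro h f hf _
    rw [F.eq_single_bot hf]
    exact (F.exists_diff_eq_single_bot_iff _).2 (by rw [h]; trivial)

lemma single_top_mem (y : M) : Pi.single F.top y ∈ F.strand M (F.deg F.top) := by
  intro a ha
  have : a ≠ F.top := fun h => ha (h ▸ rfl)
  simp [this]

lemma eq_single_top {f : F.I → M} (hf : f ∈ F.strand M (F.deg F.top)) :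
    f = Pi.single F.top (f F.top) := by
  ext a
  by_cases ha : a = F.top
  · subst ha
    simp
  · rw [hf a fun h => ha (F.eq_top a h)]
    simp [ha]

/-- In the top degree, the cycles of `K(M)` are the elements of `M` annihilated by `(x)`. -/
lemma diff_single_top_eq_zero_iff (y : M) :
    F.diff M (Pi.single F.top y) = 0 ↔ ∀ r ∈ Ideal.span (Set.range x), r • y = 0 := by
  constructor
  · intro h r hr
    obtain ⟨g, hg, hdg⟩ := F.exists_diff_eq_smul hr (F.single_top_mem y) h
    rw [F.eq_zero_of_mem_strand (Nat.lt_succ_self _) hg, map_zero, ← Pi.single_smul] at hdg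
    simpa using (congrFun hdg F.top).symm
  · intro h
    ext a
    rw [matAct_apply, Finset.sum_eq_single F.top]
    · simpa using h _ (F.D_mem _ _)
    · intro b _ hb
      simp [hb]
    · simp

/-! ### Short exact sequences of coefficient modules -/

section Exact

variable {φ : M →ₗ[A] N} (hφ : Function.Surjective φ) (K : Submodule A M)
  (hK : ∀ y, φ y = 0 ↔ y ∈ K)

include hK in
lemma exists_lift_of_comp_eq_zero {i : ℕ} {f : F.I → M} (hf : f ∈ F.strand M i)
    (h : φ ∘ f = 0) : ∃ g ∈ F.strand K i, K.subtype ∘ g = f :=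
  ⟨fun a => ⟨f a, (hK _).1 (congrFun h a)⟩, fun a ha => Subtype.ext (hf a ha), rfl⟩

lemma subtype_comp_injective {f g : F.I → K} (h : K.subtype ∘ f = K.subtype ∘ g) : f = g := by
  ext a
  exact congrFun h a

include hφ hK in
/-- If `H_{i+1}(N) = 0` then `H_i(K) → H_i(M)` is injective: a cycle of `K` that bounds in `M`
bounds in `K`. -/
lemma exists_diff_eq_of_vanish {i : ℕ} (hN : F.Vanish N (i + 1)) {f : F.I → K}
    (hfM : ∃ g ∈ F.strand M (i + 1), F.diff M g = K.subtype ∘ f) :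
    ∃ g ∈ F.strand K (i + 1), F.diff K g = f := by
  obtain ⟨g, hg, hdg⟩ := hfM
  have h₁ : F.diff N (φ ∘ g) = 0 := by
    rw [matAct_comp, hdg]
    ext a
    exact (hK _).2 (f a).2
  obtain ⟨w, hw, hdw⟩ := hN _ (F.comp_mem_strand φ hg) h₁
  obtain ⟨w, hwM, rfl⟩ := F.exists_lift hφ hw
  have h₂ : φ ∘ (g - F.diff M w) = 0 := by
    rw [matAct_comp] at hdw
    ext a
    have := congrFun hdw a
    simp only [Function.comp_apply, Pi.sub_apply, map_sub, Pi.zero_apply] at this ⊢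
    rw [this, sub_self]
  obtain ⟨z, hz, hzg⟩ := F.exists_lift_of_comp_eq_zero K hK
    (Submodule.sub_mem _ hg (F.diff_mem hwM)) h₂
  refine ⟨z, hz, F.subtype_comp_injective K ?_⟩
  rw [← matAct_comp, hzg, map_sub, F.diff_diff, sub_zero, hdg]

include hφ hK in
lemma vanish_ker {i : ℕ} (hM : F.Vanish M i) (hN : F.Vanish N (i + 1)) : F.Vanish K i := by
  intro f hf hdf
  refine F.exists_diff_eq_of_vanish hφ K hK hN (hM _ (F.comp_mem_strand _ hf) ?_)
  rw [matAct_comp, hdf]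
  rfl

include hφ hK in
lemma vanish_of_vanish_ker {i : ℕ} (hM : F.Vanish M (i + 1)) (hV : F.Vanish K i) :
    F.Vanish N (i + 1) := by
  intro f hf hdf
  obtain ⟨f, hfM, rfl⟩ := F.exists_lift hφ hf
  rw [matAct_comp] at hdf
  obtain ⟨z, hz, hzf⟩ := F.exists_lift_of_comp_eq_zero K hK (F.diff_mem hfM) hdf
  have hdz : F.diff K z = 0 := by
    apply F.subtype_comp_injective K
    rw [← matAct_comp, hzf, F.diff_diff]
    rfl
  obtain ⟨w, hw, hdw⟩ := hV z hz hdz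
  have h₁ : F.diff M (f - K.subtype ∘ w) = 0 := by
    rw [map_sub, matAct_comp, hdw, hzf, sub_self]
  obtain ⟨g, hg, hdg⟩ := hM _ (Submodule.sub_mem _ hfM (F.comp_mem_strand _ hw)) h₁
  refine ⟨φ ∘ g, F.comp_mem_strand φ hg, ?_⟩
  rw [matAct_comp, hdg]
  ext a
  have : φ (w a : M) = 0 := (hK _).2 (w a).2
  simp [this]

include hφ hK in
lemma vanish_mid {i : ℕ} (hV : F.Vanish K i) (hN : F.Vanish N i) : F.Vanish M i := by
  intro f hf hdf
  obtain ⟨g, hg, hdg⟩ := hN (φ ∘ f) (F.comp_mem_strand φ hf) (by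
    rw [matAct_comp, hdf]
    ext a
    simp)
  obtain ⟨g, hgM, rfl⟩ := F.exists_lift hφ hg
  have h₁ : φ ∘ (f - F.diff M g) = 0 := by
    rw [matAct_comp] at hdg
    ext a
    have := congrFun hdg a
    simp only [Function.comp_apply, Pi.sub_apply, map_sub, Pi.zero_apply] at this ⊢
    rw [this, sub_self]
  obtain ⟨z, hz, hzf⟩ := F.exists_lift_of_comp_eq_zero K hK
    (Submodule.sub_mem _ hf (F.diff_mem hgM)) h₁
  obtain ⟨w, hw, hdw⟩ := hV z hz (by
    apply F.subtype_comp_injective K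
    rw [← matAct_comp, hzf, map_sub, hdf, F.diff_diff]
    ext a
    simp)
  refine ⟨g + K.subtype ∘ w, Submodule.add_mem _ hgM (F.comp_mem_strand _ hw), ?_⟩
  rw [map_add, matAct_comp, hdw, hzf]
  abel

end Exact

/-! ### Reduction modulo a regular element -/

section Regular

variable {r : A} (hr : r ∈ Ideal.span (Set.range x)) (hreg : IsSMulRegular M r)
  {φ : M →ₗ[A] N} (hφ : Function.Surjective φ) (hker : ∀ y, φ y = 0 ↔ ∃ z, r • z = y)

include hker in
lemma exists_smul_eq_of_comp_eq_zero {i : ℕ} {f : F.I → M} (hf : f ∈ F.strand M i)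
    (h : φ ∘ f = 0) : ∃ g ∈ F.strand M i, r • g = f := by
  choose! s hs using fun y => (hker y).1
  refine ⟨fun a => if F.deg a = i then s (f a) else 0, fun a ha => by simp [ha], ?_⟩
  ext a
  by_cases ha : F.deg a = i
  · simpa [ha] using hs _ (congrFun h a)
  · simp [ha, hf a ha]

include hker in
lemma comp_smul_eq_zero (f : F.I → M) : φ ∘ (r • f) = 0 := by
  ext a
  exact (hker _).2 ⟨f a, rfl⟩

include hreg in
lemma eq_of_smul_eq_smul {f g : F.I → M} (h : r • f = r • g) : f = g := by
  ext a
  exact hreg (congrFun h a)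

include hr hreg hφ hker in
/-- The connecting map `H_{i+1}(M / rM) → H_i(M)` is surjective, because `r ∈ (x)` acts as zero on
`H_i(M)`. -/
lemma vanish_of_vanish_quotient {i : ℕ} (hN : F.Vanish N (i + 1)) : F.Vanish M i := by
  intro f hf hdf
  obtain ⟨g, hg, hdg⟩ := F.exists_diff_eq_smul hr hf hdf
  obtain ⟨w, hw, hdw⟩ := hN (φ ∘ g) (F.comp_mem_strand φ hg) (by
    rw [matAct_comp, hdg, F.comp_smul_eq_zero hker])
  obtain ⟨w, hwM, rfl⟩ := F.exists_lift hφ hw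
  have h₁ : φ ∘ (g - F.diff M w) = 0 := by
    rw [matAct_comp] at hdw
    ext a
    have := congrFun hdw a
    simp only [Function.comp_apply, Pi.sub_apply, map_sub, Pi.zero_apply] at this ⊢
    rw [this, sub_self]
  obtain ⟨z, hz, hzg⟩ := F.exists_smul_eq_of_comp_eq_zero hker
    (Submodule.sub_mem _ hg (F.diff_mem hwM)) h₁
  refine ⟨z, hz, F.eq_of_smul_eq_smul hreg ?_⟩
  rw [← map_smul, hzg, map_sub, F.diff_diff, sub_zero, hdg]

include hreg hφ hker in
/-- The homology of `M / rM` in degree `i` is caught between that of `M` in degrees `i` and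
`i - 1`. -/
lemma vanish_quotient {i : ℕ} (hM : F.Vanish M i) (hM' : i ≠ 0 → F.Vanish M (i - 1)) :
    F.Vanish N i := by
  intro f hf hdf
  obtain ⟨f, hfM, rfl⟩ := F.exists_lift hφ hf
  obtain ⟨y, hy, hdy⟩ : ∃ y ∈ F.strand M i, F.diff M f = r • F.diff M y := by
    rcases i with _ | i
    · exact ⟨0, Submodule.zero_mem _, by
        rw [F.diff_eq_zero_of_mem_strand_zero hfM, map_zero, smul_zero]⟩
    · rw [matAct_comp] at hdf
      obtain ⟨w, hw, hwf⟩ := F.exists_smul_eq_of_comp_eq_zero hker (F.diff_mem hfM) hdf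
      have hdw : F.diff M w = 0 := by
        apply F.eq_of_smul_eq_smul hreg
        rw [← map_smul, hwf, F.diff_diff, smul_zero]
      obtain ⟨y, hy, rfl⟩ := hM' (Nat.succ_ne_zero i) w hw hdw
      exact ⟨y, hy, hwf.symm⟩
  obtain ⟨z, hz, hdz⟩ := hM (f - r • y) (Submodule.sub_mem _ hfM (Submodule.smul_mem _ _ hy)) (by
    rw [map_sub, map_smul, hdy, sub_self])
  refine ⟨φ ∘ z, F.comp_mem_strand φ hz, ?_⟩
  rw [matAct_comp, hdz]
  ext a
  have : φ (r • y a) = 0 := (hker _).2 ⟨_, rfl⟩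
  simp only [Function.comp_apply, Pi.sub_apply, Pi.smul_apply, map_sub, this, sub_zero]

end Regular

/-! ### Dimensions over a base field -/

section Dimension

variable (k : Type w) [Field k] [Algebra k A] [Module k M] [IsScalarTower k A M]
  [Module k N] [IsScalarTower k A N]

/-- The differential of `K(M)` over the base field. -/
def diffk (M : Type*) [AddCommGroup M] [Module A M] [Module k M] [IsScalarTower k A M] :
    (F.I → M) →ₗ[k] (F.I → M) :=
  (F.diff M).restrictScalars k

/-- The strands of `K(M)` over the base field. -/
def strandk (M : Type*) [AddCommGroup M] [Module A M] [Module k M] [IsScalarTower k A M] (i : ℕ) :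
    Submodule k (F.I → M) :=
  (F.strand M i).restrictScalars k

/-- The dimension over the base field `k` of the homology of `K(M)` in degree `i`. -/
noncomputable def betti (M : Type*) [AddCommGroup M] [Module A M] [Module k M]
    [IsScalarTower k A M] (i : ℕ) : ℕ :=
  Module.finrank k (gradedHomology (F.diffk k M) (F.strandk k M) i)

lemma mem_gradedBoundaries {i : ℕ} {f : F.I → M} :
    f ∈ gradedBoundaries (F.diffk k M) (F.strandk k M) i ↔
      ∃ g ∈ F.strand M (i + 1), F.diff M g = f :=
  Iff.rfl

lemma subsingleton_gradedHomology_iff {i : ℕ} :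
    Subsingleton (gradedHomology (F.diffk k M) (F.strandk k M) i) ↔ F.Vanish M i := by
  rw [Submodule.Quotient.subsingleton_iff, Submodule.submoduleOf, Submodule.comap_subtype_eq_top]
  constructor
  · intro h f hf hdf
    exact h ⟨hdf, hf⟩
  · rintro h f ⟨hdf, hf⟩
    exact h f hf hdf

/-- Modulo a regular element of `(x)`, homology shifts up by one degree, if the next homology of
the module vanishes. -/
lemma betti_quotient {r : A} (hr : r ∈ Ideal.span (Set.range x)) (hreg : IsSMulRegular M r)
    {φ : M →ₗ[A] N} (hφ : Function.Surjective φ) (hker : ∀ y, φ y = 0 ↔ ∃ z, r • z = y) {i : ℕ}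
    (hM : F.Vanish M (i + 1)) : F.betti k N (i + 1) = F.betti k M i := by
  -- A cycle of `N` lifts to a chain `f` of `M` with `df = r z`; the connecting map sends its class
  -- to that of `z`, and `W` is the space of all such pairs `(f, z)`.
  let W : Submodule k ((F.I → M) × (F.I → M)) :=
    { carrier := {p | p.1 ∈ F.strand M (i + 1) ∧ p.2 ∈ F.strand M i ∧ F.diff M p.1 = r • p.2}
      add_mem' := by
        rintro p q ⟨h₁, h₂, h₃⟩ ⟨h₁', h₂', h₃'⟩
        exact ⟨Submodule.add_mem _ h₁ h₁', Submodule.add_mem _ h₂ h₂', by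
          simp [h₃, h₃']⟩
      zero_mem' := ⟨Submodule.zero_mem _, Submodule.zero_mem _, by simp⟩
      smul_mem' := by
        rintro c p ⟨h₁, h₂, h₃⟩
        refine ⟨(F.strandk k M _).smul_mem c h₁, (F.strandk k M _).smul_mem c h₂, ?_⟩
        have := (F.diffk k M).map_smul c p.1
        simp only [diffk, LinearMap.coe_restrictScalars] at this
        rw [Prod.smul_fst, this, h₃, Prod.smul_snd, smul_comm] }
  have hW : ∀ p : W, F.diff M p.1.2 = 0 := by
    rintro ⟨p, h₁, h₂, h₃⟩
    apply F.eq_of_smul_eq_smul hreg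
    rw [← map_smul, ← h₃, F.diff_diff, smul_zero]
  let φk : M →ₗ[k] N := φ.restrictScalars k
  let α : W →ₗ[k] gradedCycles (F.diffk k N) (F.strandk k N) (i + 1) :=
    LinearMap.codRestrict _ ((φk.compLeft F.I) ∘ₗ LinearMap.fst k _ _ ∘ₗ W.subtype) (by
      rintro ⟨p, h₁, h₂, h₃⟩
      refine ⟨?_, F.comp_mem_strand φ h₁⟩
      change F.diff N (φ ∘ p.1) = 0
      rw [matAct_comp, h₃, F.comp_smul_eq_zero hker])
  let β : W →ₗ[k] gradedCycles (F.diffk k M) (F.strandk k M) i :=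
    LinearMap.codRestrict _ (LinearMap.snd k _ _ ∘ₗ W.subtype) (by
      rintro ⟨p, h₁, h₂, h₃⟩
      exact ⟨hW ⟨p, h₁, h₂, h₃⟩, h₂⟩)
  let α' := (Submodule.mkQ ((gradedBoundaries (F.diffk k N) (F.strandk k N) (i + 1)).submoduleOf
    (gradedCycles (F.diffk k N) (F.strandk k N) (i + 1)))) ∘ₗ α
  let β' := (Submodule.mkQ ((gradedBoundaries (F.diffk k M) (F.strandk k M) i).submoduleOf
    (gradedCycles (F.diffk k M) (F.strandk k M) i))) ∘ₗ β
  have hα : Function.Surjective α' := by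
    refine (Submodule.mkQ_surjective _).comp ?_
    rintro ⟨f, hdf, hf⟩
    obtain ⟨f, hfM, rfl⟩ := F.exists_lift hφ hf
    have hdf : F.diff N (φ ∘ f) = 0 := hdf
    rw [matAct_comp] at hdf
    obtain ⟨z, hz, hzf⟩ := F.exists_smul_eq_of_comp_eq_zero hker (F.diff_mem hfM) hdf
    exact ⟨⟨(f, z), hfM, hz, hzf.symm⟩, rfl⟩
  have hβ : Function.Surjective β' := by
    refine (Submodule.mkQ_surjective _).comp ?_
    rintro ⟨z, hdz, hz⟩
    obtain ⟨f, hf, hdf⟩ := F.exists_diff_eq_smul hr hz hdz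
    exact ⟨⟨(f, z), hf, hz, hdf⟩, rfl⟩
  have hker' : LinearMap.ker α' = LinearMap.ker β' := by
    ext p
    have h₁ : p ∈ LinearMap.ker α' ↔ ∃ g ∈ F.strand N (i + 2), F.diff N g = φ ∘ p.1.1 := by
      rw [LinearMap.mem_ker]
      exact Submodule.Quotient.mk_eq_zero _
    have h₂ : p ∈ LinearMap.ker β' ↔ ∃ g ∈ F.strand M (i + 1), F.diff M g = p.1.2 := by
      rw [LinearMap.mem_ker]
      exact Submodule.Quotient.mk_eq_zero _
    rw [h₁, h₂]
    obtain ⟨⟨f, z⟩, hf, hz, hfz⟩ := p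
    simp only at hf hz hfz ⊢
    constructor
    · rintro ⟨g, hg, hdg⟩
      obtain ⟨g, hgM, rfl⟩ := F.exists_lift hφ hg
      obtain ⟨w, hw, hwf⟩ := F.exists_smul_eq_of_comp_eq_zero hker (f := f - F.diff M g)
        (Submodule.sub_mem _ hf (F.diff_mem hgM)) (by
          rw [matAct_comp] at hdg
          ext a
          have := congrFun hdg a
          simp only [Function.comp_apply, Pi.sub_apply, map_sub, Pi.zero_apply] at this ⊢
          rw [this, sub_self])
      refine ⟨w, hw, F.eq_of_smul_eq_smul hreg ?_⟩
      rw [← map_smul, hwf, map_sub, F.diff_diff, sub_zero, hfz]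
    · rintro ⟨w, hw, hdw⟩
      obtain ⟨g, hg, hdg⟩ := hM (f - r • w) (Submodule.sub_mem _ hf (Submodule.smul_mem _ _ hw))
        (by rw [map_sub, map_smul, hdw, hfz, sub_self])
      refine ⟨φ ∘ g, F.comp_mem_strand φ hg, ?_⟩
      rw [matAct_comp, hdg]
      ext a
      have : φ (r • w a) = 0 := (hker _).2 ⟨_, rfl⟩
      simp only [Function.comp_apply, Pi.sub_apply, Pi.smul_apply, map_sub, this, sub_zero]
  exact (((α'.quotKerEquivOfSurjective hα).symm.trans
    (Submodule.quotEquivOfEq _ _ hker')).trans (β'.quotKerEquivOfSurjective hβ)).finrank_eq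

end Dimension

end KoszulFrame

/-! ### Regular sequences and the length of the complex -/

section RegularSequences

open scoped Pointwise

open RingTheory.Sequence in
/-- A regular sequence on a finite module is no longer than the dimension of its support. -/
lemma length_le_supportDim_of_isRegular {A : Type u} {M : Type v} [CommRing A]
    [AddCommGroup M] [Module A M] [Module.Finite A M] (rs : List A) (h : IsRegular M rs) :
    (rs.length : WithBot ℕ∞) ≤ Module.supportDim A M := by
  induction rs generalizing M with
  | nil =>
    have := h.nontrivial
    have h₁ := Module.supportDim_ne_bot_of_nontrivial A M
    obtain ⟨d, hd⟩ := WithBot.ne_bot_iff_exists.1 h₁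
    rw [← hd]
    exact_mod_cast bot_le
  | cons r rs ih =>
    rw [isRegular_cons_iff] at h
    refine le_trans ?_ (Module.supportDim_quotSMulTop_succ_le_of_notMem_minimalPrimes (x := r)
      (M := M) fun _ => h.1.notMem_of_mem_minimalPrimes)
    rw [List.length_cons, Nat.cast_add, Nat.cast_one]
    exact add_le_add_left (ih h.2) 1

lemma quotSMulTop_mkQ_eq_zero_iff {A : Type u} {M : Type v} [CommRing A] [AddCommGroup M]
    [Module A M] (r : A) (y : M) :
    (Submodule.mkQ (r • (⊤ : Submodule A M))) y = 0 ↔ ∃ z, r • z = y := by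
  rw [Submodule.mkQ_apply, Submodule.Quotient.mk_eq_zero]
  simp [Submodule.mem_smul_pointwise_iff_exists]

namespace KoszulFrame

open RingTheory.Sequence

section

variable {V : Type u} {A : Type v} [CommRing A] {x : V → A} (F : KoszulFrame x)
variable {M : Type w} [AddCommGroup M] [Module A M]

/-- A regular sequence of length `t` in `(x)` kills the `t` highest homology groups. -/
theorem vanish_of_isWeaklyRegular (rs : List A) (hrs : ∀ r ∈ rs, r ∈ Ideal.span (Set.range x))
    (h : IsWeaklyRegular M rs) {i : ℕ} (hi : F.deg F.top < i + rs.length) : F.Vanish M i := by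
  induction rs generalizing M i with
  | nil => exact F.vanish_of_top_lt hi
  | cons r rs ih =>
    rw [isWeaklyRegular_cons_iff] at h
    rw [List.length_cons] at hi
    exact F.vanish_of_vanish_quotient (hrs r List.mem_cons_self) h.1 (Submodule.mkQ_surjective _)
      (quotSMulTop_mkQ_eq_zero_iff r)
      (ih (fun s hs => hrs s (List.mem_cons_of_mem _ hs)) h.2 (by omega))

/-- Conversely, if the `t` highest homology groups of a finite module vanish, then there is a
regular sequence of length `t` in `(x)`: the vanishing of the top homology says that `M` has no
nonzero element annihilated by `(x)`, which yields a regular element in `(x)`. -/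
theorem exists_isRegular_of_vanish [IsNoetherianRing A] [Module.Finite A M] (t : ℕ)
    (hM : Ideal.span (Set.range x) • (⊤ : Submodule A M) ≠ ⊤)
    (h : ∀ i, F.deg F.top < i + t → F.Vanish M i) :
    ∃ rs : List A, rs.length = t ∧ (∀ r ∈ rs, r ∈ Ideal.span (Set.range x)) ∧ IsRegular M rs := by
  induction t generalizing M with
  | zero =>
    have : Nontrivial M := by
      by_contra hN
      rw [not_nontrivial_iff_subsingleton] at hN
      exact hM (Subsingleton.elim _ _)
    exact ⟨[], rfl, by simp, IsRegular.nil A M⟩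
  | succ t ih =>
    have hsub : Subsingleton ((A ⧸ Ideal.span (Set.range x)) →ₗ[A] M) := by
      refine subsingleton_of_forall_eq 0 fun f => ?_
      have h₁ : f 1 = 0 := by
        have h₂ : F.diff M (Pi.single F.top (f 1)) = 0 := by
          rw [F.diff_single_top_eq_zero_iff]
          intro r hr
          rw [← map_smul]
          have : r • (1 : A ⧸ Ideal.span (Set.range x)) = 0 := by
            rw [Algebra.smul_def, mul_one]
            exact Ideal.Quotient.eq_zero_iff_mem.2 hr
          rw [this, map_zero]
        obtain ⟨g, hg, hdg⟩ := h (F.deg F.top) (by omega) _ (F.single_top_mem (f 1)) h₂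
        rw [F.eq_zero_of_mem_strand (Nat.lt_succ_self _) hg, map_zero] at hdg
        simpa using (congrFun hdg F.top).symm
      ext
      simpa using h₁
    obtain ⟨r, hr, hreg⟩ := IsSMulRegular.subsingleton_linearMap_iff.1 hsub
    rw [Ideal.annihilator_quotient] at hr
    obtain ⟨rs, hlen, hmem, hrs⟩ := ih (M := QuotSMulTop r M) (by
      intro hT
      apply hM
      have h₁ := congrArg (Submodule.comap (Submodule.mkQ (r • (⊤ : Submodule A M)))) hT
      rw [Submodule.comap_top, Submodule.comap_smul_top_of_surjective _ _
        (Submodule.mkQ_surjective _), Submodule.ker_mkQ, sup_eq_left.2] at h₁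
      · exact h₁
      · rw [← Submodule.ideal_span_singleton_smul]
        exact Submodule.smul_mono_left ((Ideal.span_singleton_le_iff_mem _).2 hr))
      (fun i hi => F.vanish_quotient hreg (Submodule.mkQ_surjective _)
        (quotSMulTop_mkQ_eq_zero_iff r) (h i (by omega)) fun h0 => h (i - 1) (by omega))
    exact ⟨r :: rs, by simp [hlen], by simpa [hr] using hmem, (isRegular_cons_iff M r rs).2
      ⟨hreg, hrs⟩⟩

variable (k : Type*) [Field k] [Algebra k A]

section Congr

variable [Module k M] [IsScalarTower k A M] {N : Type*} [AddCommGroup N] [Module A N] [Module k N]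
  [IsScalarTower k A N]

lemma betti_congr (e : M ≃ₗ[A] N) (i : ℕ) : F.betti k M i = F.betti k N i := by
  let ek : M →ₗ[k] N := e.toLinearMap.restrictScalars k
  let φ : gradedCycles (F.diffk k M) (F.strandk k M) i →ₗ[k]
      gradedCycles (F.diffk k N) (F.strandk k N) i :=
    LinearMap.restrict (ek.compLeft F.I) (by
      rintro f ⟨hdf, hf⟩
      refine ⟨?_, F.comp_mem_strand e.toLinearMap hf⟩
      change F.diff N (e.toLinearMap ∘ f) = 0
      have hdf : F.diff M f = 0 := hdf
      rw [matAct_comp, hdf]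
      ext a
      simp)
  have hφ : ∀ f, ((φ f : F.I → N)) = e.toLinearMap ∘ (f : F.I → M) := fun f => rfl
  have hsurj : Function.Surjective φ := by
    rintro ⟨f, hdf, hf⟩
    refine ⟨⟨e.symm.toLinearMap ∘ f, ?_, F.comp_mem_strand _ hf⟩, ?_⟩
    · change F.diff M (e.symm.toLinearMap ∘ f) = 0
      have hdf : F.diff N f = 0 := hdf
      rw [matAct_comp, hdf]
      ext a
      simp
    · ext a
      simp [hφ]
  refine (gradedHomologyEquiv (Submodule.mkQ _ ∘ₗ φ) ((Submodule.mkQ_surjective _).comp hsurj)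
    fun f => ?_).finrank_eq
  have h₁ : ((Submodule.mkQ ((gradedBoundaries (F.diffk k N) (F.strandk k N) i).submoduleOf
      (gradedCycles (F.diffk k N) (F.strandk k N) i)) ∘ₗ φ) f = 0) ↔
      (φ f : F.I → N) ∈ gradedBoundaries (F.diffk k N) (F.strandk k N) i :=
    Submodule.Quotient.mk_eq_zero _
  rw [h₁, F.mem_gradedBoundaries, F.mem_gradedBoundaries, hφ]
  constructor
  · rintro ⟨g, hg, hdg⟩
    refine ⟨e.symm.toLinearMap ∘ g, F.comp_mem_strand _ hg, ?_⟩
    rw [matAct_comp, hdg]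
    ext a
    simp
  · rintro ⟨g, hg, hdg⟩
    exact ⟨e.toLinearMap ∘ g, F.comp_mem_strand _ hg, by rw [matAct_comp, hdg]⟩

end Congr

variable [Module k M] [IsScalarTower k A M]

/-- Dividing by a regular sequence of length `t` in `(x)` moves the homology in degree
`top - t` to the top degree. -/
theorem betti_top_quotient (rs : List A) (hrs : ∀ r ∈ rs, r ∈ Ideal.span (Set.range x))
    (h : IsWeaklyRegular M rs) {j : ℕ} (hj : j + rs.length = F.deg F.top) :
    F.betti k (M ⧸ Ideal.ofList rs • (⊤ : Submodule A M)) (F.deg F.top) = F.betti k M j := by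
  induction rs generalizing M j with
  | nil =>
    rw [List.length_nil, add_zero] at hj
    rw [← hj]
    refine F.betti_congr k (Submodule.quotEquivOfEqBot _ ?_) j
    rw [Ideal.ofList_nil, Submodule.bot_smul]
  | cons r rs ih =>
    rw [isWeaklyRegular_cons_iff] at h
    rw [List.length_cons] at hj
    rw [F.betti_congr k (Submodule.quotOfListConsSMulTopEquivQuotSMulTopInner M r rs),
      ih (fun s hs => hrs s (List.mem_cons_of_mem _ hs)) h.2 (j := j + 1) (by omega)]
    exact F.betti_quotient k (hrs r List.mem_cons_self) h.1 (Submodule.mkQ_surjective _)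
      (quotSMulTop_mkQ_eq_zero_iff r)
      (F.vanish_of_isWeaklyRegular (r :: rs) hrs ((isWeaklyRegular_cons_iff M r rs).2 h)
        (by rw [List.length_cons]; omega))

/-- The top homology is the submodule of elements annihilated by `(x)`. -/
theorem betti_top : F.betti k M (F.deg F.top) = Module.finrank k
    ((Submodule.torsionBySet A M (Ideal.span (Set.range x) : Set A)).restrictScalars k) := by
  let φ : gradedCycles (F.diffk k M) (F.strandk k M) (F.deg F.top) →ₗ[k]
      (Submodule.torsionBySet A M (Ideal.span (Set.range x) : Set A)).restrictScalars k :=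
    LinearMap.codRestrict _ (LinearMap.proj F.top ∘ₗ Submodule.subtype _) (by
      rintro ⟨f, hdf, hf⟩
      have hdf : F.diff M f = 0 := hdf
      rw [F.eq_single_top hf] at hdf
      rw [Submodule.restrictScalars_mem, Submodule.mem_torsionBySet_iff]
      rintro ⟨r, hr⟩
      exact (F.diff_single_top_eq_zero_iff _).1 hdf r hr)
  have hφ : ∀ f, (φ f : M) = (f : F.I → M) F.top := fun f => rfl
  refine (gradedHomologyEquiv φ ?_ fun f => ?_).finrank_eq
  · rintro ⟨y, hy⟩
    rw [Submodule.restrictScalars_mem, Submodule.mem_torsionBySet_iff] at hy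
    refine ⟨⟨Pi.single F.top y, (F.diff_single_top_eq_zero_iff y).2 fun r hr => hy ⟨r, hr⟩,
      F.single_top_mem y⟩, ?_⟩
    ext
    simp [hφ]
  · obtain ⟨f, hdf, hf⟩ := f
    rw [F.mem_gradedBoundaries, Subtype.ext_iff, hφ]
    constructor
    · intro h
      refine ⟨0, Submodule.zero_mem _, ?_⟩
      have h : f F.top = 0 := h
      rw [map_zero]
      change 0 = f
      rw [F.eq_single_top hf, h, Pi.single_zero]
    · rintro ⟨g, hg, hdg⟩
      rw [F.eq_zero_of_mem_strand (Nat.lt_succ_self _) hg, map_zero] at hdg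
      exact (congrFun hdg F.top).symm

/-- The homology of a finite module is finite-dimensional over the base field, if every element of
`A` is congruent to a scalar modulo `(x)`. -/
theorem finite_gradedHomology [IsNoetherianRing A] [Module.Finite A M]
    (hk : ∀ a : A, ∃ c : k, a - algebraMap k A c ∈ Ideal.span (Set.range x)) (i : ℕ) :
    Module.Finite k (gradedHomology (F.diffk k M) (F.strandk k M) i) := by
  set B := (gradedBoundaries (F.diffk k M) (F.strandk k M) i).submoduleOf
    (gradedCycles (F.diffk k M) (F.strandk k M) i)
  have : IsNoetherian A (F.I → M) := isNoetherian_of_isNoetherianRing_of_finite A _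
  obtain ⟨s, hs⟩ := IsNoetherian.noetherian (LinearMap.ker (F.diff M) ⊓ F.strand M i)
  have hsub : ∀ f ∈ s, f ∈ gradedCycles (F.diffk k M) (F.strandk k M) i := fun f hf => by
    have : f ∈ LinearMap.ker (F.diff M) ⊓ F.strand M i := hs ▸ Submodule.subset_span hf
    exact this
  let q : s → gradedHomology (F.diffk k M) (F.strandk k M) i := fun f => B.mkQ ⟨f, hsub f f.2⟩
  rw [Module.finite_def]
  refine Submodule.fg_def.2 ⟨Set.range q, Set.finite_range q, ?_⟩
  rw [eq_top_iff]
  rintro z -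
  obtain ⟨⟨f, hf⟩, rfl⟩ := B.mkQ_surjective z
  have hf' : f ∈ Submodule.span A (s : Set (F.I → M)) := by
    rw [hs]
    exact hf
  have key : ∀ f ∈ Submodule.span A (s : Set (F.I → M)),
      ∃ hf : f ∈ gradedCycles (F.diffk k M) (F.strandk k M) i,
        B.mkQ ⟨f, hf⟩ ∈ Submodule.span k (Set.range q) := by
    intro f hf
    induction hf using Submodule.span_induction with
    | mem f hf => exact ⟨hsub f hf, Submodule.subset_span ⟨⟨f, hf⟩, rfl⟩⟩
    | zero => exact ⟨Submodule.zero_mem _, by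
        rw [show (⟨0, _⟩ : gradedCycles (F.diffk k M) (F.strandk k M) i) = 0 from rfl, map_zero]
        exact Submodule.zero_mem _⟩
    | add f g _ _ hf hg =>
      obtain ⟨hf, hf'⟩ := hf
      obtain ⟨hg, hg'⟩ := hg
      refine ⟨Submodule.add_mem _ hf hg, ?_⟩
      have := Submodule.add_mem _ hf' hg'
      rwa [← map_add] at this
    | smul a f _ hf =>
      obtain ⟨hf, hf'⟩ := hf
      obtain ⟨c, hc⟩ := hk a
      have haf : a • f ∈ gradedCycles (F.diffk k M) (F.strandk k M) i := by
        refine ⟨?_, (F.strand M i).smul_mem a hf.2⟩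
        change F.diff M (a • f) = 0
        rw [map_smul, show F.diff M f = 0 from hf.1, smul_zero]
      refine ⟨haf, ?_⟩
      -- Modulo boundaries, `a` acts as the scalar `c`.
      have h₁ : B.mkQ ⟨a • f, haf⟩ = c • B.mkQ ⟨f, hf⟩ := by
        rw [← map_smul, Submodule.mkQ_apply, Submodule.mkQ_apply, Submodule.Quotient.eq]
        have := F.exists_diff_eq_smul hc hf.2 hf.1
        rw [sub_smul, algebraMap_smul] at this
        exact this
      rw [h₁]
      exact Submodule.smul_mem _ _ hf'
  exact (key f hf').2
end

end KoszulFrame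

end RegularSequences

/-! ### Rigidity -/

namespace KoszulFrame

variable {V : Type u} {A : Type v} [CommRing A] {x : V → A} (F : KoszulFrame x)

lemma vanish_pi {i : ℕ} (h : F.Vanish A i) (n : ℕ) : F.Vanish (Fin n → A) i := by
  intro f hf hdf
  have key : ∀ c, ∃ g ∈ F.strand A (i + 1), F.diff A g =
      (LinearMap.proj c : (Fin n → A) →ₗ[A] A) ∘ f := fun c =>
    h _ (F.comp_mem_strand _ hf) (by
      rw [matAct_comp, hdf]
      rfl)
  choose g hg hdg using key
  refine ⟨fun a c => g c a, fun a ha => funext fun c => hg c a ha, ?_⟩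
  ext a c
  have h₁ := congrFun (matAct_comp (LinearMap.proj c : (Fin n → A) →ₗ[A] A) F.D
    (fun a c => g c a)) a
  have h₂ := congrFun (hdg c) a
  exact h₁.symm.trans h₂

/-- Nakayama's lemma: if `M = (x) M` for a finite module `M`, then `K(M)` is acyclic. -/
lemma vanish_of_vanish_zero {M : Type*} [AddCommGroup M] [Module A M] [Module.Finite A M]
    (h : F.Vanish M 0) (i : ℕ) : F.Vanish M i := by
  rw [F.vanish_zero_iff] at h
  obtain ⟨r, hr, hM⟩ := Submodule.exists_sub_one_mem_and_smul_eq_zero_of_fg_of_le_smul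
    (Ideal.span (Set.range x)) (⊤ : Submodule A M) Module.Finite.fg_top h.ge
  exact F.vanish_of_smul_eq_zero hr (fun y => hM y trivial) i

variable [IsNoetherianRing A]

/-- The case of first homology: choose a map from a finite free module to `M` that is bijective
modulo `(x)`. Its cokernel is acyclic, and so is its kernel if the first homology vanishes. -/
lemma vanish_of_vanish_one (hm : (Ideal.span (Set.range x)).IsMaximal)
    (hA : ∀ j, F.Vanish A (j + 1)) {M : Type w} [AddCommGroup M] [Module A M] [Module.Finite A M]
    (h : F.Vanish M 1) (j : ℕ) : F.Vanish M (j + 1) := by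
  set m := Ideal.span (Set.range x) with hmdef
  let _ := Ideal.Quotient.field m
  let q := Submodule.mkQ (m • (⊤ : Submodule A M))
  have hq : Function.Surjective q := Submodule.mkQ_surjective _
  have : Module.Finite A (M ⧸ m • (⊤ : Submodule A M)) := Module.Finite.of_surjective q hq
  have : Module.Finite (A ⧸ m) (M ⧸ m • (⊤ : Submodule A M)) :=
    Module.Finite.of_restrictScalars_finite A _ _
  let b := Module.finBasis (A ⧸ m) (M ⧸ m • (⊤ : Submodule A M))
  choose y hy using fun c => hq (b c)
  let φ := Fintype.linearCombination A y
  have hφ : ∀ f, φ f = ∑ c, f c • y c := fun f => Fintype.linearCombination_apply A y f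
  have hqφ : ∀ f, q (φ f) = ∑ c, Ideal.Quotient.mk m (f c) • b c := fun f => by
    rw [hφ, map_sum]
    refine Finset.sum_congr rfl fun c _ => ?_
    rw [map_smul, hy]
    rfl
  let π := Submodule.mkQ (LinearMap.range φ)
  have hC : ∀ i, F.Vanish (M ⧸ LinearMap.range φ) i := by
    apply F.vanish_of_vanish_zero
    rw [F.vanish_zero_iff, eq_top_iff]
    rintro z -
    obtain ⟨z, rfl⟩ := Submodule.mkQ_surjective _ z
    choose s hs using fun c => Ideal.Quotient.mk_surjective (b.repr (q z) c)
    have h₁ : z - φ s ∈ m • (⊤ : Submodule A M) := by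
      rw [← Submodule.Quotient.mk_eq_zero, ← Submodule.mkQ_apply]
      change q (z - φ s) = 0
      rw [map_sub, hqφ]
      simp only [hs]
      rw [b.sum_repr, sub_self]
    have h₂ : π z = π (z - φ s) := by
      rw [map_sub, (LinearMap.mem_ker.1 ((Submodule.ker_mkQ (LinearMap.range φ)).symm ▸
        LinearMap.mem_range_self φ s) : π (φ s) = 0), sub_zero]
    change π z ∈ _
    rw [h₂]
    have h₃ := Submodule.mem_map_of_mem (f := π) h₁
    rw [Submodule.map_smul''] at h₃
    exact Submodule.smul_mono le_rfl le_top h₃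
  have hπ : ∀ z, π z = 0 ↔ z ∈ LinearMap.range φ := fun z =>
    Submodule.Quotient.mk_eq_zero _
  have hR : F.Vanish (LinearMap.range φ) 1 :=
    F.vanish_ker (Submodule.mkQ_surjective _) _ hπ h (hC 2)
  let φ' := φ.rangeRestrict
  have hφ' : Function.Surjective φ' := φ.surjective_rangeRestrict
  have hK : ∀ f, φ' f = 0 ↔ f ∈ LinearMap.ker φ' := fun f => Iff.rfl
  have hker : ∀ f ∈ LinearMap.ker φ', f ∈ m • (⊤ : Submodule A (Fin _ → A)) := by
    intro f hf
    have h₁ : φ f = 0 := congrArg Subtype.val (LinearMap.mem_ker.1 hf)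
    have h₂ := hqφ f
    rw [h₁, map_zero] at h₂
    have h₃ := Fintype.linearIndependent_iff.1 b.linearIndependent _ h₂.symm
    rw [pi_eq_sum_univ f]
    exact Submodule.sum_mem _ fun c _ => Submodule.smul_mem_smul
      (Ideal.Quotient.eq_zero_iff_mem.1 (h₃ c)) trivial
  have hN : ∀ i, F.Vanish (LinearMap.ker φ') i := by
    apply F.vanish_of_vanish_zero
    intro f hf _
    refine F.exists_diff_eq_of_vanish hφ' _ hK hR ?_
    rw [F.eq_single_bot (F.comp_mem_strand (LinearMap.ker φ').subtype hf)]
    exact (F.exists_diff_eq_single_bot_iff _).2 (hker _ (f F.bot).2)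
  exact F.vanish_mid (Submodule.mkQ_surjective _) _ hπ
    (F.vanish_of_vanish_ker hφ' _ hK (F.vanish_pi (hA j) _) (hN j)) (hC _)

/-- Rigidity: if the complex is acyclic on free modules and the homology of a finite module
vanishes in one degree, then it vanishes in all higher degrees. -/
theorem vanish_of_le (hm : (Ideal.span (Set.range x)).IsMaximal)
    (hA : ∀ j, F.Vanish A (j + 1)) {M : Type v} [AddCommGroup M] [Module A M] [Module.Finite A M]
    {i j : ℕ} (hij : i ≤ j) (h : F.Vanish M i) : F.Vanish M j := by
  induction i generalizing M j with
  | zero => exact F.vanish_of_vanish_zero h j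
  | succ i ih =>
    obtain ⟨j, rfl⟩ : ∃ j', j = j' + 1 := ⟨j - 1, by omega⟩
    rcases i with _ | i
    · exact F.vanish_of_vanish_one hm hA h j
    · obtain ⟨n, φ, hφ⟩ := Module.Finite.exists_fin' A M
      have hK : ∀ f, φ f = 0 ↔ f ∈ LinearMap.ker φ := fun f => Iff.rfl
      have hN := F.vanish_ker hφ _ hK (F.vanish_pi (hA i) n) h
      exact F.vanish_of_vanish_ker hφ _ hK (F.vanish_pi (hA j) n) (ih (by omega) hN)

end KoszulFrame

/-! ### The variables of a polynomial ring -/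

namespace MvPolynomial

variable {V : Type u} (k : Type w) [Field k]

lemma mem_span_X_of_X_mul_mem {s : Set V} {v : V} (hv : v ∉ s) {f : MvPolynomial V k}
    (h : X v * f ∈ Ideal.span (X '' s : Set (MvPolynomial V k))) :
    f ∈ Ideal.span (X '' s : Set (MvPolynomial V k)) := by
  rw [mem_ideal_span_X_image] at h ⊢
  intro m hm
  obtain ⟨i, hi, hmi⟩ := h (Finsupp.single v 1 + m) (by
    rw [mem_support_iff, coeff_X_mul]
    exact mem_support_iff.1 hm)
  refine ⟨i, hi, ?_⟩
  have : v ≠ i := fun h => hv (h ▸ hi)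
  simpa [this] using hmi

open RingTheory.Sequence in
/-- Distinct variables form a regular sequence. -/
lemma isWeaklyRegular_map_X (l : List V) (hl : l.Nodup) :
    IsWeaklyRegular (MvPolynomial V k) (l.map (X : V → MvPolynomial V k)) := by
  rw [isWeaklyRegular_iff]
  intro i hi
  rw [isSMulRegular_quotient_iff_mem_of_smul_mem]
  have hi' : i < l.length := by simpa using hi
  have h₁ : (Ideal.ofList ((l.map (X : V → MvPolynomial V k)).take i) •
      (⊤ : Submodule (MvPolynomial V k) (MvPolynomial V k))) =
      Ideal.span (X '' {v | v ∈ l.take i}) := by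
    rw [smul_eq_mul, Ideal.mul_top, Ideal.ofList]
    congr 1
    ext p
    rw [← List.map_take]
    exact List.mem_map
  intro f hf
  rw [h₁] at hf ⊢
  rw [List.getElem_map, smul_eq_mul] at hf
  refine mem_span_X_of_X_mul_mem k ?_ hf
  intro hmem
  obtain ⟨j, hj, hji⟩ := List.mem_iff_getElem.1 (Set.mem_ofPred.1 hmem)
  rw [List.length_take] at hj
  rw [List.getElem_take, hl.getElem_inj_iff] at hji
  omega

lemma sub_C_constantCoeff_mem (f : MvPolynomial V k) :
    f - C (constantCoeff f) ∈ Ideal.span (Set.range (X : V → MvPolynomial V k)) := by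
  rw [← Set.image_univ, mem_ideal_span_X_image]
  intro m hm
  by_contra! h
  have hm0 : m = 0 := by
    ext v
    exact h v trivial
  subst hm0
  rw [mem_support_iff] at hm
  apply hm
  rw [← constantCoeff_eq]
  simp

lemma mem_span_range_X_iff (f : MvPolynomial V k) :
    f ∈ Ideal.span (Set.range (X : V → MvPolynomial V k)) ↔ constantCoeff f = 0 := by
  constructor
  · intro h
    have : Ideal.span (Set.range (X : V → MvPolynomial V k)) ≤ RingHom.ker constantCoeff := by
      rw [Ideal.span_le]
      rintro _ ⟨v, rfl⟩
      simp
    exact this h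
  · intro h
    simpa [h] using sub_C_constantCoeff_mem k f

lemma isMaximal_span_range_X :
    (Ideal.span (Set.range (X : V → MvPolynomial V k))).IsMaximal := by
  have : Ideal.span (Set.range (X : V → MvPolynomial V k)) =
      RingHom.ker (constantCoeff : MvPolynomial V k →+* k) := by
    ext f
    rw [mem_span_range_X_iff, RingHom.mem_ker]
  rw [this]
  exact RingHom.ker_isMaximal_of_surjective _ fun c => ⟨C c, constantCoeff_C _ c⟩

end MvPolynomial

namespace KoszulFrame

/-- The complex of the variables is acyclic in positive degrees on the polynomial ring. -/
lemma vanish_mvPolynomial {V : Type u} {k : Type w} [Field k] [Finite V]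
    (F : KoszulFrame (MvPolynomial.X : V → MvPolynomial V k)) (j : ℕ) :
    F.Vanish (MvPolynomial V k) (j + 1) := by
  have := Fintype.ofFinite V
  refine F.vanish_of_isWeaklyRegular (Finset.univ.toList.map MvPolynomial.X) ?_
    (MvPolynomial.isWeaklyRegular_map_X k _ (Finset.nodup_toList _)) ?_
  · intro r hr
    obtain ⟨v, _, rfl⟩ := List.mem_map.1 hr
    exact Ideal.subset_span ⟨v, rfl⟩
  · rw [F.deg_top, List.length_map, Finset.length_toList, Finset.card_univ,
      Nat.card_eq_fintype_card]
    omega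

end KoszulFrame

/-! ### Splitting a complex over a field -/

section Splitting

variable {k : Type*} [Field k] {T : Type*} [AddCommGroup T] [Module k T]

/-- A splitting of a complex `(T, d)` of vector spaces with graded pieces `G`: homogeneous cycles
`z a` and a projection `p` onto their span along a subspace that `h` contracts. The classes of the
`z a` then form a basis of the homology. -/
structure GradedSplitting (d : T →ₗ[k] T) (G : ℕ → Submodule k T) where
  A : Type
  [fintype : Fintype A]
  [decEq : DecidableEq A]
  deg : A → ℕ
  z : A → T
  p : T →ₗ[k] (A → k)
  h : T →ₗ[k] T
  z_mem : ∀ a, z a ∈ G (deg a)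
  d_z : ∀ a, d (z a) = 0
  p_d : ∀ t, p (d t) = 0
  p_z : ∀ a, p (z a) = Pi.single a 1
  p_eq_zero : ∀ n, ∀ t ∈ G n, ∀ a, deg a ≠ n → p t a = 0
  h_mem : ∀ n, ∀ t ∈ G n, h t ∈ G (n + 1)
  homotopy : ∀ t, d (h t) + h (d t) = t - ∑ a, p t a • z a

attribute [instance] GradedSplitting.fintype GradedSplitting.decEq

namespace GradedSplitting

variable {d : T →ₗ[k] T} {G : ℕ → Submodule k T}

/-- The classes of the cycles `z a` of degree `n` form a basis of the homology in degree `n`. -/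
theorem finrank_gradedHomology (s : GradedSplitting d G) (n : ℕ) :
    Module.finrank k (gradedHomology d G n) = (Finset.univ.filter fun a => s.deg a = n).card := by
  let φ : gradedCycles d G n →ₗ[k] ({a // s.deg a = n} → k) :=
    (LinearMap.funLeft k k (Subtype.val : {a // s.deg a = n} → s.A)) ∘ₗ s.p ∘ₗ Submodule.subtype _
  have hφ : ∀ f a, φ f a = s.p f a.1 := fun f a => rfl
  have h₁ := (gradedHomologyEquiv φ ?_ ?_).finrank_eq
  · rw [h₁, Module.finrank_fintype_fun_eq_card, Fintype.card_subtype]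
  · intro g
    refine ⟨⟨∑ a, (if h : s.deg a = n then g ⟨a, h⟩ else 0) • s.z a, ?_, ?_⟩, ?_⟩
    · change d _ = 0
      rw [map_sum]
      exact Finset.sum_eq_zero fun a _ => by rw [map_smul, s.d_z, smul_zero]
    · refine Submodule.sum_mem _ fun a _ => ?_
      by_cases h : s.deg a = n
      · exact Submodule.smul_mem _ _ (h ▸ s.z_mem a)
      · rw [dif_neg h, zero_smul]
        exact Submodule.zero_mem _
    · ext ⟨b, hb⟩
      rw [hφ]
      simp only [map_sum, map_smul, s.p_z, Finset.sum_apply, Pi.smul_apply, smul_eq_mul]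
      rw [Finset.sum_eq_single b]
      · simp [hb]
      · intro c _ hc
        simp [hc.symm]
      · simp
  · rintro ⟨f, hdf, hf⟩
    have hdf : d f = 0 := hdf
    constructor
    · intro h
      have hp : s.p f = 0 := by
        ext a
        by_cases ha : s.deg a = n
        · exact congrFun h ⟨a, ha⟩
        · exact s.p_eq_zero n f hf a ha
      have := s.homotopy f
      rw [hdf, map_zero, hp] at this
      simp only [Pi.zero_apply, zero_smul, Finset.sum_const_zero, add_zero, sub_zero] at this
      exact ⟨s.h f, s.h_mem n f hf, this⟩
    · rintro ⟨g, _, hg⟩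
      ext a
      rw [hφ]
      change s.p f a.1 = 0
      change d g = f at hg
      rw [← hg, s.p_d]
      rfl

end GradedSplitting

/-- Every endomorphism of a vector space has a generalized inverse. -/
lemma exists_generalized_inverse (f : Module.End k T) : ∃ g : Module.End k T, f * g * f = f := by
  obtain ⟨s, hs⟩ := f.rangeRestrict.exists_rightInverse_of_surjective f.range_rangeRestrict
  obtain ⟨r, hr⟩ := (LinearMap.range f).subtype.exists_leftInverse_of_injective
    (LinearMap.range f).ker_subtype
  refine ⟨s ∘ₗ r, ?_⟩
  ext t
  have h₁ : r (f t) = f.rangeRestrict t := LinearMap.congr_fun hr (f.rangeRestrict t)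
  have h₂ : f (s (f.rangeRestrict t)) = f t :=
    congrArg Subtype.val (LinearMap.congr_fun hs (f.rangeRestrict t))
  simp [h₁, h₂]

/-- A generalized inverse of a differential can be improved to one of square zero. -/
lemma exists_homotopy {E : Type*} [Ring E] {d h₀ : E} (hd : d * d = 0) (h : d * h₀ * d = d) :
    let h₁ := h₀ * d * h₀
    let h₂ := h₁ - h₁ * h₁ * d
    d * h₂ * d = d ∧ h₂ * h₂ = 0 := by
  intro h₁ h₂
  have e₁ : d * h₁ * d = d := by
    simp only [h₁]
    rw [show d * (h₀ * d * h₀) * d = (d * h₀ * d) * h₀ * d by noncomm_ring, h, h]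
  have e₂ : h₁ * d * h₁ = h₁ := by
    simp only [h₁]
    rw [show h₀ * d * h₀ * d * (h₀ * d * h₀) = h₀ * (d * h₀ * d) * h₀ * d * h₀ by noncomm_ring, h,
      show h₀ * d * h₀ * d * h₀ = h₀ * (d * h₀ * d) * h₀ by noncomm_ring, h]
  constructor
  · simp only [h₂]
    rw [show d * (h₁ - h₁ * h₁ * d) * d = d * h₁ * d - d * h₁ * h₁ * (d * d) by noncomm_ring, e₁,
      hd, mul_zero, sub_zero]
  · simp only [h₂]
    rw [show (h₁ - h₁ * h₁ * d) * (h₁ - h₁ * h₁ * d) = h₁ * h₁ - h₁ * h₁ * h₁ * d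
      - h₁ * (h₁ * d * h₁) + h₁ * (h₁ * d * h₁) * h₁ * d by noncomm_ring, e₂]
    noncomm_ring

/-- A complex of vector spaces with finite-dimensional homology, decomposed into finitely many
graded pieces by the projections `e i`, has a splitting. -/
theorem exists_gradedSplitting {d : Module.End k T} {G : ℕ → Submodule k T}
    (e : ℕ → Module.End k T) (N : ℕ) (hd : d * d = 0)
    (he : ∀ i, e i * e i = e i) (he' : ∀ i j, i ≠ j → e i * e j = 0)
    (hsum : ∑ i ∈ Finset.range N, e i = 1) (hN : ∀ i, N ≤ i → e i = 0)
    (hed : ∀ i, e i * d = d * e (i + 1)) (hd0 : d * e 0 = 0)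
    (hG : ∀ i t, t ∈ G i ↔ e i t = t)
    (hfin : ∀ i, Module.Finite k (gradedHomology d G i)) :
    Nonempty (GradedSplitting d G) := by
  -- Generalized inverses of the graded components of `d` add up to a generalized inverse `h₀` of
  -- `d` that raises degrees by one.
  choose g hg using fun i => exists_generalized_inverse (d * e (i + 1))
  have hsum' : e 0 + ∑ i ∈ Finset.range N, e (i + 1) = 1 := by
    have h := Finset.sum_range_succ' e N
    rw [Finset.sum_range_succ, hsum, hN N le_rfl, add_zero] at h
    rw [h, add_comm]
  set h₀ : Module.End k T := ∑ i ∈ Finset.range N, e (i + 1) * g i * e i with hh₀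
  have hdh : d * h₀ * d = d := by
    rw [hh₀, Finset.mul_sum, Finset.sum_mul]
    have h₁ : ∀ i ∈ Finset.range N, d * (e (i + 1) * g i * e i) * d = d * e (i + 1) := by
      intro i _
      rw [show d * (e (i + 1) * g i * e i) * d = d * e (i + 1) * g i * (e i * d) by
        noncomm_ring, hed, hg]
    rw [Finset.sum_congr rfl h₁, ← Finset.mul_sum]
    have h₂ : d * (e 0 + ∑ i ∈ Finset.range N, e (i + 1)) = d := by rw [hsum', mul_one]
    rwa [mul_add, hd0, zero_add] at h₂
  have deg₀ : ∀ i, h₀ * e i = e (i + 1) * h₀ := by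
    intro i
    rw [hh₀, Finset.sum_mul, Finset.mul_sum]
    refine Finset.sum_congr rfl fun j _ => ?_
    by_cases hij : j = i
    · subst hij
      rw [mul_assoc _ (e j) (e j), he, ← mul_assoc, ← mul_assoc, he]
    · rw [mul_assoc _ (e j) (e i), he' j i hij, mul_zero, ← mul_assoc, ← mul_assoc,
        he' (i + 1) (j + 1) (by omega), zero_mul, zero_mul]
  set h₁ := h₀ * d * h₀ with hh₁
  set h := h₁ - h₁ * h₁ * d with hh
  obtain ⟨hdhd, hhh⟩ := exists_homotopy hd hdh
  rw [← hh₁, ← hh] at hdhd hhh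
  have deg₁ : ∀ i, h₁ * e i = e (i + 1) * h₁ := by
    intro i
    rw [hh₁, mul_assoc _ h₀ (e i), deg₀, mul_assoc h₀ d, ← mul_assoc d, ← hed, ← mul_assoc,
      ← mul_assoc, deg₀]
    noncomm_ring
  have zero₁ : e 0 * h₁ = 0 := by
    rw [← mul_one (e 0 * h₁), ← hsum, Finset.mul_sum]
    refine Finset.sum_eq_zero fun i _ => ?_
    rw [mul_assoc, deg₁, ← mul_assoc, he' 0 (i + 1) (by omega), zero_mul]
  have deg : ∀ i, h * e i = e (i + 1) * h := by
    intro i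
    rw [hh, sub_mul, mul_sub, deg₁]
    congr 1
    rcases i with _ | i
    · rw [mul_assoc, hd0, mul_zero, ← mul_assoc, ← mul_assoc, ← deg₁, mul_assoc h₁, zero₁,
        mul_zero, zero_mul]
    · rw [mul_assoc, ← hed, ← mul_assoc, mul_assoc h₁, deg₁, ← mul_assoc, deg₁]
      noncomm_ring
  have zero : e 0 * h = 0 := by
    rw [hh, mul_sub, zero₁, ← mul_assoc, ← mul_assoc, zero₁]
    simp
  clear_value h
  -- The idempotent `π` projects onto a space of cycles that represent the homology.
  set π : Module.End k T := 1 - d * h - h * d with hπ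
  have dπ : d * π = 0 := by
    rw [hπ, show d * (1 - d * h - h * d) = d - d * d * h - d * h * d by noncomm_ring, hd, hdhd]
    simp
  have πd : π * d = 0 := by
    rw [hπ, show (1 - d * h - h * d) * d = d - d * h * d - h * (d * d) by noncomm_ring, hd, hdhd]
    simp
  have ππ : π * π = π := by
    nth_rewrite 2 [hπ]
    rw [mul_sub, mul_sub, mul_one, ← mul_assoc, πd, zero_mul, sub_zero]
    have : π * h * d = 0 := by
      rw [hπ, show (1 - d * h - h * d) * h * d = h * d - d * (h * h) * d - h * (d * h * d) by
        noncomm_ring, hhh, hdhd]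
      simp
    rw [← mul_assoc, this, sub_zero]
  have degπ : ∀ i, π * e i = e i * π := by
    intro i
    have e₁ : d * h * e i = e i * (d * h) := by
      rw [mul_assoc, deg, ← mul_assoc, ← hed, mul_assoc]
    have e₂ : h * d * e i = e i * (h * d) := by
      rcases i with _ | i
      · rw [mul_assoc, hd0, mul_zero, ← mul_assoc, zero, zero_mul]
      · rw [mul_assoc, ← hed, ← mul_assoc, deg, mul_assoc]
    rw [hπ, sub_mul, sub_mul, mul_sub, mul_sub, e₁, e₂]
    simp
  let W : ℕ → Submodule k T := fun i => LinearMap.range (π * e i)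
  have hWG : ∀ i, ∀ t ∈ W i, e i t = t := by
    rintro i _ ⟨t, rfl⟩
    rw [← Module.End.mul_apply, ← mul_assoc, ← degπ, mul_assoc, he]
  have hWπ : ∀ i, ∀ t ∈ W i, π t = t := by
    rintro i _ ⟨t, rfl⟩
    rw [← Module.End.mul_apply, ← mul_assoc, ππ]
  have hWd : ∀ i, ∀ t ∈ W i, d t = 0 := by
    rintro i t ht
    rw [← hWπ i t ht, ← Module.End.mul_apply, dπ]
    rfl
  have hWfin : ∀ i, Module.Finite k (W i) := by
    intro i
    have := hfin i
    let ψ : W i →ₗ[k] gradedHomology d G i :=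
      Submodule.mkQ _ ∘ₗ LinearMap.codRestrict (gradedCycles d G i) (W i).subtype
        fun t => ⟨hWd i t t.2, (hG i t).2 (hWG i t t.2)⟩
    refine Module.Finite.of_injective ψ (LinearMap.ker_eq_bot.1 (LinearMap.ker_eq_bot'.2 ?_))
    intro t ht
    have ht' := (Submodule.Quotient.mk_eq_zero
      ((gradedBoundaries d G i).submoduleOf (gradedCycles d G i))).1 ht
    obtain ⟨g, _, hg⟩ : (t : T) ∈ gradedBoundaries d G i := ht'
    apply Subtype.ext
    rw [← hWπ i t t.2, ← hg, ← Module.End.mul_apply, πd]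
    rfl
  let b := fun i => Module.finBasis k (W i)
  refine ⟨{
    A := Σ i : Fin N, Fin (Module.finrank k (W i))
    deg := fun a => a.1
    z := fun a => b a.1 a.2
    p := LinearMap.pi fun a => (b a.1).coord a.2 ∘ₗ (π * e a.1).rangeRestrict
    h := h
    z_mem := fun a => (hG _ _).2 (hWG _ _ (b a.1 a.2).2)
    d_z := fun a => hWd _ _ (b a.1 a.2).2
    p_d := ?_
    p_z := ?_
    p_eq_zero := ?_
    h_mem := ?_
    homotopy := ?_ }⟩
  · intro t
    ext a
    have : (π * e a.1).rangeRestrict (d t) = 0 := by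
      apply Subtype.ext
      change (π * e a.1) (d t) = 0
      rw [← Module.End.mul_apply, mul_assoc, hed, ← mul_assoc, πd, zero_mul]
      rfl
    simp [this]
  · rintro ⟨i, a⟩
    ext ⟨j, c⟩
    by_cases hij : i = j
    · subst hij
      have : (π * e i).rangeRestrict (b i a) = b i a := by
        apply Subtype.ext
        change (π * e i) (b i a) = b i a
        rw [Module.End.mul_apply, hWG i _ (b i a).2, hWπ i _ (b i a).2]
      simp only [LinearMap.pi_apply, LinearMap.comp_apply, this, Module.Basis.coord_apply,
        Module.Basis.repr_self]
      by_cases hac : a = c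
      · subst hac
        simp
      · have : (⟨i, c⟩ : Σ i : Fin N, Fin (Module.finrank k (W i))) ≠ ⟨i, a⟩ := by
          intro h
          simp at h
          exact hac h.symm
        rw [Pi.single_eq_of_ne this, Finsupp.single_eq_of_ne (Ne.symm hac)]
    · have : (π * e j).rangeRestrict (b i a) = 0 := by
        apply Subtype.ext
        change (π * e j) (b i a) = 0
        rw [← hWG i _ (b i a).2, ← Module.End.mul_apply, mul_assoc,
          he' j i (fun h => hij (Fin.ext h.symm)), mul_zero]
        rfl
      have hne : (⟨j, c⟩ : Σ i : Fin N, Fin (Module.finrank k (W i))) ≠ ⟨i, a⟩ := by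
        intro h
        exact hij (congrArg Sigma.fst h).symm
      rw [Pi.single_eq_of_ne hne]
      simp only [LinearMap.pi_apply, LinearMap.comp_apply, this, map_zero]
  · rintro n t ht ⟨i, a⟩ hi
    have : (π * e i).rangeRestrict t = 0 := by
      apply Subtype.ext
      change (π * e i) t = 0
      rw [← (hG n t).1 ht, ← Module.End.mul_apply, mul_assoc, he' i n hi, mul_zero]
      rfl
    simp only [LinearMap.pi_apply, LinearMap.comp_apply, this, map_zero]
  · intro n t ht
    rw [hG] at ht ⊢
    rw [← Module.End.mul_apply, ← deg, Module.End.mul_apply, ht]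
  · intro t
    have h₁ : ∀ i : Fin N, ∑ c, (b i).coord c ((π * e i).rangeRestrict t) • (b i c : T) =
        (π * e i) t := by
      intro i
      have := congrArg Subtype.val ((b i).sum_repr ((π * e i).rangeRestrict t))
      rw [Submodule.coe_sum] at this
      exact this
    have h₂ : ∑ i ∈ Finset.range N, (π * e i) = π := by rw [← Finset.mul_sum, hsum, mul_one]
    rw [Fintype.sum_sigma]
    simp only [LinearMap.pi_apply, LinearMap.comp_apply]
    rw [Finset.sum_congr rfl fun i _ => h₁ i, Fin.sum_univ_eq_sum_range (fun i => (π * e i) t) N,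
      ← LinearMap.sum_apply, h₂, hπ]
    simp only [LinearMap.sub_apply, Module.End.mul_apply, Module.End.one_apply]
    abel

end Splitting

/-! ### Tensor products of split complexes -/

section Kunneth

open scoped TensorProduct

section TensorSplitting

variable {k : Type*} [Field k] {T₁ T₂ : Type*} [AddCommGroup T₁] [Module k T₁]
  [AddCommGroup T₂] [Module k T₂]

/-- The graded pieces of the tensor product of two graded vector spaces. -/
def tensorGrading (G₁ : ℕ → Submodule k T₁) (G₂ : ℕ → Submodule k T₂) (n : ℕ) :
    Submodule k (T₁ ⊗[k] T₂) :=
  Submodule.span k {t | ∃ i j, i + j = n ∧ ∃ a ∈ G₁ i, ∃ b ∈ G₂ j, a ⊗ₜ b = t}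

/-- The differential `d₁ ⊗ 1 + ε ⊗ d₂` of a tensor product; `ε` stands for `(-1)^deg` on the first
factor. -/
noncomputable def tensorDifferential (d₁ ε : T₁ →ₗ[k] T₁) (d₂ : T₂ →ₗ[k] T₂) :
    (T₁ ⊗[k] T₂) →ₗ[k] (T₁ ⊗[k] T₂) :=
  TensorProduct.map d₁ LinearMap.id + TensorProduct.map ε d₂

variable {d₁ ε : T₁ →ₗ[k] T₁} {d₂ : T₂ →ₗ[k] T₂} {G₁ : ℕ → Submodule k T₁}
  {G₂ : ℕ → Submodule k T₂}

/-- The tensor product of two splittings; the contraction is `h₁ ⊗ 1 + π₁ ε ⊗ h₂`, where `π₁` is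
the projection of the first splitting. -/
noncomputable def GradedSplitting.tensor (s₁ : GradedSplitting d₁ G₁) (s₂ : GradedSplitting d₂ G₂)
    (hε : ∀ n, ∀ t ∈ G₁ n, ε t = (-1 : k) ^ n • t) (hd0 : ∀ t ∈ G₁ 0, d₁ t = 0)
    (hd : ∀ n, ∀ t ∈ G₁ (n + 1), d₁ t ∈ G₁ n) (htop : ⨆ n, G₁ n = ⊤) :
    GradedSplitting (tensorDifferential d₁ ε d₂) (tensorGrading G₁ G₂) where
  A := s₁.A × s₂.A
  deg a := s₁.deg a.1 + s₂.deg a.2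
  z a := s₁.z a.1 ⊗ₜ s₂.z a.2
  p := LinearMap.pi fun a => LinearMap.mul' k k ∘ₗ
    TensorProduct.map (LinearMap.proj a.1 ∘ₗ s₁.p) (LinearMap.proj a.2 ∘ₗ s₂.p)
  h := TensorProduct.map s₁.h LinearMap.id +
    TensorProduct.map ((∑ a, (LinearMap.proj a ∘ₗ s₁.p).smulRight (s₁.z a)) ∘ₗ ε) s₂.h
  z_mem a := Submodule.subset_span ⟨_, _, rfl, _, s₁.z_mem _, _, s₂.z_mem _, rfl⟩
  d_z a := by
    simp [tensorDifferential, s₁.d_z, s₂.d_z]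
  p_d t := by
    induction t using TensorProduct.induction_on with
    | zero => simp
    | add x y hx hy => rw [map_add, map_add, hx, hy, add_zero]
    | tmul a b =>
      ext c
      simp [tensorDifferential, s₁.p_d, s₂.p_d]
  p_z a := by
    ext c
    simp only [LinearMap.pi_apply, LinearMap.comp_apply, TensorProduct.map_tmul, s₁.p_z, s₂.p_z,
      LinearMap.proj_apply, LinearMap.mul'_apply]
    by_cases h₁ : c.1 = a.1
    · by_cases h₂ : c.2 = a.2
      · rw [Prod.ext h₁ h₂]
        simp
      · rw [Pi.single_eq_of_ne h₂, Pi.single_eq_of_ne fun h => h₂ (congrArg Prod.snd h), mul_zero]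
    · rw [Pi.single_eq_of_ne h₁, Pi.single_eq_of_ne fun h => h₁ (congrArg Prod.fst h), zero_mul]
  p_eq_zero n t ht a ha := by
    induction ht using Submodule.span_induction with
    | zero => simp
    | add x y _ _ hx hy => rw [map_add, Pi.add_apply, hx, hy, add_zero]
    | smul c x _ hx => rw [map_smul, Pi.smul_apply, hx, smul_zero]
    | mem t ht =>
      obtain ⟨i, j, hij, x, hx, y, hy, rfl⟩ := ht
      simp only [LinearMap.pi_apply, LinearMap.comp_apply, TensorProduct.map_tmul,
        LinearMap.proj_apply, LinearMap.mul'_apply]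
      by_cases h₁ : s₁.deg a.1 = i
      · rw [s₂.p_eq_zero j y hy a.2 (by omega), mul_zero]
      · rw [s₁.p_eq_zero i x hx a.1 h₁, zero_mul]
  h_mem n t ht := by
    induction ht using Submodule.span_induction with
    | zero => simp
    | add x y _ _ hx hy => rw [map_add]; exact Submodule.add_mem _ hx hy
    | smul c x _ hx => rw [map_smul]; exact Submodule.smul_mem _ _ hx
    | mem t ht =>
      obtain ⟨i, j, hij, x, hx, y, hy, rfl⟩ := ht
      rw [LinearMap.add_apply, TensorProduct.map_tmul, TensorProduct.map_tmul]
      refine Submodule.add_mem _ (Submodule.subset_span ⟨i + 1, j, by omega, _, s₁.h_mem _ _ hx,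
        _, hy, rfl⟩) (Submodule.subset_span ⟨i, j + 1, by omega, _, ?_, _, s₂.h_mem _ _ hy, rfl⟩)
      rw [LinearMap.comp_apply, hε i x hx, LinearMap.sum_apply]
      refine Submodule.sum_mem _ fun a _ => ?_
      by_cases h₁ : s₁.deg a = i
      · exact Submodule.smul_mem _ _ (h₁ ▸ s₁.z_mem a)
      · simp [s₁.p_eq_zero i x hx a h₁]
  homotopy t := by
    induction t using TensorProduct.induction_on with
    | zero => simp
    | add x y hx hy =>
      simp only [map_add, Pi.add_apply, add_smul, Finset.sum_add_distrib] at hx hy ⊢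
      rw [add_add_add_comm, hx, hy]
      abel
    | tmul x y =>
      have hx : x ∈ ⨆ n, G₁ n := htop ▸ trivial
      induction hx using Submodule.iSup_induction' with
      | zero => simp
      | add x x' _ _ hx hx' =>
        simp only [TensorProduct.add_tmul, map_add, Pi.add_apply, add_smul,
          Finset.sum_add_distrib] at hx hx' ⊢
        rw [add_add_add_comm, hx, hx']
        abel
      | mem n x hx =>
        set π : T₁ →ₗ[k] T₁ := ∑ a, (LinearMap.proj a ∘ₗ s₁.p).smulRight (s₁.z a) with hπ
        have hπ' : ∀ t, π t = ∑ a, s₁.p t a • s₁.z a := fun t => by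
          simp [hπ, LinearMap.sum_apply]
        have hπd : π (ε (d₁ x)) = 0 := by
          rcases n with _ | n
          · rw [hd0 x hx, map_zero, map_zero]
          · rw [hε n _ (hd n x hx), map_smul, hπ', s₁.p_d]
            simp
        have hdπ : d₁ (π x) = 0 := by
          rw [hπ', map_sum]
          exact Finset.sum_eq_zero fun a _ => by rw [map_smul, s₁.d_z, smul_zero]
        have hεπ : ε (π x) = (-1 : k) ^ n • π x := by
          refine hε n _ ?_
          rw [hπ']
          refine Submodule.sum_mem _ fun a _ => ?_
          by_cases h₁ : s₁.deg a = n
          · exact Submodule.smul_mem _ _ (h₁ ▸ s₁.z_mem a)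
          · simp [s₁.p_eq_zero n x hx a h₁]
        have hεh : ε (s₁.h x) = (-1 : k) ^ (n + 1) • s₁.h x := hε _ _ (s₁.h_mem n x hx)
        have h₁ : d₁ (s₁.h x) + s₁.h (d₁ x) = x - π x := by rw [hπ', s₁.homotopy]
        have h₂ := s₂.homotopy y
        have hsq : ((-1 : k) ^ n) * (-1) ^ n = 1 := by rw [← mul_pow]; simp
        have hsum : ∑ a : s₁.A × s₂.A, (s₁.p x a.1 * s₂.p y a.2) • (s₁.z a.1 ⊗ₜ[k] s₂.z a.2) =
            π x ⊗ₜ (∑ b, s₂.p y b • s₂.z b) := by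
          rw [hπ', TensorProduct.sum_tmul, Fintype.sum_prod_type]
          refine Finset.sum_congr rfl fun a _ => ?_
          rw [TensorProduct.tmul_sum]
          refine Finset.sum_congr rfl fun b _ => ?_
          rw [TensorProduct.smul_tmul_smul]
        simp only [LinearMap.pi_apply, LinearMap.comp_apply, TensorProduct.map_tmul,
          LinearMap.proj_apply, LinearMap.mul'_apply, tensorDifferential, LinearMap.add_apply,
          LinearMap.id_apply, map_add]
        rw [hsum, hπd, hε n x hx]
        simp only [map_smul, hdπ, hεπ, hεh, hε n x hx, smul_smul, hsq, one_smul,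
          TensorProduct.zero_tmul, smul_zero, ← TensorProduct.smul_tmul', zero_add, pow_succ,
          mul_neg, mul_one, neg_smul, TensorProduct.neg_tmul]
        have e₁ := congrArg (fun t => t ⊗ₜ[k] y) h₁
        have e₂ := congrArg (fun t => (π x) ⊗ₜ[k] t) h₂
        simp only [TensorProduct.add_tmul, TensorProduct.sub_tmul] at e₁
        simp only [TensorProduct.tmul_add, TensorProduct.tmul_sub] at e₂
        rw [eq_sub_iff_add_eq] at e₁ e₂ ⊢
        rw [← e₁, ← e₂]
        generalize (-1 : k) ^ n • s₁.h x ⊗ₜ[k] d₂ y = w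
        abel

end TensorSplitting

/-! ### The Künneth formula for tensor products of frames -/

/-- An isomorphism of graded complexes induces an isomorphism on homology. -/
lemma finrank_gradedHomology_congr {k T T' : Type*} [Field k] [AddCommGroup T] [Module k T]
    [AddCommGroup T'] [Module k T'] {d : T →ₗ[k] T} {d' : T' →ₗ[k] T'} {G : ℕ → Submodule k T}
    {G' : ℕ → Submodule k T'} (e : T ≃ₗ[k] T') (hd : ∀ t, e (d t) = d' (e t))
    (hG : ∀ n t, t ∈ G n ↔ e t ∈ G' n) (n : ℕ) :
    Module.finrank k (gradedHomology d G n) = Module.finrank k (gradedHomology d' G' n) := by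
  have hmem : ∀ t, t ∈ gradedCycles d G n ↔ e t ∈ gradedCycles d' G' n := fun t => by
    simp only [gradedCycles, Submodule.mem_inf, LinearMap.mem_ker, ← hG, ← hd,
      e.map_eq_zero_iff]
  let φ : gradedCycles d G n →ₗ[k] gradedCycles d' G' n :=
    LinearMap.restrict e.toLinearMap fun t ht => (hmem t).1 ht
  refine (gradedHomologyEquiv (Submodule.mkQ _ ∘ₗ φ) ((Submodule.mkQ_surjective _).comp ?_)
    fun f => ?_).finrank_eq
  · rintro ⟨t, ht⟩
    exact ⟨⟨e.symm t, (hmem _).2 (by simpa using ht)⟩, Subtype.ext (e.apply_symm_apply t)⟩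
  · have h₁ : ((Submodule.mkQ ((gradedBoundaries d' G' n).submoduleOf
        (gradedCycles d' G' n)) ∘ₗ φ) f = 0) ↔ e f ∈ gradedBoundaries d' G' n :=
      Submodule.Quotient.mk_eq_zero _
    rw [h₁]
    constructor
    · rintro ⟨g, hg, hdg⟩
      refine ⟨e.symm g, (hG _ _).2 (by simpa using hg), e.injective ?_⟩
      rw [hd, e.apply_symm_apply, hdg]
    · rintro ⟨g, hg, hdg⟩
      exact ⟨e g, (hG _ _).1 hg, by rw [← hd, hdg]⟩

/-- Counting pairs by the sum of their degrees. -/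
lemma card_filter_add_eq {A₁ A₂ : Type*} [Fintype A₁] [Fintype A₂] (d₁ : A₁ → ℕ) (d₂ : A₂ → ℕ)
    (n : ℕ) : (Finset.univ.filter fun a : A₁ × A₂ => d₁ a.1 + d₂ a.2 = n).card =
      ∑ p ∈ Finset.HasAntidiagonal.antidiagonal n, (Finset.univ.filter fun a => d₁ a = p.1).card *
        (Finset.univ.filter fun a => d₂ a = p.2).card := by
  rw [Finset.card_eq_sum_card_fiberwise (f := fun a => (d₁ a.1, d₂ a.2))
    (t := Finset.HasAntidiagonal.antidiagonal n) fun a ha => by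
      simpa using (Finset.mem_filter.1 ha).2]
  refine Finset.sum_congr rfl fun p hp => ?_
  rw [← Finset.card_product]
  congr 1
  ext a
  have := Finset.HasAntidiagonal.mem_antidiagonal.1 hp
  simp only [Finset.mem_filter, Finset.mem_univ, true_and, Finset.mem_product, Prod.ext_iff]
  constructor
  · exact fun h => h.2
  · exact fun h => ⟨by omega, h⟩

section FunTensor

variable {k : Type*} [Field k] {I₁ I₂ : Type} [Fintype I₁] [Fintype I₂] [DecidableEq I₁]
  [DecidableEq I₂] {M₁ M₂ M : Type*} [AddCommGroup M₁] [Module k M₁] [AddCommGroup M₂] [Module k M₂]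
  [AddCommGroup M] [Module k M]

/-- The tensor product of two spaces of functions, as a space of functions of two arguments. -/
noncomputable def funTensorEquiv (I₁ I₂ : Type) [Fintype I₁] [Fintype I₂] [DecidableEq I₁]
    [DecidableEq I₂] (μ : M₁ ⊗[k] M₂ ≃ₗ[k] M) :
    (I₁ → M₁) ⊗[k] (I₂ → M₂) ≃ₗ[k] (I₁ × I₂ → M) :=
  (TensorProduct.piRight k k (I₁ → M₁) fun _ : I₂ => M₂) ≪≫ₗ
    (LinearEquiv.piCongrRight fun _ : I₂ => (TensorProduct.comm k _ _ ≪≫ₗ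
      TensorProduct.piRight k k M₂ (fun _ : I₁ => M₁)) ≪≫ₗ
      LinearEquiv.piCongrRight fun _ : I₁ => (TensorProduct.comm k _ _) ≪≫ₗ μ) ≪≫ₗ
    (LinearEquiv.curry k M I₂ I₁).symm ≪≫ₗ
    LinearEquiv.funCongrLeft k M (Equiv.prodComm I₁ I₂)

lemma funTensorEquiv_tmul (μ : M₁ ⊗[k] M₂ ≃ₗ[k] M) (f : I₁ → M₁) (g : I₂ → M₂)
    (a : I₁ × I₂) : funTensorEquiv I₁ I₂ μ (f ⊗ₜ g) a = μ (f a.1 ⊗ₜ g a.2) := by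
  change μ (TensorProduct.comm k _ _ (TensorProduct.piRight k k M₂ (fun _ : I₁ => M₁)
    (TensorProduct.comm k _ _ (TensorProduct.piRight k k (I₁ → M₁) (fun _ : I₂ => M₂)
      (f ⊗ₜ g) a.2)) a.1)) = _
  simp

end FunTensor

namespace KoszulFrame

variable {V : Type u} {A : Type v} [CommRing A] {x : V → A} (F : KoszulFrame x)
variable (k : Type*) [Field k]

/-- The projection of `K(M)` onto its strand of degree `i`. -/
def proj (M : Type*) [AddCommGroup M] [Module k M] (i : ℕ) : (F.I → M) →ₗ[k] (F.I → M) where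
  toFun f a := if F.deg a = i then f a else 0
  map_add' f g := by ext a; by_cases h : F.deg a = i <;> simp [h]
  map_smul' c f := by ext a; by_cases h : F.deg a = i <;> simp [h]

/-- The sign operator `(-1)^deg` of `K(M)`. -/
def sign (M : Type*) [AddCommGroup M] [Module k M] : (F.I → M) →ₗ[k] (F.I → M) where
  toFun f a := (-1 : k) ^ F.deg a • f a
  map_add' f g := by ext a; simp
  map_smul' c f := by ext a; simp [smul_comm c]

lemma sum_proj {M : Type*} [AddCommGroup M] [Module k M] (f : F.I → M) :
    ∑ i ∈ Finset.range (F.deg F.top + 1), F.proj k M i f = f := by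
  ext a
  rw [Finset.sum_apply, Finset.sum_eq_single (F.deg a)]
  · simp [proj]
  · intro i _ hi
    simp [proj, hi.symm]
  · intro h
    exact absurd (Finset.mem_range.2 (Nat.lt_succ_of_le (F.deg_le a))) h

section TensorEquiv

variable {k} {V₁ V₂ A₁ A₂ : Type*} [Finite V₁] [Finite V₂] [CommRing A₁] [CommRing A₂]
  {x₁ : V₁ → A₁} {x₂ : V₂ → A₂} (F₁ : KoszulFrame x₁) (F₂ : KoszulFrame x₂)
  (φ₁ : A₁ →+* A) (φ₂ : A₂ →+* A) {M₁ M₂ M : Type*} [AddCommGroup M₁] [Module k M₁]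
  [AddCommGroup M₂] [Module k M₂] [AddCommGroup M] [Module k M]

/-- The tensor product of the complexes of two frames, as the complex of the tensor product. -/
noncomputable def tensorEquiv (F₁ : KoszulFrame x₁) (F₂ : KoszulFrame x₂) (φ₁ : A₁ →+* A)
    (φ₂ : A₂ →+* A) (μ : M₁ ⊗[k] M₂ ≃ₗ[k] M) :
    (F₁.I → M₁) ⊗[k] (F₂.I → M₂) ≃ₗ[k] ((F₁.tensor F₂ φ₁ φ₂).I → M) :=
  funTensorEquiv F₁.I F₂.I μ

lemma tensorEquiv_tmul (μ : M₁ ⊗[k] M₂ ≃ₗ[k] M) (f : F₁.I → M₁) (g : F₂.I → M₂)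
    (a : (F₁.tensor F₂ φ₁ φ₂).I) :
    F₁.tensorEquiv F₂ φ₁ φ₂ μ (f ⊗ₜ g) a = μ (f (Prod.fst a) ⊗ₜ g (Prod.snd a)) :=
  funTensorEquiv_tmul μ f g a

end TensorEquiv

variable [Algebra k A] {M : Type*} [AddCommGroup M] [Module A M] [Module k M] [IsScalarTower k A M]

lemma mem_strandk_iff_proj {i : ℕ} {f : F.I → M} : f ∈ F.strandk k M i ↔ F.proj k M i f = f := by
  constructor
  · intro hf
    ext a
    by_cases ha : F.deg a = i
    · simp [proj, ha]
    · simp [proj, ha, hf a ha]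
  · intro h a ha
    rw [← h]
    simp [proj, ha]

/-- The complex `K(M)` has a splitting if its homology is finite-dimensional. -/
lemma nonempty_gradedSplitting
    (hfin : ∀ i, Module.Finite k (gradedHomology (F.diffk k M) (F.strandk k M) i)) :
    Nonempty (GradedSplitting (F.diffk k M) (F.strandk k M)) := by
  have hd0 : ∀ f : F.I → M, F.diff M (F.proj k M 0 f) = 0 := fun f =>
    F.diff_eq_zero_of_mem_strand_zero fun a ha => by simp [proj, ha]
  refine exists_gradedSplitting (F.proj k M) (F.deg F.top + 1) ?_ ?_ ?_ ?_ ?_ ?_ ?_ ?_ hfin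
  · refine LinearMap.ext fun f => ?_
    exact F.diff_diff f
  · intro i
    refine LinearMap.ext fun f => funext fun a => ?_
    by_cases h : F.deg a = i <;> simp [proj, h]
  · intro i j hij
    refine LinearMap.ext fun f => funext fun a => ?_
    by_cases h : F.deg a = i
    · have : F.deg a ≠ j := h ▸ hij
      simp [proj, this]
    · simp [proj, h]
  · refine LinearMap.ext fun f => ?_
    rw [LinearMap.sum_apply]
    exact F.sum_proj k f
  · intro i hi
    refine LinearMap.ext fun f => funext fun a => ?_
    have := F.deg_le a
    simp [proj, show F.deg a ≠ i by omega]
  · intro i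
    refine LinearMap.ext fun f => ?_
    change F.proj k M i (F.diff M f) = F.diff M (F.proj k M (i + 1) f)
    ext a
    simp only [proj, LinearMap.coe_mk, AddHom.coe_mk, matAct_apply]
    rw [ite_eq_iff']
    constructor
    · intro ha
      refine Finset.sum_congr rfl fun b _ => ?_
      by_cases hD : F.D a b = 0
      · simp [hD]
      · simp [F.deg_of_D a b hD, ha]
    · intro ha
      refine (Finset.sum_eq_zero fun b _ => ?_).symm
      by_cases hD : F.D a b = 0
      · simp [hD]
      · simp [F.deg_of_D a b hD, ha]
  · refine LinearMap.ext fun f => ?_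
    exact hd0 f
  · intro i f
    exact F.mem_strandk_iff_proj k

variable {V₁ V₂ A₁ A₂ : Type*} [Finite V₁] [Finite V₂] [CommRing A₁] [CommRing A₂]
  {x₁ : V₁ → A₁} {x₂ : V₂ → A₂} (F₁ : KoszulFrame x₁) (F₂ : KoszulFrame x₂)
  (φ₁ : A₁ →+* A) (φ₂ : A₂ →+* A) [Algebra k A₁] [Algebra k A₂]
  {M₁ M₂ : Type*} [AddCommGroup M₁] [Module A₁ M₁] [Module k M₁] [IsScalarTower k A₁ M₁]
  [AddCommGroup M₂] [Module A₂ M₂] [Module k M₂] [IsScalarTower k A₂ M₂]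

lemma proj_mem (i : ℕ) (f : F.I → M) : F.proj k M i f ∈ F.strandk k M i := fun a ha => by
  simp [proj, ha]

lemma iSup_strandk : ⨆ i, F.strandk k M i = ⊤ := by
  refine eq_top_iff.2 fun f _ => ?_
  rw [← F.sum_proj k f]
  exact Submodule.sum_mem _ fun i _ => Submodule.mem_iSup_of_mem i (F.proj_mem k i f)

variable {k} {φ₁ φ₂}

/-- The isomorphism `tensorEquiv` is compatible with the differentials; `hμ` expresses that `μ` is
semilinear with respect to the two maps of base rings. -/
lemma tensorEquiv_tensorDifferential (μ : M₁ ⊗[k] M₂ ≃ₗ[k] M)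
    (hμ : ∀ a₁ a₂ m₁ m₂, μ ((a₁ • m₁) ⊗ₜ (a₂ • m₂)) = (φ₁ a₁ * φ₂ a₂) • μ (m₁ ⊗ₜ m₂))
    (t : (F₁.I → M₁) ⊗[k] (F₂.I → M₂)) :
    F₁.tensorEquiv F₂ φ₁ φ₂ μ
      (tensorDifferential (F₁.diffk k M₁) (F₁.sign k M₁) (F₂.diffk k M₂) t) =
      (F₁.tensor F₂ φ₁ φ₂).diffk k M (F₁.tensorEquiv F₂ φ₁ φ₂ μ t) := by
  induction t using TensorProduct.induction_on with
  | zero => simp only [map_zero]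
  | add s t hs ht => simp only [map_add, hs, ht]
  | tmul f g =>
    have h₁ : ∀ a m₁ m₂, μ ((a • m₁) ⊗ₜ m₂) = φ₁ a • μ (m₁ ⊗ₜ m₂) := fun a m₁ m₂ => by
      simpa using hμ a 1 m₁ m₂
    have h₂ : ∀ a m₁ m₂, μ (m₁ ⊗ₜ (a • m₂)) = φ₂ a • μ (m₁ ⊗ₜ m₂) := fun a m₁ m₂ => by
      simpa using hμ 1 a m₁ m₂
    refine funext fun a => ?_
    obtain ⟨a₁, a₂⟩ : F₁.I × F₂.I := a
    rw [tensorDifferential, LinearMap.add_apply, TensorProduct.map_tmul, TensorProduct.map_tmul,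
      map_add, Pi.add_apply, tensorEquiv_tmul, tensorEquiv_tmul]
    have hr : (F₁.tensor F₂ φ₁ φ₂).diffk k M (F₁.tensorEquiv F₂ φ₁ φ₂ μ (f ⊗ₜ g)) (a₁, a₂) =
        ∑ b₁, ∑ b₂, (φ₁ (F₁.D a₁ b₁) * (1 : Matrix F₂.I F₂.I A) a₂ b₂ +
          sgn F₁.deg a₁ b₁ * φ₂ (F₂.D a₂ b₂)) • μ (f b₁ ⊗ₜ g b₂) := by
      rw [← Fintype.sum_prod_type' (f := fun b₁ b₂ =>
        (φ₁ (F₁.D a₁ b₁) * (1 : Matrix F₂.I F₂.I A) a₂ b₂ +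
          sgn F₁.deg a₁ b₁ * φ₂ (F₂.D a₂ b₂)) • μ (f b₁ ⊗ₜ g b₂))]
      refine Finset.sum_congr rfl fun b _ => ?_
      rw [tensorEquiv_tmul]
      rfl
    rw [hr]
    have e₁ : F₁.diffk k M₁ f a₁ = ∑ b, F₁.D a₁ b • f b := rfl
    have e₂ : F₂.diffk k M₂ g a₂ = ∑ b, F₂.D a₂ b • g b := rfl
    have e₃ : F₁.sign k M₁ f a₁ = (-1 : k) ^ F₁.deg a₁ • f a₁ := rfl
    rw [e₁, e₂, e₃, TensorProduct.sum_tmul, TensorProduct.tmul_sum, map_sum, map_sum]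
    simp only [add_smul, Finset.sum_add_distrib, Matrix.one_apply, sgn, Matrix.diagonal_apply,
      mul_ite, mul_one, mul_zero, ite_smul, zero_smul, ite_mul, zero_mul, Finset.sum_ite_eq,
      Finset.mem_univ, if_true, h₁]
    congr 1
    rw [Finset.sum_comm]
    refine Finset.sum_congr rfl fun b _ => ?_
    rw [Finset.sum_ite_eq, if_pos (Finset.mem_univ _), h₂, mul_smul,
      ← TensorProduct.smul_tmul', map_smul, smul_comm]
    rcases Nat.even_or_odd (F₁.deg a₁) with h | h <;> simp [h.neg_one_pow]

lemma mem_tensorGrading_iff (μ : M₁ ⊗[k] M₂ ≃ₗ[k] M) (n : ℕ)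
    (t : (F₁.I → M₁) ⊗[k] (F₂.I → M₂)) :
    t ∈ tensorGrading (F₁.strandk k M₁) (F₂.strandk k M₂) n ↔
      F₁.tensorEquiv F₂ φ₁ φ₂ μ t ∈ (F₁.tensor F₂ φ₁ φ₂).strandk k M n := by
  constructor
  · intro ht
    induction ht using Submodule.span_induction with
    | zero => rw [map_zero]; exact Submodule.zero_mem _
    | add x y _ _ hx hy => rw [map_add]; exact Submodule.add_mem _ hx hy
    | smul c x _ hx => rw [map_smul]; exact Submodule.smul_mem _ _ hx
    | mem t ht =>
      obtain ⟨i, j, hij, f, hf, g, hg, rfl⟩ := ht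
      intro a ha
      rw [tensorEquiv_tmul]
      obtain ⟨a₁, a₂⟩ : F₁.I × F₂.I := a
      change F₁.deg a₁ + F₂.deg a₂ ≠ n at ha
      by_cases h : F₁.deg a₁ = i
      · rw [hg a₂ (by omega), TensorProduct.tmul_zero, map_zero]
      · rw [hf a₁ h, TensorProduct.zero_tmul, map_zero]
  · intro ht
    set f : (F₁.tensor F₂ φ₁ φ₂).I → M := F₁.tensorEquiv F₂ φ₁ φ₂ μ t with hf
    have hsingle : ∀ (a : (F₁.tensor F₂ φ₁ φ₂).I) (w : M₁ ⊗[k] M₂),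
        (F₁.tensor F₂ φ₁ φ₂).deg a = n → ∃ s ∈ tensorGrading (F₁.strandk k M₁) (F₂.strandk k M₂) n,
          F₁.tensorEquiv F₂ φ₁ φ₂ μ s = Pi.single a (μ w) := by
      rintro ⟨a₁, a₂⟩ w ha
      induction w using TensorProduct.induction_on with
      | zero => exact ⟨0, Submodule.zero_mem _, by simp⟩
      | add w w' hw hw' =>
        obtain ⟨s, hs, hs'⟩ := hw
        obtain ⟨s₁, hs₁, hs₁'⟩ := hw'
        exact ⟨s + s₁, Submodule.add_mem _ hs hs₁, by
          rw [map_add, map_add, Pi.single_add, hs', hs₁']⟩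
      | tmul m₁ m₂ =>
        refine ⟨Pi.single a₁ m₁ ⊗ₜ Pi.single a₂ m₂, Submodule.subset_span
          ⟨_, _, ha, _, fun b hb => ?_, _, fun b hb => ?_, rfl⟩, ?_⟩
        · exact Pi.single_eq_of_ne (fun h => hb (by rw [h])) _
        · exact Pi.single_eq_of_ne (fun h => hb (by rw [h])) _
        · refine funext fun b => ?_
          obtain ⟨b₁, b₂⟩ : F₁.I × F₂.I := b
          rw [tensorEquiv_tmul]
          by_cases h₁ : b₁ = a₁
          · by_cases h₂ : b₂ = a₂
            · subst h₁ h₂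
              simp
            · rw [Pi.single_eq_of_ne h₂, Pi.single_eq_of_ne fun h => h₂ (congrArg Prod.snd h),
                TensorProduct.tmul_zero, map_zero]
          · rw [Pi.single_eq_of_ne h₁, Pi.single_eq_of_ne fun h => h₁ (congrArg Prod.fst h),
              TensorProduct.zero_tmul, map_zero]
    have h : ∀ a, ∃ s ∈ tensorGrading (F₁.strandk k M₁) (F₂.strandk k M₂) n,
        F₁.tensorEquiv F₂ φ₁ φ₂ μ s = Pi.single a (f a) := fun a => by
      by_cases ha : (F₁.tensor F₂ φ₁ φ₂).deg a = n
      · simpa using hsingle a (μ.symm (f a)) ha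
      · exact ⟨0, Submodule.zero_mem _, by rw [ht a ha]; simp⟩
    choose s hs hs' using h
    have : t = ∑ a, s a := (F₁.tensorEquiv F₂ φ₁ φ₂ μ).injective (by
      rw [map_sum, ← hf]
      simp only [hs']
      exact (Finset.univ_sum_single f).symm)
    rw [this]
    exact Submodule.sum_mem _ fun a _ => hs a

/-- The Künneth formula: over a field, the homology of the complex of a tensor product of frames,
with coefficients in a tensor product of modules, has the expected dimensions. -/
theorem betti_tensor (μ : M₁ ⊗[k] M₂ ≃ₗ[k] M)
    (hμ : ∀ a₁ a₂ m₁ m₂, μ ((a₁ • m₁) ⊗ₜ (a₂ • m₂)) = (φ₁ a₁ * φ₂ a₂) • μ (m₁ ⊗ₜ m₂))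
    (h₁ : ∀ i, Module.Finite k (gradedHomology (F₁.diffk k M₁) (F₁.strandk k M₁) i))
    (h₂ : ∀ i, Module.Finite k (gradedHomology (F₂.diffk k M₂) (F₂.strandk k M₂) i)) (n : ℕ) :
    (F₁.tensor F₂ φ₁ φ₂).betti k M n =
      ∑ p ∈ Finset.HasAntidiagonal.antidiagonal n, F₁.betti k M₁ p.1 * F₂.betti k M₂ p.2 := by
  obtain ⟨s₁⟩ := F₁.nonempty_gradedSplitting k h₁
  obtain ⟨s₂⟩ := F₂.nonempty_gradedSplitting k h₂
  let s := s₁.tensor s₂ (ε := F₁.sign k M₁)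
    (fun i t ht => funext fun a => by
      by_cases ha : F₁.deg a = i
      · simp [sign, ha]
      · simp [sign, ht a ha])
    (fun t ht => F₁.diff_eq_zero_of_mem_strand_zero ht) (fun i t ht => F₁.diff_mem ht)
    (F₁.iSup_strandk k)
  have e := finrank_gradedHomology_congr (F₁.tensorEquiv F₂ φ₁ φ₂ μ)
    (F₁.tensorEquiv_tensorDifferential F₂ μ hμ) (F₁.mem_tensorGrading_iff F₂ μ) n
  rw [betti, ← e, s.finrank_gradedHomology]
  simp only [betti, s₁.finrank_gradedHomology, s₂.finrank_gradedHomology]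
  exact card_filter_add_eq s₁.deg s₂.deg n

end KoszulFrame

end Kunneth

/-! ### Koszul homology as a Tor module -/

namespace KoszulFrame

section ChainComplex

variable {V : Type u} {A : Type v} [CommRing A] {x : V → A} (F : KoszulFrame x)
variable {M : Type v} [AddCommGroup M] [Module A M]

/-- Extension by zero of a function defined on the indices of degree `i`. -/
def extend (M : Type*) [AddCommGroup M] [Module A M] (i : ℕ) :
    ({a // F.deg a = i} → M) →ₗ[A] (F.I → M) where
  toFun f a := if h : F.deg a = i then f ⟨a, h⟩ else 0
  map_add' f g := by ext a; by_cases h : F.deg a = i <;> simp [h]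
  map_smul' c f := by ext a; by_cases h : F.deg a = i <;> simp [h]

lemma extend_coe (i : ℕ) (f : {a // F.deg a = i} → M) (a : {a // F.deg a = i}) :
    F.extend M i f a = f a :=
  dif_pos a.2

lemma extend_mem (i : ℕ) (f : {a // F.deg a = i} → M) : F.extend M i f ∈ F.strand M i :=
  fun _ ha => dif_neg ha

lemma extend_injective (i : ℕ) : Function.Injective (F.extend M i) := fun f g h => by
  ext a
  rw [← F.extend_coe i f a, h, F.extend_coe]

lemma extend_restrict {i : ℕ} {f : F.I → M} (hf : f ∈ F.strand M i) :
    F.extend M i (fun a => f a) = f := by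
  ext a
  by_cases h : F.deg a = i
  · exact dif_pos h
  · rw [hf a h]
    exact dif_neg h

/-- The differential of `K(M)` in degree `i + 1`, in terms of functions on the indices of a fixed
degree. -/
def strandDiff (M : Type*) [AddCommGroup M] [Module A M] (i : ℕ) :
    ({a // F.deg a = i + 1} → M) →ₗ[A] ({a // F.deg a = i} → M) :=
  LinearMap.funLeft A M Subtype.val ∘ₗ F.diff M ∘ₗ F.extend M (i + 1)

lemma extend_strandDiff (i : ℕ) (f : {a // F.deg a = i + 1} → M) :
    F.extend M i (F.strandDiff M i f) = F.diff M (F.extend M (i + 1) f) :=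
  F.extend_restrict (F.diff_mem (F.extend_mem _ f))

lemma strandDiff_strandDiff (i : ℕ) (f : {a // F.deg a = i + 2} → M) :
    F.strandDiff M i (F.strandDiff M (i + 1) f) = 0 := by
  apply F.extend_injective
  rw [extend_strandDiff, extend_strandDiff, diff_diff, map_zero]

lemma strandDiff_comp {N : Type*} [AddCommGroup N] [Module A N] (φ : M →ₗ[A] N) (i : ℕ)
    (f : {a // F.deg a = i + 1} → M) :
    F.strandDiff N i (φ ∘ f) = φ ∘ F.strandDiff M i f := by
  have h : F.extend N (i + 1) (φ ∘ f) = φ ∘ F.extend M (i + 1) f := by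
    ext a
    by_cases h : F.deg a = i + 1 <;> simp [extend, h]
  ext a
  change F.diff N (F.extend N (i + 1) (φ ∘ f)) a = φ (F.diff M (F.extend M (i + 1) f) a)
  rw [h, diff, matAct_comp]
  rfl

/-- The complex `K(M)` as a chain complex of modules. -/
noncomputable def chainComplex (M : Type v) [AddCommGroup M] [Module A M] :
    ChainComplex (ModuleCat.{v} A) ℕ :=
  ChainComplex.of (fun i => ModuleCat.of A ({a // F.deg a = i} → M))
    (fun i => ModuleCat.ofHom (F.strandDiff M i)) fun i => by
      refine ModuleCat.hom_ext ?_
      exact LinearMap.ext (F.strandDiff_strandDiff i)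

lemma chainComplex_d (i : ℕ) :
    (F.chainComplex M).d (i + 1) i = ModuleCat.ofHom (F.strandDiff M i) :=
  ChainComplex.of_d (fun i => ModuleCat.of A ({a // F.deg a = i} → M))
    (fun i => ModuleCat.ofHom (F.strandDiff M i)) i

lemma d_apply_eq_zero_iff (i : ℕ) (f : {a // F.deg a = i} → M) :
    (F.chainComplex M).d i ((ComplexShape.down ℕ).next i) f = 0 ↔
      F.diff M (F.extend M i f) = 0 := by
  rcases i with _ | i
  · rw [ChainComplex.next_nat_zero, (F.chainComplex M).shape 0 0 (by simp),
      F.diff_eq_zero_of_mem_strand_zero (F.extend_mem 0 f)]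
    exact iff_of_true rfl rfl
  · rw [ChainComplex.next_nat_succ, chainComplex_d, ← F.extend_strandDiff,
      ← (F.extend M i).map_zero, (F.extend_injective i).eq_iff]
    rfl

/-- The homology of the chain complex `K(M)` has the dimensions `F.betti k M`. -/
theorem finrank_homology (k : Type w) [Field k] [Algebra k A] [Module k M] [IsScalarTower k A M]
    (i : ℕ) (H : ModuleCat.{v} A) (e : (F.chainComplex M).homology i ≅ H) :
    Module.finrank k ((ModuleCat.restrictScalars (algebraMap k A)).obj H) = F.betti k M i := by
  let S := (F.chainComplex M).sc' (i + 1) i ((ComplexShape.down ℕ).next i)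
  let e' : ModuleCat.of A (LinearMap.ker S.g.hom ⧸ LinearMap.range S.moduleCatToCycles) ≅ H :=
    S.moduleCatHomologyIso.symm ≪≫ ((F.chainComplex M).homologyIsoSc' (i + 1) i
      ((ComplexShape.down ℕ).next i) (by simp) rfl).symm ≪≫ e
  let ρ : LinearMap.ker S.g.hom →ₗ[A] H :=
    e'.toLinearEquiv.toLinearMap ∘ₗ (LinearMap.range S.moduleCatToCycles).mkQ
  have hρ : Function.Surjective ρ :=
    e'.toLinearEquiv.surjective.comp (Submodule.mkQ_surjective _)
  have hρ0 : ∀ z, ρ z = 0 ↔ ∃ w : {a // F.deg a = i + 1} → M, F.strandDiff M i w = z.1 := by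
    intro z
    change e'.toLinearEquiv ((LinearMap.range S.moduleCatToCycles).mkQ z) = 0 ↔ _
    rw [e'.toLinearEquiv.map_eq_zero_iff, Submodule.mkQ_apply, Submodule.Quotient.mk_eq_zero,
      LinearMap.mem_range]
    have hf : ∀ w : {a // F.deg a = i + 1} → M, (S.moduleCatToCycles w).1 = F.strandDiff M i w := by
      intro w
      change (F.chainComplex M).d (i + 1) i w = _
      rw [chainComplex_d]
      rfl
    exact exists_congr fun w => Subtype.ext_iff.trans (Eq.congr_left (hf w))
  let φ : gradedCycles (F.diffk k M) (F.strandk k M) i →ₗ[k]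
      (ModuleCat.restrictScalars (algebraMap k A)).obj H :=
    { toFun := fun f => ρ ⟨fun a => f.1 a.1, (F.d_apply_eq_zero_iff i _).2 (by
        rw [F.extend_restrict f.2.2]
        exact f.2.1)⟩
      map_add' := fun f g => ρ.map_add ⟨_, _⟩ ⟨_, _⟩
      map_smul' := fun c f => by
        change _ = algebraMap k A c • ρ _
        rw [← ρ.map_smul]
        congr 2
        funext a
        exact (algebraMap_smul A c (f.1 a.1)).symm }
  refine (gradedHomologyEquiv φ ?_ ?_).finrank_eq.symm
  · intro y
    obtain ⟨⟨z, hz⟩, rfl⟩ := hρ y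
    refine ⟨⟨F.extend M i z, (F.d_apply_eq_zero_iff i z).1 hz, F.extend_mem i z⟩, ?_⟩
    refine congrArg ρ (Subtype.ext (funext fun a => F.extend_coe i z a))
  · intro f
    refine (hρ0 _).trans ?_
    rw [mem_gradedBoundaries]
    constructor
    · rintro ⟨w, hw⟩
      refine ⟨_, F.extend_mem _ w, ?_⟩
      rw [← extend_strandDiff, hw, F.extend_restrict f.2.2]
    · rintro ⟨g, hg, hdg⟩
      refine ⟨fun a => g a, F.extend_injective i ?_⟩
      rw [extend_strandDiff, F.extend_restrict hg, hdg, F.extend_restrict f.2.2]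

/-- The augmentation `A → A / (x)` of the complex `K(A)`. -/
noncomputable def augmentation :
    ({a // F.deg a = 0} → A) →ₗ[A] (A ⧸ Ideal.span (Set.range x)) :=
  (Ideal.span (Set.range x)).mkQ ∘ₗ LinearMap.proj ⟨F.bot, F.deg_bot⟩

lemma extend_eq_single_bot (f : {a // F.deg a = 0} → M) :
    F.extend M 0 f = Pi.single F.bot (f ⟨F.bot, F.deg_bot⟩) := by
  ext a
  by_cases h : a = F.bot
  · subst h
    rw [Pi.single_eq_same]
    exact dif_pos F.deg_bot
  · rw [Pi.single_eq_of_ne h]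
    exact dif_neg fun h' => h (F.eq_bot a h')

lemma augmentation_eq_zero_iff (f : {a // F.deg a = 0} → A) :
    F.augmentation f = 0 ↔ ∃ g, F.strandDiff A 0 g = f := by
  have h₁ : F.augmentation f = 0 ↔ f ⟨F.bot, F.deg_bot⟩ ∈ Ideal.span (Set.range x) :=
    Submodule.Quotient.mk_eq_zero _
  have h₂ := F.exists_diff_eq_single_bot_iff (M := A) (f ⟨F.bot, F.deg_bot⟩)
  rw [smul_eq_mul, Ideal.mul_top] at h₂
  rw [h₁, ← h₂]
  constructor
  · rintro ⟨g, hg, hdg⟩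
    refine ⟨fun a => g a, F.extend_injective 0 ?_⟩
    rw [extend_strandDiff, F.extend_restrict hg, hdg, extend_eq_single_bot]
  · rintro ⟨g, rfl⟩
    exact ⟨_, F.extend_mem _ g, by rw [← extend_strandDiff, extend_eq_single_bot]⟩

/-- The augmentation of `K(A)` as a map of complexes. -/
noncomputable def resolutionπ : F.chainComplex A ⟶
    (ChainComplex.single₀ (ModuleCat.{v} A)).obj
      (ModuleCat.of A (A ⧸ Ideal.span (Set.range x))) :=
  ((F.chainComplex A).toSingle₀Equiv _).symm ⟨ModuleCat.ofHom F.augmentation, by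
    rw [chainComplex_d]
    refine ModuleCat.hom_ext (LinearMap.ext fun g => ?_)
    exact (F.augmentation_eq_zero_iff _).2 ⟨g, rfl⟩⟩

lemma quasiIso_resolutionπ (hF : ∀ j, F.Vanish A (j + 1)) : QuasiIso F.resolutionπ where
  quasiIsoAt i := by
    rcases i with _ | i
    · rw [ChainComplex.quasiIsoAt₀_iff, ShortComplex.quasiIso_iff_of_zeros' _ rfl rfl rfl]
      constructor
      · rw [ShortComplex.moduleCat_exact_iff]
        intro f hf
        obtain ⟨g, hg⟩ := (F.augmentation_eq_zero_iff f).1 hf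
        refine ⟨g, ?_⟩
        change (F.chainComplex A).d 1 0 g = f
        rw [chainComplex_d]
        exact hg
      · rw [ModuleCat.epi_iff_surjective]
        intro y
        obtain ⟨r, rfl⟩ := Submodule.mkQ_surjective _ y
        exact ⟨fun _ => r, rfl⟩
    · rw [quasiIsoAt_iff_exactAt' (hL := ChainComplex.exactAt_succ_single_obj ..),
        HomologicalComplex.exactAt_iff' _ (i + 2) (i + 1) i (by simp) (by simp),
        ShortComplex.moduleCat_exact_iff]
      intro f hf
      have h := (F.d_apply_eq_zero_iff (i + 1) f).1 (by rw [ChainComplex.next_nat_succ]; exact hf)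
      obtain ⟨g, hg, hdg⟩ := hF i _ (F.extend_mem (i + 1) f) h
      refine ⟨fun a => g a, ?_⟩
      change (F.chainComplex A).d (i + 1 + 1) (i + 1) (fun a => g a) = f
      rw [chainComplex_d]
      apply F.extend_injective (i + 1)
      refine (F.extend_strandDiff _ _).trans ?_
      rw [F.extend_restrict hg, hdg]

/-- If `K(A)` is acyclic in positive degrees, it is a free resolution of `A / (x)`. -/
noncomputable def resolution (hF : ∀ j, F.Vanish A (j + 1)) :
    ProjectiveResolution (ModuleCat.of A (A ⧸ Ideal.span (Set.range x))) where
  complex := F.chainComplex A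
  projective i := (IsProjective.iff_projective ({a // F.deg a = i} → A)).1 inferInstance
  π := F.resolutionπ
  quasiIso := F.quasiIso_resolutionπ hF

/-- Tensoring `K(A)` with a module `M` gives `K(M)`. -/
noncomputable def tensorChainComplexIso (M : Type v) [AddCommGroup M] [Module A M] :
    (((MonoidalCategory.tensoringLeft (ModuleCat.{v} A)).obj
      (ModuleCat.of A M)).mapHomologicalComplex (ComplexShape.down ℕ)).obj (F.chainComplex A) ≅
      F.chainComplex M :=
  HomologicalComplex.Hom.isoOfComponents
    (fun i => (TensorProduct.piScalarRight A A M {a // F.deg a = i}).toModuleIso)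
    (by
      rintro _ i rfl
      rw [chainComplex_d]
      refine ModuleCat.MonoidalCategory.tensor_ext fun m f => ?_
      change F.strandDiff M i (TensorProduct.piScalarRight A A M {a // F.deg a = i + 1}
        (m ⊗ₜ f)) = TensorProduct.piScalarRight A A M {a // F.deg a = i}
          (m ⊗ₜ (F.chainComplex A).d (i + 1) i f)
      rw [chainComplex_d]
      exact (F.strandDiff_comp (LinearMap.toSpanSingleton A M m) i f).trans rfl)

/-- If `K(A)` is acyclic in positive degrees, the homology of `K(M)` is the torsion product of `M`
with `A / (x)`. -/
theorem finrank_tor (hF : ∀ j, F.Vanish A (j + 1)) (k : Type w) [Field k] [Algebra k A] [Module k M]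
    [IsScalarTower k A M] (i : ℕ) :
    Module.finrank k ((ModuleCat.restrictScalars (algebraMap k A)).obj
      (((Tor (ModuleCat.{v} A) i).obj (ModuleCat.of A M)).obj
        (ModuleCat.of A (A ⧸ Ideal.span (Set.range x))))) = F.betti k M i :=
  F.finrank_homology k i _ (((F.resolution hF).isoLeftDerivedObj
    ((MonoidalCategory.tensoringLeft (ModuleCat.{v} A)).obj (ModuleCat.of A M)) i ≪≫
      (HomologicalComplex.homologyFunctor _ _ i).mapIso (F.tensorChainComplexIso M)).symm)

end ChainComplex
end KoszulFrame

namespace AbstractSimplicialComplex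

/-- The total Betti numbers of a Stanley–Reisner ring are the dimensions of its Koszul homology. -/
theorem bettiNumber_eq (k : Type w) [Field k] {V : Type u} [Finite V]
    (Δ : AbstractSimplicialComplex V)
    (F : KoszulFrame (MvPolynomial.X : V → MvPolynomial V k)) (i : ℕ) :
    bettiNumber k Δ i = F.betti k (stanleyReisnerRing k Δ) i :=
  F.finrank_tor F.vanish_mvPolynomial k i

/-! ### Faces of maximal size -/

section Faces

lemma mem_of_subset {V : Type u} (Δ : AbstractSimplicialComplex V) {s t : Finset V} (hs : s ∈ Δ)
    (hts : t ⊆ s) (ht : t.Nonempty) : t ∈ Δ :=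
  (Δ.isRelLowerSet_faces hs).2 hts ht

lemma mem_join {V : Type u} {W : Type v} (Δ : AbstractSimplicialComplex V)
    (Γ : AbstractSimplicialComplex W) {s : Finset (V ⊕ W)} : s ∈ Δ.join Γ ↔
    s.Nonempty ∧ (s.toLeft.Nonempty → s.toLeft ∈ Δ) ∧ (s.toRight.Nonempty → s.toRight ∈ Γ) :=
  Iff.rfl

variable {V : Type u} [Fintype V] (Δ : AbstractSimplicialComplex V)

open Classical in
/-- The largest number of vertices of a face (`0` if there are no vertices). -/
noncomputable def maxFaceCard : ℕ :=
  (Finset.univ.filter fun s : Finset V => s ∈ Δ).sup Finset.card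

lemma codim_eq : Δ.codim = Fintype.card V - Δ.maxFaceCard := rfl

lemma card_le_maxFaceCard {s : Finset V} (hs : s.Nonempty → s ∈ Δ) : s.card ≤ Δ.maxFaceCard := by
  classical
  rcases s.eq_empty_or_nonempty with rfl | h
  · simp
  · exact Finset.le_sup (f := Finset.card) (Finset.mem_filter.2 ⟨Finset.mem_univ _, hs h⟩)

lemma exists_card_eq_maxFaceCard :
    ∃ s : Finset V, (s.Nonempty → s ∈ Δ) ∧ s.card = Δ.maxFaceCard := by
  classical
  rcases (Finset.univ.filter fun s : Finset V => s ∈ Δ).eq_empty_or_nonempty with h | h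
  · refine ⟨∅, by simp, ?_⟩
    unfold maxFaceCard
    convert Finset.card_empty.trans (Finset.sup_empty (f := Finset.card)).symm
  · obtain ⟨s, hs, hs'⟩ := Finset.exists_mem_eq_sup _ h Finset.card
    refine ⟨s, fun _ => (Finset.mem_filter.1 hs).2, ?_⟩
    unfold maxFaceCard
    convert hs'.symm

lemma maxFaceCard_le : Δ.maxFaceCard ≤ Fintype.card V := by
  obtain ⟨s, -, hs⟩ := Δ.exists_card_eq_maxFaceCard
  rw [← hs]
  exact s.card_le_univ

lemma codim_eq_zero_iff : Δ.codim = 0 ↔ Δ.IsSimplex := by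
  rw [codim_eq, Nat.sub_eq_zero_iff_le]
  constructor
  · intro h s hs
    obtain ⟨t, ht, htc⟩ := Δ.exists_card_eq_maxFaceCard
    have htu : t = Finset.univ := Finset.eq_univ_of_card t (t.card_le_univ.antisymm (htc ▸ h))
    refine Δ.mem_of_subset (ht ?_) (htu ▸ s.subset_univ) hs
    exact hs.mono (htu ▸ s.subset_univ)
  · intro h
    exact Δ.card_le_maxFaceCard (h Finset.univ)

variable {W : Type v} [Fintype W] (Γ : AbstractSimplicialComplex W)

lemma maxFaceCard_join : (Δ.join Γ).maxFaceCard = Δ.maxFaceCard + Γ.maxFaceCard := by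
  apply le_antisymm
  · obtain ⟨s, hs, hsc⟩ := (Δ.join Γ).exists_card_eq_maxFaceCard
    rw [← hsc, ← Finset.card_toLeft_add_card_toRight]
    rcases s.eq_empty_or_nonempty with rfl | hne
    · simp [show Finset.toLeft (∅ : Finset (V ⊕ W)) = ∅ by ext; simp,
        show Finset.toRight (∅ : Finset (V ⊕ W)) = ∅ by ext; simp]
    · obtain ⟨-, h₁, h₂⟩ := (Δ.mem_join Γ).1 (hs hne)
      exact add_le_add (Δ.card_le_maxFaceCard h₁) (Γ.card_le_maxFaceCard h₂)
  · obtain ⟨s, hs, hsc⟩ := Δ.exists_card_eq_maxFaceCard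
    obtain ⟨t, ht, htc⟩ := Γ.exists_card_eq_maxFaceCard
    rw [← hsc, ← htc, ← Finset.card_disjSum]
    exact (Δ.join Γ).card_le_maxFaceCard fun h => (Δ.mem_join Γ).2 ⟨h, by simpa, by simpa⟩

lemma codim_join : (Δ.join Γ).codim = Δ.codim + Γ.codim := by
  rw [codim_eq, codim_eq, codim_eq, maxFaceCard_join, Fintype.card_sum]
  have := Δ.maxFaceCard_le
  have := Γ.maxFaceCard_le
  omega

end Faces

/-! ### The Krull dimension of a Stanley–Reisner ring -/

section Dimension

variable (k : Type w) [Field k] {V : Type u} (Δ : AbstractSimplicialComplex V)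

lemma prod_X_mem {s : Finset V} (hs : s.Nonempty) (hsΔ : s ∉ Δ) :
    ∏ v ∈ s, (MvPolynomial.X v : MvPolynomial V k) ∈ stanleyReisnerIdeal k Δ :=
  Ideal.subset_span ⟨s, hs, hsΔ, rfl⟩

/-- A ring homomorphism out of the polynomial ring factors through `k[Δ]` if it kills the monomials
of the nonfaces. -/
lemma stanleyReisnerIdeal_le_ker {B : Type*} [CommRing B] {f : MvPolynomial V k →+* B}
    (hf : ∀ s : Finset V, s.Nonempty → s ∉ Δ → ∏ v ∈ s, f (MvPolynomial.X v) = 0) :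
    stanleyReisnerIdeal k Δ ≤ RingHom.ker f := by
  refine Ideal.span_le.2 ?_
  rintro _ ⟨s, hs, hsΔ, rfl⟩
  change f _ = 0
  rw [map_prod]
  exact hf s hs hsΔ

open Classical in
/-- The restriction of `k[Δ]` to a face: the variables outside of the face are sent to zero. -/
noncomputable def restrictFace {G : Finset V} (hG : G.Nonempty → G ∈ Δ) :
    stanleyReisnerRing k Δ →+* MvPolynomial G k :=
  Ideal.Quotient.lift _ (MvPolynomial.aeval (fun v => if h : v ∈ G then MvPolynomial.X ⟨v, h⟩
    else 0) : MvPolynomial V k →ₐ[k] MvPolynomial G k).toRingHom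
    (stanleyReisnerIdeal_le_ker k Δ fun s hs hsΔ => by
      obtain ⟨v, hv, hvG⟩ : ∃ v ∈ s, v ∉ G := by
        by_contra! h
        exact hsΔ (Δ.mem_of_subset (hG (hs.mono h)) h hs)
      refine Finset.prod_eq_zero hv ?_
      simp [hvG])

lemma restrictFace_X_of_mem {G : Finset V} (hG : G.Nonempty → G ∈ Δ) {v : V}
    (hv : v ∈ G) : restrictFace k Δ hG (Ideal.Quotient.mk _ (MvPolynomial.X v)) =
      MvPolynomial.X ⟨v, hv⟩ := by
  simp [restrictFace, hv]

lemma restrictFace_X_of_notMem {G : Finset V} (hG : G.Nonempty → G ∈ Δ) {v : V}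
    (hv : v ∉ G) : restrictFace k Δ hG (Ideal.Quotient.mk _ (MvPolynomial.X v)) = 0 := by
  simp [restrictFace, hv]

lemma restrictFace_algebraMap {G : Finset V} (hG : G.Nonempty → G ∈ Δ) (c : k) :
    restrictFace k Δ hG (algebraMap k _ c) = MvPolynomial.C c := by
  change restrictFace k Δ hG (Ideal.Quotient.mk _ (MvPolynomial.C c)) = _
  simp [restrictFace]

lemma restrictFace_surjective {G : Finset V} (hG : G.Nonempty → G ∈ Δ) :
    Function.Surjective (restrictFace k Δ hG) := by
  intro f
  induction f using MvPolynomial.induction_on with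
  | C c => exact ⟨_, restrictFace_algebraMap k Δ hG c⟩
  | add f g hf hg =>
    obtain ⟨a, rfl⟩ := hf
    obtain ⟨b, rfl⟩ := hg
    exact ⟨a + b, map_add _ _ _⟩
  | mul_X f v hf =>
    obtain ⟨a, rfl⟩ := hf
    exact ⟨a * Ideal.Quotient.mk _ (MvPolynomial.X v.1), by
      rw [map_mul, restrictFace_X_of_mem k Δ hG v.2]⟩

/-- The Krull dimension of a ring is determined by the quotients by its prime ideals. -/
lemma ringKrullDim_le_of_forall_isPrime {R : Type*} [CommRing R] {n : WithBot ℕ∞}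
    (h : ∀ p : Ideal R, p.IsPrime → ringKrullDim (R ⧸ p) ≤ n) : ringKrullDim R ≤ n := by
  refine iSup_le fun l => (?_ : _ ≤ ringKrullDim (R ⧸ l.head.asIdeal)).trans (h _ l.head.2)
  rw [ringKrullDim_quotient]
  let l' : LTSeries (PrimeSpectrum.zeroLocus (R := R) l.head.asIdeal) :=
    { length := l.length
      toFun := fun i => ⟨l i, l.head_le i⟩
      step := fun i => l.step i }
  exact Order.LTSeries.length_le_krullDim l'

/-- The dimension of `k[Δ]` is the largest number of vertices of a face: modulo a prime, `k[Δ]` is a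
quotient of a polynomial ring on the vertices of a face, and conversely every such polynomial ring
is a quotient of `k[Δ]`. -/
theorem ringKrullDim_stanleyReisnerRing [Fintype V] :
    ringKrullDim (stanleyReisnerRing k Δ) = Δ.maxFaceCard := by
  have hpoly : ∀ G : Finset V, ringKrullDim (MvPolynomial G k) = G.card := fun G => by
    rw [MvPolynomial.ringKrullDim_of_isNoetherianRing, ringKrullDim_eq_zero_of_field]
    simp
  apply le_antisymm
  · refine ringKrullDim_le_of_forall_isPrime fun p hp => ?_
    classical
    let y : V → stanleyReisnerRing k Δ := fun v => Ideal.Quotient.mk _ (MvPolynomial.X v)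
    let G : Finset V := Finset.univ.filter fun v => y v ∉ p
    -- The variables outside of `p` form a face, since the product over a nonface vanishes.
    have hG : G.Nonempty → G ∈ Δ := by
      intro hne
      by_contra hG
      have h₀ : ∏ v ∈ G, y v = 0 := by
        rw [← map_prod, Ideal.Quotient.eq_zero_iff_mem]
        exact prod_X_mem k Δ hne hG
      obtain ⟨v, hv, hvp⟩ := (Ideal.IsPrime.prod_mem_iff (s := G) (x := y)).1 (h₀ ▸ p.zero_mem)
      exact (Finset.mem_filter.1 hv).2 hvp
    let g : MvPolynomial G k →+* (stanleyReisnerRing k Δ ⧸ p) :=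
      ((Ideal.Quotient.mk p).comp (Ideal.Quotient.mk _)).comp
        (MvPolynomial.rename (Subtype.val : G → V)).toRingHom
    have hg : Function.Surjective g := by
      intro z
      obtain ⟨f, rfl⟩ := ((Ideal.Quotient.mk_surjective (I := p)).comp
        (Ideal.Quotient.mk_surjective (I := stanleyReisnerIdeal k Δ))) z
      induction f using MvPolynomial.induction_on with
      | C c => exact ⟨MvPolynomial.C c, by simp [g]⟩
      | add f f' hf hf' =>
        obtain ⟨a, ha⟩ := hf
        obtain ⟨b, hb⟩ := hf'
        exact ⟨a + b, by rw [map_add, ha, hb]; simp⟩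
      | mul_X f v hf =>
        obtain ⟨a, ha⟩ := hf
        by_cases hv : y v ∈ p
        · refine ⟨0, ?_⟩
          rw [map_zero]
          refine (Ideal.Quotient.eq_zero_iff_mem.2 ?_).symm
          rw [map_mul]
          exact p.mul_mem_left _ hv
        · refine ⟨a * MvPolynomial.X ⟨v, Finset.mem_filter.2 ⟨Finset.mem_univ _, hv⟩⟩, ?_⟩
          rw [map_mul, ha]
          simp [g]
    refine (ringKrullDim_le_of_surjective g hg).trans ?_
    rw [hpoly]
    exact_mod_cast Δ.card_le_maxFaceCard hG
  · obtain ⟨G, hG, hGc⟩ := Δ.exists_card_eq_maxFaceCard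
    rw [← hGc, ← hpoly]
    exact ringKrullDim_le_of_surjective _ (restrictFace_surjective k Δ hG)

end Dimension

/-! ### The Stanley–Reisner ring of a join -/

section Join

open scoped TensorProduct

variable (k : Type w) [Field k] {V₁ : Type u} {V₂ : Type v} (Δ₁ : AbstractSimplicialComplex V₁)
  (Δ₂ : AbstractSimplicialComplex V₂)

lemma prod_mk_X_eq_zero {V : Type*} (Δ : AbstractSimplicialComplex V) {s : Finset V}
    (hs : s.Nonempty) (hsΔ : s ∉ Δ) :
    ∏ v ∈ s, Ideal.Quotient.mk (stanleyReisnerIdeal k Δ) (MvPolynomial.X v) = 0 := by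
  rw [← map_prod, Ideal.Quotient.eq_zero_iff_mem]
  exact prod_X_mem k Δ hs hsΔ

/-- The inclusion `k[Δ₁] → k[Δ₁ * Δ₂]`. -/
noncomputable def joinInl : stanleyReisnerRing k Δ₁ →ₐ[k] stanleyReisnerRing k (Δ₁.join Δ₂) :=
  Ideal.Quotient.liftₐ _ ((Ideal.Quotient.mkₐ k _).comp (MvPolynomial.rename Sum.inl))
    (stanleyReisnerIdeal_le_ker k Δ₁ fun s hs hsΔ => by
      have h := prod_mk_X_eq_zero k (Δ₁.join Δ₂) (s := s.map ⟨Sum.inl, Sum.inl_injective⟩)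
        (hs.map) fun h => hsΔ (by
          have h' := ((Δ₁.mem_join Δ₂).1 h).2.1
          rwa [show (s.map ⟨Sum.inl, Sum.inl_injective⟩ : Finset (V₁ ⊕ V₂)).toLeft = s by
            ext; simp, imp_iff_right hs] at h')
      rw [Finset.prod_map] at h
      simpa using h)

/-- The inclusion `k[Δ₂] → k[Δ₁ * Δ₂]`. -/
noncomputable def joinInr : stanleyReisnerRing k Δ₂ →ₐ[k] stanleyReisnerRing k (Δ₁.join Δ₂) :=
  Ideal.Quotient.liftₐ _ ((Ideal.Quotient.mkₐ k _).comp (MvPolynomial.rename Sum.inr))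
    (stanleyReisnerIdeal_le_ker k Δ₂ fun s hs hsΔ => by
      have h := prod_mk_X_eq_zero k (Δ₁.join Δ₂) (s := s.map ⟨Sum.inr, Sum.inr_injective⟩)
        (hs.map) fun h => hsΔ (by
          have h' := ((Δ₁.mem_join Δ₂).1 h).2.2
          rwa [show (s.map ⟨Sum.inr, Sum.inr_injective⟩ : Finset (V₁ ⊕ V₂)).toRight = s by
            ext; simp, imp_iff_right hs] at h')
      rw [Finset.prod_map] at h
      simpa using h)

lemma joinInl_mk (f : MvPolynomial V₁ k) : joinInl k Δ₁ Δ₂ (Ideal.Quotient.mk _ f) =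
    Ideal.Quotient.mk _ (MvPolynomial.rename Sum.inl f) := rfl

lemma joinInr_mk (f : MvPolynomial V₂ k) : joinInr k Δ₁ Δ₂ (Ideal.Quotient.mk _ f) =
    Ideal.Quotient.mk _ (MvPolynomial.rename Sum.inr f) := rfl

/-- The evaluation of polynomials in the disjoint union of two sets of variables at the images of
the variables under maps out of two Stanley–Reisner rings. -/
noncomputable def joinEval {B : Type*} [CommRing B] [Algebra k B]
    (f : stanleyReisnerRing k Δ₁ →ₐ[k] B) (g : stanleyReisnerRing k Δ₂ →ₐ[k] B) :
    MvPolynomial (V₁ ⊕ V₂) k →ₐ[k] B :=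
  MvPolynomial.aeval (Sum.elim
    (fun v => f (Ideal.Quotient.mk (stanleyReisnerIdeal k Δ₁) (MvPolynomial.X v)))
    (fun v => g (Ideal.Quotient.mk (stanleyReisnerIdeal k Δ₂) (MvPolynomial.X v))))

lemma joinEval_eq_zero {B : Type*} [CommRing B] [Algebra k B]
    (f : stanleyReisnerRing k Δ₁ →ₐ[k] B) (g : stanleyReisnerRing k Δ₂ →ₐ[k] B)
    {p : MvPolynomial (V₁ ⊕ V₂) k} (hp : p ∈ stanleyReisnerIdeal k (Δ₁.join Δ₂)) :
    joinEval k Δ₁ Δ₂ f g p = 0 := by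
  refine RingHom.mem_ker.1 (stanleyReisnerIdeal_le_ker k (Δ₁.join Δ₂)
    (f := (joinEval k Δ₁ Δ₂ f g).toRingHom) (fun s hs hsΔ => ?_) hp)
  simp only [AlgHom.toRingHom_eq_coe, RingHom.coe_coe, joinEval, MvPolynomial.aeval_X]
  rw [← Finset.toLeft_disjSum_toRight (u := s), Finset.prod_disjSum]
  simp only [Sum.elim_inl, Sum.elim_inr, ← map_prod]
  by_cases hl : s.toLeft.Nonempty → s.toLeft ∈ Δ₁
  · by_cases hr : s.toRight.Nonempty → s.toRight ∈ Δ₂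
    · exact absurd ((Δ₁.mem_join Δ₂).2 ⟨hs, hl, hr⟩) hsΔ
    · rw [Classical.not_imp] at hr
      rw [Ideal.Quotient.eq_zero_iff_mem.2 (prod_X_mem k Δ₂ hr.1 hr.2), map_zero, mul_zero]
  · rw [Classical.not_imp] at hl
    rw [Ideal.Quotient.eq_zero_iff_mem.2 (prod_X_mem k Δ₁ hl.1 hl.2), map_zero, zero_mul]

/-- Two maps out of `k[Δ₁]` and `k[Δ₂]` induce a map out of `k[Δ₁ * Δ₂]`: a set of vertices is a
nonface of the join if its part in `V₁` is a nonface of `Δ₁` or its part in `V₂` is a nonface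
of `Δ₂`. -/
noncomputable def joinLift {B : Type*} [CommRing B] [Algebra k B]
    (f : stanleyReisnerRing k Δ₁ →ₐ[k] B) (g : stanleyReisnerRing k Δ₂ →ₐ[k] B) :
    stanleyReisnerRing k (Δ₁.join Δ₂) →ₐ[k] B :=
  Ideal.Quotient.liftₐ _ (joinEval k Δ₁ Δ₂ f g) fun _ => joinEval_eq_zero k Δ₁ Δ₂ f g

lemma joinLift_X_inl {B : Type*} [CommRing B] [Algebra k B]
    (f : stanleyReisnerRing k Δ₁ →ₐ[k] B) (g : stanleyReisnerRing k Δ₂ →ₐ[k] B) (v : V₁) :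
    joinLift k Δ₁ Δ₂ f g (Ideal.Quotient.mk _ (MvPolynomial.X (Sum.inl v))) =
      f (Ideal.Quotient.mk (stanleyReisnerIdeal k Δ₁) (MvPolynomial.X v)) :=
  MvPolynomial.aeval_X _ _

lemma joinLift_X_inr {B : Type*} [CommRing B] [Algebra k B]
    (f : stanleyReisnerRing k Δ₁ →ₐ[k] B) (g : stanleyReisnerRing k Δ₂ →ₐ[k] B) (v : V₂) :
    joinLift k Δ₁ Δ₂ f g (Ideal.Quotient.mk _ (MvPolynomial.X (Sum.inr v))) =
      g (Ideal.Quotient.mk (stanleyReisnerIdeal k Δ₂) (MvPolynomial.X v)) :=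
  MvPolynomial.aeval_X _ _

/-- The map `k[Δ₁ * Δ₂] → k[Δ₁] ⊗ k[Δ₂]`. -/
noncomputable def joinToTensor : stanleyReisnerRing k (Δ₁.join Δ₂) →ₐ[k]
    stanleyReisnerRing k Δ₁ ⊗[k] stanleyReisnerRing k Δ₂ :=
  joinLift k Δ₁ Δ₂ (B := stanleyReisnerRing k Δ₁ ⊗[k] stanleyReisnerRing k Δ₂)
    Algebra.TensorProduct.includeLeft Algebra.TensorProduct.includeRight

/-- The Stanley–Reisner ring of a join is the tensor product of the Stanley–Reisner rings. -/
noncomputable def joinEquiv : stanleyReisnerRing k Δ₁ ⊗[k] stanleyReisnerRing k Δ₂ ≃ₐ[k]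
    stanleyReisnerRing k (Δ₁.join Δ₂) :=
  AlgEquiv.ofAlgHom (Algebra.TensorProduct.productMap (joinInl k Δ₁ Δ₂) (joinInr k Δ₁ Δ₂))
    (joinToTensor k Δ₁ Δ₂)
    (by
      refine Ideal.Quotient.algHom_ext _ (MvPolynomial.algHom_ext fun v => ?_)
      rcases v with v | v
      · change Algebra.TensorProduct.productMap _ _ (joinToTensor k Δ₁ Δ₂ _) =
          Ideal.Quotient.mk _ _
        refine (congrArg (Algebra.TensorProduct.productMap (joinInl k Δ₁ Δ₂) (joinInr k Δ₁ Δ₂))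
          (joinLift_X_inl k Δ₁ Δ₂ _ _ v)).trans ?_
        rw [Algebra.TensorProduct.includeLeft_apply,
          Algebra.TensorProduct.productMap_apply_tmul, map_one, mul_one, joinInl_mk,
          MvPolynomial.rename_X]
      · change Algebra.TensorProduct.productMap _ _ (joinToTensor k Δ₁ Δ₂ _) =
          Ideal.Quotient.mk _ _
        refine (congrArg (Algebra.TensorProduct.productMap (joinInl k Δ₁ Δ₂) (joinInr k Δ₁ Δ₂))
          (joinLift_X_inr k Δ₁ Δ₂ _ _ v)).trans ?_
        rw [Algebra.TensorProduct.includeRight_apply,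
          Algebra.TensorProduct.productMap_apply_tmul, map_one, one_mul, joinInr_mk,
          MvPolynomial.rename_X])
    (by
      refine Algebra.TensorProduct.ext ?_ ?_
      · refine Ideal.Quotient.algHom_ext _ (MvPolynomial.algHom_ext fun v => ?_)
        change joinToTensor k Δ₁ Δ₂ (Algebra.TensorProduct.productMap (joinInl k Δ₁ Δ₂)
          (joinInr k Δ₁ Δ₂) (Ideal.Quotient.mk _ (MvPolynomial.X v) ⊗ₜ 1)) =
            Ideal.Quotient.mk _ (MvPolynomial.X v) ⊗ₜ 1
        rw [Algebra.TensorProduct.productMap_apply_tmul, map_one, mul_one]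
        exact (congrArg (fun t => joinToTensor k Δ₁ Δ₂ (Ideal.Quotient.mk _ t))
          (MvPolynomial.rename_X _ _)).trans (joinLift_X_inl k Δ₁ Δ₂ _ _ v)
      · refine Ideal.Quotient.algHom_ext _ (MvPolynomial.algHom_ext fun v => ?_)
        change joinToTensor k Δ₁ Δ₂ (Algebra.TensorProduct.productMap (joinInl k Δ₁ Δ₂)
          (joinInr k Δ₁ Δ₂) (1 ⊗ₜ Ideal.Quotient.mk _ (MvPolynomial.X v))) =
            1 ⊗ₜ Ideal.Quotient.mk _ (MvPolynomial.X v)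
        rw [Algebra.TensorProduct.productMap_apply_tmul, map_one, one_mul]
        exact (congrArg (fun t => joinToTensor k Δ₁ Δ₂ (Ideal.Quotient.mk _ t))
          (MvPolynomial.rename_X _ _)).trans (joinLift_X_inr k Δ₁ Δ₂ _ _ v))

lemma smul_eq_mk_mul {V : Type*} (Δ : AbstractSimplicialComplex V) (a : MvPolynomial V k)
    (m : stanleyReisnerRing k Δ) : a • m = Ideal.Quotient.mk _ a * m := by
  obtain ⟨f, rfl⟩ := Ideal.Quotient.mk_surjective m
  rfl

lemma joinEquiv_smul_tmul (a₁ : MvPolynomial V₁ k) (a₂ : MvPolynomial V₂ k)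
    (m₁ : stanleyReisnerRing k Δ₁) (m₂ : stanleyReisnerRing k Δ₂) :
    joinEquiv k Δ₁ Δ₂ ((a₁ • m₁) ⊗ₜ (a₂ • m₂)) =
      (MvPolynomial.rename Sum.inl a₁ * MvPolynomial.rename Sum.inr a₂ :
        MvPolynomial (V₁ ⊕ V₂) k) • joinEquiv k Δ₁ Δ₂ (m₁ ⊗ₜ m₂) := by
  change joinInl k Δ₁ Δ₂ (a₁ • m₁) * joinInr k Δ₁ Δ₂ (a₂ • m₂) =
    _ • (joinInl k Δ₁ Δ₂ m₁ * joinInr k Δ₁ Δ₂ m₂)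
  rw [smul_eq_mk_mul, smul_eq_mk_mul, smul_eq_mk_mul, map_mul, map_mul, map_mul, joinInl_mk,
    joinInr_mk]
  ring

/-- Every Stanley–Reisner ring has finite-dimensional Koszul homology. -/
lemma finite_gradedHomology {V : Type u} [Finite V] (Δ : AbstractSimplicialComplex V)
    (F : KoszulFrame (MvPolynomial.X : V → MvPolynomial V k)) (i : ℕ) :
    Module.Finite k (gradedHomology (F.diffk k (stanleyReisnerRing k Δ))
      (F.strandk k (stanleyReisnerRing k Δ)) i) :=
  F.finite_gradedHomology k (fun f => ⟨MvPolynomial.constantCoeff f,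
    MvPolynomial.sub_C_constantCoeff_mem k f⟩) i

/-- The Künneth formula for the Betti numbers of a join. -/
theorem bettiNumber_join [Finite V₁] [Finite V₂] (n : ℕ) :
    bettiNumber k (Δ₁.join Δ₂) n = ∑ p ∈ Finset.HasAntidiagonal.antidiagonal n,
      bettiNumber k Δ₁ p.1 * bettiNumber k Δ₂ p.2 := by
  obtain ⟨F₁⟩ := KoszulFrame.nonempty (MvPolynomial.X : V₁ → MvPolynomial V₁ k)
  obtain ⟨F₂⟩ := KoszulFrame.nonempty (MvPolynomial.X : V₂ → MvPolynomial V₂ k)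
  have hX : Sum.elim
      (fun v => (MvPolynomial.rename Sum.inl).toRingHom (MvPolynomial.X v : MvPolynomial V₁ k))
      (fun v => (MvPolynomial.rename Sum.inr).toRingHom (MvPolynomial.X v : MvPolynomial V₂ k)) =
      (MvPolynomial.X : V₁ ⊕ V₂ → MvPolynomial (V₁ ⊕ V₂) k) := by
    funext v
    rcases v with v | v <;> simp
  have key : ∀ {y : V₁ ⊕ V₂ → MvPolynomial (V₁ ⊕ V₂) k} (F : KoszulFrame y),
      y = MvPolynomial.X → bettiNumber k (Δ₁.join Δ₂) n =
        F.betti k (stanleyReisnerRing k (Δ₁.join Δ₂)) n := by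
    rintro _ F rfl
    exact bettiNumber_eq k _ F n
  rw [key _ hX, KoszulFrame.betti_tensor F₁ F₂ (joinEquiv k Δ₁ Δ₂).toLinearEquiv
    (joinEquiv_smul_tmul k Δ₁ Δ₂) (finite_gradedHomology k Δ₁ F₁) (finite_gradedHomology k Δ₂ F₂)]
  simp only [bettiNumber_eq k Δ₁ F₁, bettiNumber_eq k Δ₂ F₂]

end Join

section Irrelevant

variable (k : Type w) [Field k] {V : Type u} (Δ : AbstractSimplicialComplex V)

/-! ### The irrelevant ideal -/

lemma constantCoeff_eq_zero_of_mem {p : MvPolynomial V k} (hp : p ∈ stanleyReisnerIdeal k Δ) :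
    MvPolynomial.constantCoeff p = 0 :=
  RingHom.mem_ker.1 (stanleyReisnerIdeal_le_ker k Δ (f := MvPolynomial.constantCoeff)
    (fun s hs _ => by
      obtain ⟨v, hv⟩ := hs
      exact Finset.prod_eq_zero hv (by simp)) hp)

lemma irrelevantIdeal_eq_map : irrelevantIdeal k Δ =
    (Ideal.span (Set.range (MvPolynomial.X : V → MvPolynomial V k))).map
      (algebraMap (MvPolynomial V k) (stanleyReisnerRing k Δ)) := by
  rw [Ideal.map_span, ← Set.range_comp]
  rfl

lemma mk_mem_irrelevantIdeal_iff (f : MvPolynomial V k) :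
    Ideal.Quotient.mk (stanleyReisnerIdeal k Δ) f ∈ irrelevantIdeal k Δ ↔
      MvPolynomial.constantCoeff f = 0 := by
  rw [irrelevantIdeal_eq_map]
  constructor
  · intro h
    obtain ⟨g, hg, hgf⟩ :=
      (Ideal.mem_map_iff_of_surjective _ Ideal.Quotient.mk_surjective).1 h
    have h₁ := constantCoeff_eq_zero_of_mem k Δ (Ideal.Quotient.eq.1 hgf)
    rw [map_sub, (MvPolynomial.mem_span_range_X_iff k g).1 hg, zero_sub, neg_eq_zero] at h₁
    exact h₁
  · intro h
    exact Ideal.mem_map_of_mem _ ((MvPolynomial.mem_span_range_X_iff k f).2 h)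

lemma mem_span_X_smul_top_iff (y : stanleyReisnerRing k Δ) :
    y ∈ Ideal.span (Set.range (MvPolynomial.X : V → MvPolynomial V k)) •
      (⊤ : Submodule (MvPolynomial V k) (stanleyReisnerRing k Δ)) ↔ y ∈ irrelevantIdeal k Δ := by
  rw [Ideal.smul_top_eq_map, irrelevantIdeal_eq_map]
  rfl

lemma one_notMem_irrelevantIdeal : (1 : stanleyReisnerRing k Δ) ∉ irrelevantIdeal k Δ := by
  intro h
  have := (mk_mem_irrelevantIdeal_iff k Δ 1).1 h
  simp at this

instance : Nontrivial (stanleyReisnerRing k Δ) :=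
  ⟨1, 0, fun h => one_notMem_irrelevantIdeal k Δ (h ▸ Ideal.zero_mem _)⟩

lemma span_X_smul_top_ne_top : Ideal.span (Set.range (MvPolynomial.X : V → MvPolynomial V k)) •
    (⊤ : Submodule (MvPolynomial V k) (stanleyReisnerRing k Δ)) ≠ ⊤ := fun h =>
  one_notMem_irrelevantIdeal k Δ ((mem_span_X_smul_top_iff k Δ 1).1 (by rw [h]; trivial))

end Irrelevant

/-! ### Vanishing of Betti numbers -/

section Vanishing

open RingTheory.Sequence

variable (k : Type w) [Field k] {V : Type u} (Δ : AbstractSimplicialComplex V)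

/-- Sequences in the irrelevant ideal of `k[Δ]` lift to sequences in the ideal of the variables. -/
lemma exists_map_eq_of_forall_mem_irrelevantIdeal {rs : List (stanleyReisnerRing k Δ)}
    (hrs : ∀ r ∈ rs, r ∈ irrelevantIdeal k Δ) :
    ∃ ss : List (MvPolynomial V k),
      (∀ s ∈ ss, s ∈ Ideal.span (Set.range (MvPolynomial.X : V → MvPolynomial V k))) ∧
      ss.map (algebraMap (MvPolynomial V k) (stanleyReisnerRing k Δ)) = rs := by
  induction rs with
  | nil => exact ⟨[], by simp, rfl⟩
  | cons r rs ih =>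
    obtain ⟨ss, hss, rfl⟩ := ih fun r hr => hrs r (List.mem_cons_of_mem _ hr)
    have hr := hrs r List.mem_cons_self
    obtain ⟨s, rfl⟩ := Ideal.Quotient.mk_surjective r
    refine ⟨s :: ss, ?_, rfl⟩
    intro t ht
    rcases List.mem_cons.1 ht with rfl | ht
    · exact (MvPolynomial.mem_span_range_X_iff k _).2 ((mk_mem_irrelevantIdeal_iff k Δ _).1 hr)
    · exact hss t ht

/-- Regularity of a sequence does not depend on the ring over which the module is considered. -/
lemma isRegular_map_algebraMap_iff {A B M : Type*} [CommRing A] [CommRing B] [Algebra A B]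
    [AddCommGroup M] [Module A M] [Module B M] [IsScalarTower A B M] (rs : List A) :
    IsRegular M (rs.map (algebraMap A B)) ↔ IsRegular M rs :=
  (AddEquiv.refl M).isRegular_congr <| List.forall₂_map_left_iff.mpr <|
    List.forall₂_same.mpr fun r _ => algebraMap_smul B r

section

variable [Finite V] (F : KoszulFrame (MvPolynomial.X : V → MvPolynomial V k))

lemma vanish_iff_bettiNumber_eq_zero (i : ℕ) :
    F.Vanish (stanleyReisnerRing k Δ) i ↔ bettiNumber k Δ i = 0 := by
  have := finite_gradedHomology k Δ F i
  rw [bettiNumber_eq k Δ F, KoszulFrame.betti, Module.finrank_zero_iff,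
    F.subsingleton_gradedHomology_iff]

/-- Rigidity of `Tor`: once a Betti number vanishes, so do all later ones. -/
lemma bettiNumber_eq_zero_of_le {i j : ℕ} (hij : i ≤ j) (h : bettiNumber k Δ i = 0) :
    bettiNumber k Δ j = 0 := by
  obtain ⟨F⟩ := KoszulFrame.nonempty (MvPolynomial.X : V → MvPolynomial V k)
  rw [← vanish_iff_bettiNumber_eq_zero k Δ F] at h ⊢
  exact F.vanish_of_le (MvPolynomial.isMaximal_span_range_X k) F.vanish_mvPolynomial hij h

lemma bettiNumber_zero : bettiNumber k Δ 0 = 1 := by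
  obtain ⟨F⟩ := KoszulFrame.nonempty (MvPolynomial.X : V → MvPolynomial V k)
  let ε : stanleyReisnerRing k Δ →ₐ[k] k :=
    Ideal.Quotient.liftₐ _ (MvPolynomial.aeval fun _ => 0) fun p hp => by
      have := constantCoeff_eq_zero_of_mem k Δ hp
      rw [MvPolynomial.aeval_zero', this, map_zero]
  have hε : ∀ y, ε y = 0 ↔ y ∈ irrelevantIdeal k Δ := fun y => by
    obtain ⟨f, rfl⟩ := Ideal.Quotient.mk_surjective y
    rw [mk_mem_irrelevantIdeal_iff]
    change MvPolynomial.aeval (fun _ => 0) f = 0 ↔ _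
    rw [MvPolynomial.aeval_zero']
    rfl
  let φ : gradedCycles (F.diffk k (stanleyReisnerRing k Δ))
      (F.strandk k (stanleyReisnerRing k Δ)) 0 →ₗ[k] k :=
    ε.toLinearMap ∘ₗ LinearMap.proj F.bot ∘ₗ Submodule.subtype _
  rw [bettiNumber_eq k Δ F, KoszulFrame.betti, (gradedHomologyEquiv φ ?_ ?_).finrank_eq,
    Module.finrank_self]
  · intro c
    refine ⟨⟨(Pi.single F.bot (algebraMap k _ c) : F.I → stanleyReisnerRing k Δ), ?_,
      F.single_bot_mem _⟩, ?_⟩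
    · exact F.diff_eq_zero_of_mem_strand_zero (F.single_bot_mem _)
    · change ε ((Pi.single F.bot (algebraMap k _ c) : F.I → stanleyReisnerRing k Δ) F.bot) = c
      rw [Pi.single_eq_same, AlgHom.commutes]
      rfl
  · intro f
    have hf : (f : F.I → stanleyReisnerRing k Δ) = Pi.single F.bot ((f : F.I → _) F.bot) :=
      F.eq_single_bot f.2.2
    rw [F.mem_gradedBoundaries, hf, zero_add, F.exists_diff_eq_single_bot_iff,
      mem_span_X_smul_top_iff, ← hε]
    rfl

end

variable [Fintype V]

/-- The projective dimension of `k[Δ]` is at least the codimension: otherwise the depth would exceed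
the Krull dimension. -/
lemma bettiNumber_codim_ne_zero : bettiNumber k Δ Δ.codim ≠ 0 := by
  intro h
  obtain ⟨F⟩ := KoszulFrame.nonempty (MvPolynomial.X : V → MvPolynomial V k)
  obtain ⟨rs, hrs, -, hreg⟩ := F.exists_isRegular_of_vanish (Δ.maxFaceCard + 1)
    (span_X_smul_top_ne_top k Δ) fun i hi => by
      rw [vanish_iff_bettiNumber_eq_zero]
      refine bettiNumber_eq_zero_of_le k Δ ?_ h
      rw [F.deg_top, Nat.card_eq_fintype_card] at hi
      rw [codim_eq]
      omega
  have := length_le_supportDim_of_isRegular rs hreg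
  rw [Module.supportDim_quotient_eq_ringKrullDim, ringKrullDim_stanleyReisnerRing, hrs] at this
  have h' : Δ.maxFaceCard + 1 ≤ Δ.maxFaceCard := by exact_mod_cast this
  omega

lemma bettiNumber_ne_zero_of_le_codim {i : ℕ} (hi : i ≤ Δ.codim) : bettiNumber k Δ i ≠ 0 :=
  fun h => bettiNumber_codim_ne_zero k Δ (bettiNumber_eq_zero_of_le k Δ hi h)

/-- `Δ` is Cohen–Macaulay if and only if the projective dimension of `k[Δ]` is at most the
codimension, as regular sequences detect how many of the highest Koszul homology groups vanish. -/
theorem isCohenMacaulay_iff : IsCohenMacaulay k Δ ↔ ∀ i, Δ.codim < i → bettiNumber k Δ i = 0 := by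
  obtain ⟨F⟩ := KoszulFrame.nonempty (MvPolynomial.X : V → MvPolynomial V k)
  have hle := Δ.maxFaceCard_le
  have hc := Δ.codim_eq
  have htop : F.deg F.top = Fintype.card V := by rw [F.deg_top, Nat.card_eq_fintype_card]
  constructor
  · rintro ⟨rs, hrs, hreg, hlen⟩ i hi
    rw [ringKrullDim_stanleyReisnerRing] at hlen
    have hlen' : rs.length = Δ.maxFaceCard := by exact_mod_cast hlen
    obtain ⟨ss, hss, rfl⟩ := exists_map_eq_of_forall_mem_irrelevantIdeal k Δ hrs
    rw [← vanish_iff_bettiNumber_eq_zero k Δ F]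
    refine F.vanish_of_isWeaklyRegular ss hss
      ((isWeaklyRegular_map_algebraMap_iff _ _ _).1 hreg.toIsWeaklyRegular) ?_
    rw [List.length_map] at hlen'
    omega
  · intro h
    obtain ⟨ss, hlen, hss, hreg⟩ := F.exists_isRegular_of_vanish Δ.maxFaceCard
      (span_X_smul_top_ne_top k Δ) fun i hi => by
        rw [vanish_iff_bettiNumber_eq_zero]
        exact h i (by omega)
    refine ⟨ss.map (algebraMap _ _), ?_, (isRegular_map_algebraMap_iff ss).2 hreg, ?_⟩
    · intro r hr
      obtain ⟨s, hs, rfl⟩ := List.mem_map.1 hr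
      rw [irrelevantIdeal_eq_map]
      exact Ideal.mem_map_of_mem _ (hss s hs)
    · rw [ringKrullDim_stanleyReisnerRing, List.length_map, hlen]

end Vanishing

/-! ### The linear strand of the graded Betti numbers -/

section Graded

variable (k : Type w) [Field k] {V : Type u} (Δ : AbstractSimplicialComplex V)

lemma mem_gradedPiece_zero_iff (y : stanleyReisnerRing k Δ) :
    y ∈ gradedPiece k Δ 0 ↔ ∃ c : k, algebraMap k _ c = y := by
  constructor
  · rintro ⟨f, hf, rfl⟩
    refine ⟨MvPolynomial.coeff 0 f, ?_⟩
    have h := MvPolynomial.IsHomogeneous.totalDegree_le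
      ((MvPolynomial.mem_homogeneousSubmodule 0 f).1 hf)
    rw [MvPolynomial.totalDegree_eq_zero_iff_eq_C.1 (Nat.le_zero.1 h)]
    simp
  · rintro ⟨c, rfl⟩
    exact ⟨MvPolynomial.C c, (MvPolynomial.mem_homogeneousSubmodule 0 _).2
      (MvPolynomial.isHomogeneous_C V c), rfl⟩

variable [Fintype V]

/-- The variables are linearly independent in `k[Δ]`, since every vertex is a face. -/
lemma eq_zero_of_sum_X_mul_eq_zero {c : V → k}
    (h : ∑ v, Ideal.Quotient.mk (stanleyReisnerIdeal k Δ) (MvPolynomial.X v) *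
      algebraMap k (stanleyReisnerRing k Δ) (c v) = 0) (v : V) : c v = 0 := by
  have hv : ({v} : Finset V).Nonempty → {v} ∈ Δ := fun _ => Δ.singleton_mem v
  have h' := congrArg (restrictFace k Δ hv) h
  rw [map_sum, Finset.sum_eq_single v, map_mul, map_zero, restrictFace_algebraMap,
    restrictFace_X_of_mem k Δ hv (Finset.mem_singleton_self v), mul_comm,
    ← MvPolynomial.smul_eq_C_mul] at h'
  · exact (smul_eq_zero.1 h').resolve_right (MvPolynomial.X_ne_zero _)
  · intro u _ hu
    rw [map_mul, restrictFace_X_of_notMem k Δ hv (by simpa using hu), zero_mul]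
  · exact fun hv => absurd (Finset.mem_univ v) hv

/-- For positive `i` there are no nonzero cycles of degree `i` in `K_i`: their coefficients are
scalars, and the variables are linearly independent in `k[Δ]`. -/
lemma gradedBettiNumber_self {i : ℕ} (hi : i ≠ 0) : gradedBettiNumber k Δ i i = 0 := by
  obtain ⟨i, rfl⟩ := Nat.exists_eq_succ_of_ne_zero hi
  have hbot : ∀ f ∈ koszulCycles k (fun y : V => Ideal.Quotient.mk (stanleyReisnerIdeal k Δ)
      (MvPolynomial.X y)) (gradedPiece k Δ) (i + 1) (i + 1), f = 0 := by
    rintro f ⟨⟨-, -, hf⟩, hdf⟩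
    have hf' : ∀ s, ∃ c : k, algebraMap k _ c = f s := fun s => by
      rw [← mem_gradedPiece_zero_iff]
      simpa using hf s
    choose c hc using hf'
    funext s
    have h := congrFun (LinearMap.mem_ker.1 hdf) (Fin.tail s)
    simp only [koszulDifferential, LinearMap.coe_mk, AddHom.coe_mk, ← hc] at h
    have h₀ := eq_zero_of_sum_X_mul_eq_zero k Δ h (s 0)
    rw [Fin.cons_self_tail] at h₀
    rw [← hc, h₀, map_zero]
    rfl
  have : Subsingleton (koszulCycles k (fun y : V => Ideal.Quotient.mk (stanleyReisnerIdeal k Δ)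
      (MvPolynomial.X y)) (gradedPiece k Δ) (i + 1) (i + 1)) :=
    ⟨fun f g => Subtype.ext ((hbot f f.2).trans (hbot g g.2).symm)⟩
  exact Module.finrank_zero_of_subsingleton

lemma gradedBettiNumber_zero : gradedBettiNumber k Δ 0 0 = 1 := by
  let φ : k →ₗ[k] koszulHomology k (fun y : V => Ideal.Quotient.mk (stanleyReisnerIdeal k Δ)
      (MvPolynomial.X y)) (gradedPiece k Δ) 0 0 :=
    Submodule.mkQ _ ∘ₗ LinearMap.codRestrict _
      (LinearMap.pi fun _ => Algebra.linearMap k (stanleyReisnerRing k Δ)) (fun c =>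
        ⟨fun s hs => absurd (Function.injective_of_subsingleton s) hs, fun s σ => by
          rw [Subsingleton.elim σ 1]
          simp, fun s => by
          simpa using (mem_gradedPiece_zero_iff k Δ _).2 ⟨c, rfl⟩⟩)
  have hφ : Function.Bijective φ := by
    constructor
    · rw [injective_iff_map_eq_zero]
      intro c hc
      obtain ⟨g, hg, hdg⟩ := (Submodule.Quotient.mk_eq_zero _).1 hc
      have hg0 : g = 0 := funext fun s => by simpa using hg.2.2 s
      rw [hg0, map_zero] at hdg
      have h := congrFun hdg.symm Fin.elim0
      exact (map_eq_zero (algebraMap k (stanleyReisnerRing k Δ))).1 h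
    · intro y
      obtain ⟨⟨f, hf⟩, rfl⟩ := Submodule.mkQ_surjective _ y
      have h := hf.2.2 Fin.elim0
      obtain ⟨c, hc⟩ := (mem_gradedPiece_zero_iff k Δ (f Fin.elim0)).1 (by simpa using h)
      refine ⟨c, congrArg _ (Subtype.ext (funext fun s => ?_))⟩
      rw [Subsingleton.elim s Fin.elim0]
      exact hc
  exact (LinearEquiv.ofBijective φ hφ).finrank_eq.symm.trans (Module.finrank_self k)

/-- In codimension zero the subtracted term is the only Betti number. -/
lemma modifiedType_of_isSimplex (h : Δ.IsSimplex) : modifiedType k Δ = 0 := by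
  rw [modifiedType, (codim_eq_zero_iff Δ).2 h, bettiNumber_zero, gradedBettiNumber_zero, sub_self]

/-- In positive codimension the subtracted term vanishes. -/
lemma modifiedType_of_not_isSimplex (h : ¬ Δ.IsSimplex) :
    modifiedType k Δ = bettiNumber k Δ Δ.codim := by
  rw [modifiedType, gradedBettiNumber_self k Δ (mt (codim_eq_zero_iff Δ).1 h)]
  simp

end Graded

end AbstractSimplicialComplex

/-! ### Ext modules and regular sequences -/

section Ext

open RingTheory.Sequence
open scoped Pointwise

variable {R : Type v} [CommRing R]

lemma smul_top_quotSMulTop_ne_top {M : Type*} [AddCommGroup M] [Module R M] {I : Ideal R} {r : R}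
    (hr : r ∈ I) (hI : I • (⊤ : Submodule R M) ≠ ⊤) :
    I • (⊤ : Submodule R (QuotSMulTop r M)) ≠ ⊤ := by
  intro h
  apply hI
  rw [eq_top_iff]
  intro y _
  have hy : (r • (⊤ : Submodule R M)).mkQ y ∈ I • (⊤ : Submodule R (QuotSMulTop r M)) := by
    rw [h]
    trivial
  rw [← Submodule.range_mkQ, LinearMap.range_eq_map, ← Submodule.map_smul''] at hy
  obtain ⟨z, hz, hzy⟩ := hy
  have h₁ : y - z ∈ r • (⊤ : Submodule R M) := by
    rw [← Submodule.Quotient.mk_eq_zero, Submodule.Quotient.mk_sub, sub_eq_zero]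
    exact hzy.symm
  obtain ⟨t, ht, htr⟩ := (Submodule.mem_smul_pointwise_iff_exists _ _ _).1 h₁
  rw [← sub_add_cancel y z, ← htr]
  exact Submodule.add_mem _ (Submodule.smul_mem_smul hr ht) hz

/-- The linear maps out of `R / I` are the elements killed by `I`. -/
def quotientHomEquiv (I : Ideal R) (M : Type*) [AddCommGroup M] [Module R M] :
    ((R ⧸ I) →ₗ[R] M) ≃ₗ[R] Submodule.torsionBySet R M (I : Set R) where
  toFun f := ⟨f 1, (Submodule.mem_torsionBySet_iff _ _).2 fun a => by
    rw [← map_smul]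
    have : (a : R) • (1 : R ⧸ I) = 0 := by
      change Ideal.Quotient.mk I ((a : R) * 1) = 0
      rw [mul_one, Ideal.Quotient.eq_zero_iff_mem]
      exact a.2
    rw [this, map_zero]⟩
  map_add' f g := rfl
  map_smul' r f := rfl
  invFun y := I.liftQ (LinearMap.toSpanSingleton R M y) fun a ha =>
    (Submodule.mem_torsionBySet_iff _ _).1 y.2 ⟨a, ha⟩
  left_inv f := by
    refine LinearMap.ext fun z => ?_
    obtain ⟨a, rfl⟩ := Submodule.mkQ_surjective _ z
    change a • f 1 = f _
    rw [← map_smul]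
    congr 1
    change Ideal.Quotient.mk I (a * 1) = Ideal.Quotient.mk I a
    rw [mul_one]
  right_inv y := Subtype.ext (one_smul R y.1)

/-- An element `r` of `I` acts on `Ext (R / I) M` through either argument, hence by zero. -/
lemma ext_comp_mk₀_smul_id_eq_zero {I : Ideal R} {M : ModuleCat.{v} R} {r : R} (hr : r ∈ I) {n : ℕ}
    (x : Abelian.Ext (ModuleCat.of R (R ⧸ I)) M n) :
    x.comp (Abelian.Ext.mk₀ (r • 𝟙 M)) (add_zero n) = 0 := by
  have hN : r • 𝟙 (ModuleCat.of R (R ⧸ I)) = 0 := by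
    refine ModuleCat.hom_ext (LinearMap.ext fun z => ?_)
    obtain ⟨a, rfl⟩ := Ideal.Quotient.mk_surjective z
    exact Ideal.Quotient.eq_zero_iff_mem.2 (I.mul_mem_right a hr)
  have h₁ : r • x = (Abelian.Ext.mk₀ (r • 𝟙 (ModuleCat.of R (R ⧸ I)))).comp x (zero_add n) := by
    rw [Abelian.Ext.mk₀_smul, Abelian.Ext.smul_comp, Abelian.Ext.mk₀_id_comp]
  rw [Abelian.Ext.mk₀_smul, Abelian.Ext.comp_smul, Abelian.Ext.comp_mk₀_id, h₁, hN,
    Abelian.Ext.mk₀_zero, Abelian.Ext.zero_comp]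

/-- Dimension shifting along a regular element of `I`. -/
lemma nonempty_ext_quotSMulTop_linearEquiv {I : Ideal R} {M : ModuleCat.{v} R} {r : R} (hr : r ∈ I)
    (hreg : IsSMulRegular M r) (n : ℕ)
    (h : Subsingleton (Abelian.Ext (ModuleCat.of R (R ⧸ I)) M n)) :
    Nonempty (Abelian.Ext (ModuleCat.of R (R ⧸ I)) (ModuleCat.of R (QuotSMulTop r M)) n ≃ₗ[R]
      Abelian.Ext (ModuleCat.of R (R ⧸ I)) M (n + 1)) := by
  have hS := hreg.smulShortComplex_shortExact
  refine ⟨LinearEquiv.ofBijective (Abelian.Ext.postcompOfLinear hS.extClass R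
    (ModuleCat.of R (R ⧸ I)) rfl) ⟨?_, ?_⟩⟩
  · rw [injective_iff_map_eq_zero]
    intro x hx
    obtain ⟨y, rfl⟩ := Abelian.Ext.covariant_sequence_exact₃ _ hS x rfl hx
    have hy : y = 0 := @Subsingleton.elim _ h y 0
    rw [hy, Abelian.Ext.zero_comp]
  · intro x
    refine Abelian.Ext.covariant_sequence_exact₁ _ hS x ?_ rfl
    change x.comp (Abelian.Ext.mk₀ (M.smulShortComplex r).f) _ = 0
    rw [ModuleCat.smulShortComplex_f_eq_smul_id]
    exact ext_comp_mk₀_smul_id_eq_zero hr x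

/-- Rees' theorem: modulo a regular sequence of length `d` in `I`, `Ext^d (R / I) M` becomes the
module of maps from `R / I`, that is, of elements killed by `I`. -/
theorem nonempty_ext_linearEquiv [IsNoetherianRing R] {I : Ideal R} (rs : List R)
    (hrs : ∀ r ∈ rs, r ∈ I) (M : ModuleCat.{v} R) [Module.Finite R M]
    (hI : I • (⊤ : Submodule R M) ≠ ⊤) (hreg : IsRegular M rs) :
    Nonempty (Abelian.Ext (ModuleCat.of R (R ⧸ I)) M rs.length ≃ₗ[R]
      Submodule.torsionBySet R (M ⧸ Ideal.ofList rs • (⊤ : Submodule R M)) (I : Set R)) := by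
  induction rs generalizing M with
  | nil =>
    have e : M ≃ₗ[R] (M ⧸ Ideal.ofList ([] : List R) • (⊤ : Submodule R M)) :=
      (Submodule.quotEquivOfEqBot _ (by rw [Ideal.ofList_nil, Submodule.bot_smul])).symm
    exact ⟨Abelian.Ext.linearEquiv₀ ≪≫ₗ ModuleCat.homLinearEquiv ≪≫ₗ
      LinearEquiv.congrRight e ≪≫ₗ quotientHomEquiv I _⟩
  | cons r rs ih =>
    have hr := hrs r List.mem_cons_self
    have hreg' := (isRegular_cons_iff M r rs).1 hreg
    obtain ⟨e₁⟩ := ih (fun r hr => hrs r (List.mem_cons_of_mem _ hr))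
      (ModuleCat.of R (QuotSMulTop r M)) (smul_top_quotSMulTop_ne_top hr hI) hreg'.2
    have hsub := ModuleCat.subsingleton_ext_of_exists_isRegular I (ModuleCat.of R (R ⧸ I))
      (by
        change Module.support R (R ⧸ I) ⊆ _
        rw [Module.support_eq_zeroLocus, Ideal.annihilator_quotient]) M hI.lt_top (r :: rs) hrs
        hreg rs.length (by simp)
    obtain ⟨e₂⟩ := nonempty_ext_quotSMulTop_linearEquiv hr hreg'.1 rs.length hsub
    let e₃ := Submodule.quotOfListConsSMulTopEquivQuotSMulTopInner M r rs
    exact ⟨e₂.symm ≪≫ₗ e₁ ≪≫ₗ (quotientHomEquiv I _).symm ≪≫ₗ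
      LinearEquiv.congrRight e₃.symm ≪≫ₗ quotientHomEquiv I _⟩

/-- A module over a `k`-algebra that is killed by an ideal with residue field `k` is isomorphic to
the residue field if and only if it is one-dimensional. -/
lemma nonempty_linearEquiv_quotient_iff {k : Type*} [Field k] [Algebra k R] {m : Ideal R}
    (hm : (1 : R) ∉ m) (hk : ∀ a : R, ∃ c : k, a - algebraMap k R c ∈ m)
    {T : Type*} [AddCommGroup T] [Module R T] [Module k T] [IsScalarTower k R T]
    (hT : ∀ a ∈ m, ∀ t : T, a • t = 0) :
    Nonempty (T ≃ₗ[R] (R ⧸ m)) ↔ Module.finrank k T = 1 := by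
  constructor
  · rintro ⟨e⟩
    rw [(e.restrictScalars k).finrank_eq, finrank_eq_one_iff']
    refine ⟨1, fun h => hm (Ideal.Quotient.eq_zero_iff_mem.1 h), fun z => ?_⟩
    obtain ⟨a, rfl⟩ := Ideal.Quotient.mk_surjective z
    obtain ⟨c, hc⟩ := hk a
    refine ⟨c, ?_⟩
    rw [← Ideal.Quotient.eq] at hc
    rw [hc, Algebra.smul_def, mul_one]
    rfl
  · intro h
    obtain ⟨t, ht, hspan⟩ := finrank_eq_one_iff'.1 h
    refine ⟨(LinearEquiv.ofBijective (m.liftQ (LinearMap.toSpanSingleton R T t) fun a ha =>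
      hT a ha t) ⟨?_, ?_⟩).symm⟩
    · rw [injective_iff_map_eq_zero]
      intro z hz
      obtain ⟨a, rfl⟩ := Submodule.mkQ_surjective _ z
      obtain ⟨c, hc⟩ := hk a
      have h₁ : a • t = 0 := hz
      have h₂ := hT _ hc t
      rw [sub_smul, h₁, algebraMap_smul, zero_sub, neg_eq_zero, smul_eq_zero] at h₂
      rw [h₂.resolve_right ht, map_zero, sub_zero] at hc
      exact (Submodule.Quotient.mk_eq_zero m).2 hc
    · intro s
      obtain ⟨c, rfl⟩ := hspan s
      exact ⟨Submodule.mkQ _ (algebraMap k R c), algebraMap_smul R c t⟩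

end Ext

/-! ### The Gorenstein property in terms of Betti numbers -/

namespace AbstractSimplicialComplex

section Gorenstein

open RingTheory.Sequence

variable (k : Type w) [Field k] {V : Type u} [Fintype V] (Δ : AbstractSimplicialComplex V)

/-- A Cohen–Macaulay complex is Gorenstein if and only if its last Betti number is one: both that
Betti number and the dimension of `Ext_R^d(k, R)` equal the dimension of the socle of `R` modulo a
maximal regular sequence. -/
theorem isGorenstein_iff (hCM : IsCohenMacaulay k Δ) :
    IsGorenstein k Δ ↔ bettiNumber k Δ Δ.codim = 1 := by
  obtain ⟨F⟩ := KoszulFrame.nonempty (MvPolynomial.X : V → MvPolynomial V k)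
  obtain ⟨rs, hrs, hreg, hlen⟩ := id hCM
  have hlen' : rs.length = Δ.maxFaceCard := by
    rw [ringKrullDim_stanleyReisnerRing] at hlen
    exact_mod_cast hlen
  obtain ⟨ss, hss, hssrs⟩ := exists_map_eq_of_forall_mem_irrelevantIdeal k Δ hrs
  have htop : Δ.codim + ss.length = F.deg F.top := by
    have hle := Δ.maxFaceCard_le
    have hc := Δ.codim_eq
    have hl : ss.length = rs.length := by rw [← hssrs, List.length_map]
    rw [F.deg_top, Nat.card_eq_fintype_card]
    omega
  have hweak : IsWeaklyRegular (stanleyReisnerRing k Δ) ss :=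
    (isWeaklyRegular_map_algebraMap_iff (stanleyReisnerRing k Δ) _ ss).1
      (hssrs ▸ hreg.toIsWeaklyRegular)
  let N : Ideal (stanleyReisnerRing k Δ) := Ideal.ofList rs • ⊤
  have hN : (Ideal.ofList ss • ⊤ : Submodule (MvPolynomial V k) (stanleyReisnerRing k Δ)) =
      N.restrictScalars (MvPolynomial V k) := by
    rw [Ideal.smul_top_eq_map, Ideal.map_ofList, hssrs]
    change _ = (Ideal.ofList rs • ⊤ : Ideal (stanleyReisnerRing k Δ)).restrictScalars _
    rw [smul_eq_mul, Ideal.mul_top]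
  let e : (stanleyReisnerRing k Δ ⧸
      (Ideal.ofList ss • ⊤ : Submodule (MvPolynomial V k) (stanleyReisnerRing k Δ)))
        ≃ₗ[MvPolynomial V k] (stanleyReisnerRing k Δ ⧸ N) :=
    Submodule.quotEquivOfEq _ _ hN ≪≫ₗ Submodule.Quotient.restrictScalarsEquiv _ N
  have hb : bettiNumber k Δ Δ.codim = Module.finrank k
      (Submodule.torsionBySet (stanleyReisnerRing k Δ) (stanleyReisnerRing k Δ ⧸ N)
        (irrelevantIdeal k Δ : Set (stanleyReisnerRing k Δ))) := by
    rw [bettiNumber_eq k Δ F, ← F.betti_top_quotient k ss hss hweak htop, F.betti_congr k e,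
      F.betti_top k]
    have hT : (Submodule.torsionBySet (MvPolynomial V k) (stanleyReisnerRing k Δ ⧸ N)
          (Ideal.span (Set.range (MvPolynomial.X : V → MvPolynomial V k)) :
            Set (MvPolynomial V k))).restrictScalars k =
        (Submodule.torsionBySet (stanleyReisnerRing k Δ) (stanleyReisnerRing k Δ ⧸ N)
          (irrelevantIdeal k Δ : Set (stanleyReisnerRing k Δ))).restrictScalars k := by
      ext y
      rw [Submodule.restrictScalars_mem, Submodule.restrictScalars_mem,
        Submodule.mem_torsionBySet_iff, Submodule.mem_torsionBySet_iff]
      constructor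
      · rintro h ⟨a, ha⟩
        obtain ⟨f, rfl⟩ := Ideal.Quotient.mk_surjective a
        have hf : f ∈ Ideal.span (Set.range (MvPolynomial.X : V → MvPolynomial V k)) :=
          (MvPolynomial.mem_span_range_X_iff k f).2 ((mk_mem_irrelevantIdeal_iff k Δ f).1 ha)
        have := h ⟨f, hf⟩
        rw [← algebraMap_smul (stanleyReisnerRing k Δ)] at this
        exact this
      · rintro h ⟨f, hf⟩
        have := h ⟨algebraMap _ _ f, by
          rw [irrelevantIdeal_eq_map]; exact Ideal.mem_map_of_mem _ hf⟩
        rw [algebraMap_smul] at this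
        exact this
    rw [hT]
    rfl
  have hI : irrelevantIdeal k Δ • (⊤ : Submodule (stanleyReisnerRing k Δ)
      (stanleyReisnerRing k Δ)) ≠ ⊤ := by
    rw [smul_eq_mul, Ideal.mul_top, Ne, Ideal.eq_top_iff_one]
    exact one_notMem_irrelevantIdeal k Δ
  obtain ⟨E⟩ := nonempty_ext_linearEquiv rs hrs
    (ModuleCat.of (stanleyReisnerRing k Δ) (stanleyReisnerRing k Δ)) hI hreg
  have key : Nonempty (Submodule.torsionBySet (stanleyReisnerRing k Δ)
        (stanleyReisnerRing k Δ ⧸ N) (irrelevantIdeal k Δ : Set (stanleyReisnerRing k Δ))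
      ≃ₗ[stanleyReisnerRing k Δ] (stanleyReisnerRing k Δ ⧸ irrelevantIdeal k Δ)) ↔ _ :=
    nonempty_linearEquiv_quotient_iff (k := k) (one_notMem_irrelevantIdeal k Δ) (fun a => by
      obtain ⟨f, rfl⟩ := Ideal.Quotient.mk_surjective a
      refine ⟨MvPolynomial.constantCoeff f, (mk_mem_irrelevantIdeal_iff k Δ _).2 ?_⟩
      exact (MvPolynomial.mem_span_range_X_iff k _).1 (MvPolynomial.sub_C_constantCoeff_mem k f))
      fun a ha t => Subtype.ext ((Submodule.mem_torsionBySet_iff _ _).1 t.2 ⟨a, ha⟩)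
  rw [hb, ← key]
  constructor
  · rintro ⟨-, d, hd, ⟨e'⟩⟩
    rw [← hlen] at hd
    have hd' : d = rs.length := by exact_mod_cast hd
    subst hd'
    exact ⟨E.symm ≪≫ₗ e'⟩
  · rintro ⟨e'⟩
    exact ⟨hCM, rs.length, hlen, ⟨E ≪≫ₗ e'⟩⟩

end Gorenstein

end AbstractSimplicialComplex

/-! ### The type defect of a join -/

namespace AbstractSimplicialComplex

section TypeDefectJoin

variable (k : Type w) [Field k] {V : Type u} (Δ : AbstractSimplicialComplex V)

lemma stanleyReisnerIdeal_of_isSimplex (h : Δ.IsSimplex) : stanleyReisnerIdeal k Δ = ⊥ := by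
  rw [stanleyReisnerIdeal, Ideal.span_eq_bot]
  rintro p ⟨s, hs, hsΔ, -⟩
  exact absurd (h s hs) hsΔ

variable [Fintype V]

lemma bettiNumber_of_isSimplex (h : Δ.IsSimplex) {i : ℕ} (hi : i ≠ 0) : bettiNumber k Δ i = 0 := by
  obtain ⟨F⟩ := KoszulFrame.nonempty (MvPolynomial.X : V → MvPolynomial V k)
  obtain ⟨i, rfl⟩ := Nat.exists_eq_succ_of_ne_zero hi
  rw [bettiNumber_eq k Δ F, F.betti_congr k
    (Submodule.quotEquivOfEqBot _ (stanleyReisnerIdeal_of_isSimplex k Δ h))]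
  have := (F.subsingleton_gradedHomology_iff (k := k)).2 (F.vanish_mvPolynomial i)
  exact Module.finrank_zero_of_subsingleton

lemma typeDefect_of_isSimplex (h : Δ.IsSimplex) : typeDefect k Δ = 0 := by
  rw [typeDefect, modifiedType_of_isSimplex k Δ h, (codim_eq_zero_iff Δ).2 h]
  rfl

lemma typeDefect_of_not_isSimplex (h : ¬ Δ.IsSimplex) :
    typeDefect k Δ = bettiNumber k Δ Δ.codim - Δ.codim := by
  rw [typeDefect, modifiedType_of_not_isSimplex k Δ h]

variable {V₁ : Type u} {V₂ : Type v} [Fintype V₁] [Fintype V₂]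
  (Δ₁ : AbstractSimplicialComplex V₁) (Δ₂ : AbstractSimplicialComplex V₂)

lemma isSimplex_join_iff : (Δ₁.join Δ₂).IsSimplex ↔ Δ₁.IsSimplex ∧ Δ₂.IsSimplex := by
  rw [← codim_eq_zero_iff, ← codim_eq_zero_iff, ← codim_eq_zero_iff, codim_join,
    Nat.add_eq_zero_iff]

lemma bettiNumber_join_of_isSimplex_right (h : Δ₂.IsSimplex) (n : ℕ) :
    bettiNumber k (Δ₁.join Δ₂) n = bettiNumber k Δ₁ n := by
  rw [bettiNumber_join, Finset.sum_eq_single (n, 0), bettiNumber_zero, mul_one]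
  · intro p hp hne
    rw [Finset.HasAntidiagonal.mem_antidiagonal] at hp
    rw [bettiNumber_of_isSimplex k Δ₂ h, mul_zero]
    intro h0
    exact hne (Prod.ext (by rw [← hp, h0, add_zero]) h0)
  · intro hn
    exact absurd (Finset.HasAntidiagonal.mem_antidiagonal.2 (add_zero n)) hn

lemma bettiNumber_join_of_isSimplex_left (h : Δ₁.IsSimplex) (n : ℕ) :
    bettiNumber k (Δ₁.join Δ₂) n = bettiNumber k Δ₂ n := by
  rw [bettiNumber_join, Finset.sum_eq_single (0, n), bettiNumber_zero, one_mul]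
  · intro p hp hne
    rw [Finset.HasAntidiagonal.mem_antidiagonal] at hp
    rw [bettiNumber_of_isSimplex k Δ₁ h, zero_mul]
    intro h0
    exact hne (Prod.ext h0 (by rw [← hp, h0, zero_add]))
  · intro hn
    exact absurd (Finset.HasAntidiagonal.mem_antidiagonal.2 (zero_add n)) hn

lemma typeDefect_join_of_isSimplex_right (h : Δ₂.IsSimplex) :
    typeDefect k (Δ₁.join Δ₂) = typeDefect k Δ₁ := by
  by_cases h₁ : Δ₁.IsSimplex
  · rw [typeDefect_of_isSimplex k Δ₁ h₁, typeDefect_of_isSimplex k _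
      ((isSimplex_join_iff Δ₁ Δ₂).2 ⟨h₁, h⟩)]
  · rw [typeDefect_of_not_isSimplex k Δ₁ h₁, typeDefect_of_not_isSimplex k _
      (mt (fun hj => ((isSimplex_join_iff Δ₁ Δ₂).1 hj).1) h₁),
      bettiNumber_join_of_isSimplex_right k Δ₁ Δ₂ h, codim_join, (codim_eq_zero_iff Δ₂).2 h,
      add_zero]

lemma typeDefect_join_of_isSimplex_left (h : Δ₁.IsSimplex) :
    typeDefect k (Δ₁.join Δ₂) = typeDefect k Δ₂ := by
  by_cases h₂ : Δ₂.IsSimplex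
  · rw [typeDefect_of_isSimplex k Δ₂ h₂, typeDefect_of_isSimplex k _
      ((isSimplex_join_iff Δ₁ Δ₂).2 ⟨h, h₂⟩)]
  · rw [typeDefect_of_not_isSimplex k Δ₂ h₂, typeDefect_of_not_isSimplex k _
      (mt (fun hj => ((isSimplex_join_iff Δ₁ Δ₂).1 hj).2) h₂),
      bettiNumber_join_of_isSimplex_left k Δ₁ Δ₂ h, codim_join, (codim_eq_zero_iff Δ₁).2 h,
      zero_add]

lemma isCohenMacaulay_iff_bettiNumber_succ_eq_zero :
    IsCohenMacaulay k Δ ↔ bettiNumber k Δ (Δ.codim + 1) = 0 := by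
  rw [isCohenMacaulay_iff]
  exact ⟨fun h => h _ (Nat.lt_succ_self _), fun h i hi => bettiNumber_eq_zero_of_le k Δ hi h⟩

/-- The Betti number of a join at the codimension is the product of those of the factors plus the
remaining Künneth summands, which all vanish exactly when both factors are Cohen–Macaulay. -/
lemma exists_bettiNumber_join_codim (h₁ : ¬ Δ₁.IsSimplex) (h₂ : ¬ Δ₂.IsSimplex) :
    ∃ r : ℕ, bettiNumber k (Δ₁.join Δ₂) (Δ₁.join Δ₂).codim =
        bettiNumber k Δ₁ Δ₁.codim * bettiNumber k Δ₂ Δ₂.codim + r ∧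
      (r = 0 ↔ IsCohenMacaulay k Δ₁ ∧ IsCohenMacaulay k Δ₂) := by
  classical
  rw [codim_join, bettiNumber_join, ← Finset.add_sum_erase _ _
    (Finset.HasAntidiagonal.mem_antidiagonal.2 rfl :
      (Δ₁.codim, Δ₂.codim) ∈ Finset.HasAntidiagonal.antidiagonal (Δ₁.codim + Δ₂.codim))]
  refine ⟨_, rfl, ?_⟩
  rw [Finset.sum_eq_zero_iff]
  have hc₁ : Δ₁.codim ≠ 0 := mt (codim_eq_zero_iff Δ₁).1 h₁
  have hc₂ : Δ₂.codim ≠ 0 := mt (codim_eq_zero_iff Δ₂).1 h₂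
  constructor
  · intro h
    rw [isCohenMacaulay_iff_bettiNumber_succ_eq_zero, isCohenMacaulay_iff_bettiNumber_succ_eq_zero]
    -- The summands next to the central one already detect a too large projective dimension.
    constructor
    · have := h (Δ₁.codim + 1, Δ₂.codim - 1) (Finset.mem_erase.2 ⟨by simp,
        Finset.HasAntidiagonal.mem_antidiagonal.2 (by dsimp only; omega)⟩)
      exact (mul_eq_zero.1 this).resolve_right
        (bettiNumber_ne_zero_of_le_codim k Δ₂ (Nat.sub_le _ _))
    · have := h (Δ₁.codim - 1, Δ₂.codim + 1) (Finset.mem_erase.2 ⟨by simp,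
        Finset.HasAntidiagonal.mem_antidiagonal.2 (by dsimp only; omega)⟩)
      exact (mul_eq_zero.1 this).resolve_left
        (bettiNumber_ne_zero_of_le_codim k Δ₁ (Nat.sub_le _ _))
  · rintro ⟨hCM₁, hCM₂⟩ ⟨p, q⟩ hpq
    rw [Finset.mem_erase, Finset.HasAntidiagonal.mem_antidiagonal, Ne, Prod.mk.injEq] at hpq
    dsimp only at hpq
    rcases Nat.lt_or_ge Δ₁.codim p with hp | hp
    · rw [(isCohenMacaulay_iff k Δ₁).1 hCM₁ p hp, zero_mul]
    · rw [(isCohenMacaulay_iff k Δ₂).1 hCM₂ q (by omega), mul_zero]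

end TypeDefectJoin

end AbstractSimplicialComplex

theorem mainTheorem11 (k : Type w) [Field k] {V₁ : Type u} {V₂ : Type v} [Fintype V₁] [Fintype V₂]
    (Δ₁ : AbstractSimplicialComplex V₁) (Δ₂ : AbstractSimplicialComplex V₂) :
    (Δ₂.IsSimplex →
      AbstractSimplicialComplex.typeDefect k (Δ₁.join Δ₂) =
        AbstractSimplicialComplex.typeDefect k Δ₁) ∧
    AbstractSimplicialComplex.typeDefect k (Δ₁.join Δ₂) ≥
      AbstractSimplicialComplex.typeDefect k Δ₁ + AbstractSimplicialComplex.typeDefect k Δ₂ - 1 ∧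
    (AbstractSimplicialComplex.typeDefect k (Δ₁.join Δ₂) =
        AbstractSimplicialComplex.typeDefect k Δ₁ +
          AbstractSimplicialComplex.typeDefect k Δ₂ - 1 ↔
      (AbstractSimplicialComplex.IsCohenMacaulay k Δ₁ ∧
        AbstractSimplicialComplex.IsCohenMacaulay k Δ₂) ∧
      (¬ Δ₁.IsSimplex ∧ ¬ Δ₂.IsSimplex) ∧
      (AbstractSimplicialComplex.IsGorenstein k Δ₁ ∨
        AbstractSimplicialComplex.IsGorenstein k Δ₂)) := by
  refine ⟨AbstractSimplicialComplex.typeDefect_join_of_isSimplex_right k Δ₁ Δ₂, ?_⟩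
  by_cases h₁ : Δ₁.IsSimplex
  · rw [AbstractSimplicialComplex.typeDefect_join_of_isSimplex_left k Δ₁ Δ₂ h₁,
      AbstractSimplicialComplex.typeDefect_of_isSimplex k Δ₁ h₁]
    exact ⟨by omega, fun h => by omega, fun h => absurd h₁ h.2.1.1⟩
  by_cases h₂ : Δ₂.IsSimplex
  · rw [AbstractSimplicialComplex.typeDefect_join_of_isSimplex_right k Δ₁ Δ₂ h₂,
      AbstractSimplicialComplex.typeDefect_of_isSimplex k Δ₂ h₂]
    exact ⟨by omega, fun h => by omega, fun h => absurd h₂ h.2.1.2⟩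
  obtain ⟨r, hr, hCM⟩ :=
    AbstractSimplicialComplex.exists_bettiNumber_join_codim k Δ₁ Δ₂ h₁ h₂
  obtain ⟨a, ha⟩ := Nat.exists_eq_succ_of_ne_zero
    (AbstractSimplicialComplex.bettiNumber_codim_ne_zero k Δ₁)
  obtain ⟨b, hb⟩ := Nat.exists_eq_succ_of_ne_zero
    (AbstractSimplicialComplex.bettiNumber_codim_ne_zero k Δ₂)
  -- With `a + 1` and `b + 1` the last Betti numbers, the two sides differ by `a * b + r`.
  have hdiff : AbstractSimplicialComplex.typeDefect k (Δ₁.join Δ₂) =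
      AbstractSimplicialComplex.typeDefect k Δ₁ + AbstractSimplicialComplex.typeDefect k Δ₂ - 1 +
        ((a * b + r : ℕ) : ℤ) := by
    rw [AbstractSimplicialComplex.typeDefect_of_not_isSimplex k Δ₁ h₁,
      AbstractSimplicialComplex.typeDefect_of_not_isSimplex k Δ₂ h₂,
      AbstractSimplicialComplex.typeDefect_of_not_isSimplex k (Δ₁.join Δ₂)
        (mt (fun h => ((AbstractSimplicialComplex.isSimplex_join_iff Δ₁ Δ₂).1 h).1) h₁),
      hr, AbstractSimplicialComplex.codim_join, ha, hb]
    push_cast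
    ring
  refine ⟨by omega, ?_⟩
  rw [hdiff, add_eq_left, Nat.cast_eq_zero, Nat.add_eq_zero_iff, mul_eq_zero, hCM]
  constructor
  · rintro ⟨hab, hCM'⟩
    rw [AbstractSimplicialComplex.isGorenstein_iff k Δ₁ hCM'.1,
      AbstractSimplicialComplex.isGorenstein_iff k Δ₂ hCM'.2, ha, hb]
    exact ⟨hCM', ⟨h₁, h₂⟩, hab.imp (congrArg Nat.succ) (congrArg Nat.succ)⟩
  · rintro ⟨hCM', -, hG⟩
    rw [AbstractSimplicialComplex.isGorenstein_iff k Δ₁ hCM'.1,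
      AbstractSimplicialComplex.isGorenstein_iff k Δ₂ hCM'.2, ha, hb] at hG
    exact ⟨hG.imp Nat.succ_injective.eq_iff.1 Nat.succ_injective.eq_iff.1, hCM'⟩
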